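/- Let $k=\mathbb F_q$ be a finite field, $F=k(t)$, let $S$ be the set of closed points of $\mathbb P^1$ over $k$, and for $s\in S$ let $F_s$ be the completion of $F$ at $s$, $\mathcal O_s\subset F_s$ its ring of integers, $\nu_s$ its valuation; let $\mathbb A$ be the ring of adeles of $F$. Let $D$ be a skew-field with center $F$, $\dim_F D=n^2$, that is unramified outside $\{0,\infty\}$; put $D_s=D\otimes_F F_s$, $G_s=D_s^\times$, $G(F)=D^\times$ and $G(\mathbb A)=(D\otimes_F\mathbb A)^\times$. For every $s\in S\setminus\{0,\infty\}$ fix an isomorphism of $F_s$-algebras $\varphi_s:D_s\to M_n(F_s)$, such that for every $d\in D$ the matrix $\varphi_s(d)$ lies in $M_n(\mathcal O_s)$ for all but finitely many $s$, and let $K_s=\varphi_s^{-1}(GL_n(\mathcal O_s))\subset G_s$. Let $N_\infty$ be the reduced norm of $D_\infty$, and put $$K^1_\infty=\{g\in G_\infty : \nu_\infty(N_\infty(g-1))>0\},\qquad K^1=\prod_{s\in S\setminus\{0,\infty\}}K_s\times K^1_\infty .$$ Embed $G_0$ and $K^1$ in $G(\mathbb A)$ by putting $1$ at the missing places, and embed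 $G(F)$ diagonally. Then the multiplication map $$\kappa:G_0\times K^1\times G(F)\to G(\mathbb A),\qquad \kappa(g,c,\gamma)=g\,c\,\gamma,$$ is a bijection. -/

import Mathlib

open Polynomial IsDedekindDomain
open scoped TensorProduct

noncomputable section

namespace KappaMap

/-! ### The reduced norm of a central simple algebra -/

section ReducedNorm

variable (K : Type*) [Field K] {A : Type*} [Ring A] [Algebra K A]

/-- `c : K` is a reduced norm of `a : A`: for some isomorphism `ψ` of the scalar extension of `A` to
an algebraic closure of `K` with a matrix algebra, `c` is the determinant of `ψ (1 ⊗ a)`. -/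
def IsReducedNorm (a : A) (c : K) : Prop :=
  ∃ (m : ℕ) (ψ : AlgebraicClosure K ⊗[K] A ≃ₐ[AlgebraicClosure K]
      Matrix (Fin m) (Fin m) (AlgebraicClosure K)),
    algebraMap K (AlgebraicClosure K) c = (ψ (1 ⊗ₜ[K] a)).det

open Classical in
/-- The reduced norm `A → K` (for `A` central simple and finite-dimensional over `K` the element `c`
below exists and is unique; for other algebras the value may be meaningless). -/
def reducedNorm (a : A) : K :=
  if h : ∃ c : K, IsReducedNorm K a c then h.choose else 0

end ReducedNorm

/-! ### Points of the projective line, completions, adeles -/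

section Places

variable (k : Type*) [Field k]

/-- The closed points `s ≠ ∞` of the projective line over `k`: the nonzero primes of `k[t]`.
The point `0` is `Polynomial.idealX k`, the ideal generated by `t`. -/
abbrev FinitePlace := HeightOneSpectrum k[X]

variable {k} in
/-- The completion of `F = k(t)` at a point `s ≠ ∞`. -/
abbrev CompletionAt (v : FinitePlace k) := v.adicCompletion (RatFunc k)

variable {k} in
/-- The valuation ring of the completion of `F = k(t)` at a point `s ≠ ∞`. -/
abbrev IntegersAt (v : FinitePlace k) := v.adicCompletionIntegers (RatFunc k)

open Classical in
/-- The completion of `F = k(t)` at `∞`. -/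
abbrev CompletionInfty := RatFunc.CompletionAtInfty k

/-- The ring of adeles of `F = k(t)`. -/
abbrev Adele := CompletionInfty k × FiniteAdeleRing k[X] (RatFunc k)

/-- The projection of the adeles to the completion at `∞`. -/
def adeleToInfty : Adele k →ₐ[RatFunc k] CompletionInfty k :=
  AlgHom.fst (RatFunc k) _ _

variable {k} in
/-- The projection of the adeles to the completion at a point `s ≠ ∞`. -/
def adeleToAt (v : FinitePlace k) : Adele k →ₐ[RatFunc k] CompletionAt v where
  toFun x := x.2 v
  map_one' := rfl
  map_mul' _ _ := rfl
  map_zero' := rfl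
  map_add' _ _ := rfl
  commutes' _ := rfl

end Places

/-! ### The multiplicative group of `D` over completions and adeles -/

section Groups

variable {k : Type*} [Field k]
variable (D : Type*) [DivisionRing D] [Algebra (RatFunc k) D]

/-- The algebra `D_s` at a point `s ≠ ∞`. -/
abbrev AlgAt (v : FinitePlace k) := CompletionAt v ⊗[RatFunc k] D

variable (k) in
/-- The algebra `D_∞`. -/
abbrev AlgInfty := CompletionInfty k ⊗[RatFunc k] D

/-- The group `G_s` at a point `s ≠ ∞`. -/
abbrev GAt (v : FinitePlace k) := (AlgAt D v)ˣ

variable (k) in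
/-- The group `G_∞`. -/
abbrev GInfty := (AlgInfty k D)ˣ

variable (k) in
/-- The group `G(𝔸)` of adelic points. -/
abbrev GAdele := (Adele k ⊗[RatFunc k] D)ˣ

variable {D} in
/-- The component at `s ≠ ∞` of an element of `D ⊗ 𝔸`. -/
def compAt (v : FinitePlace k) : Adele k ⊗[RatFunc k] D →ₐ[RatFunc k] AlgAt D v :=
  Algebra.TensorProduct.map (adeleToAt v) (AlgHom.id (RatFunc k) D)

variable {D} in
/-- The component at `∞` of an element of `D ⊗ 𝔸`. -/
def compInfty : Adele k ⊗[RatFunc k] D →ₐ[RatFunc k] AlgInfty k D :=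
  Algebra.TensorProduct.map (adeleToInfty k) (AlgHom.id (RatFunc k) D)

variable (k) in
/-- The diagonal embedding of `G(F) = Dˣ` into `G(𝔸)`. -/
def diag : Dˣ →* GAdele k D :=
  Units.map (Algebra.TensorProduct.includeRight : D →ₐ[RatFunc k] Adele k ⊗[RatFunc k] D)

variable (k) in
/-- The set `K¹_∞` of all `g` in `G_∞` such that the reduced norm of `g - 1` has positive
(additive) valuation. -/
def K1Infty : Set (GInfty k D) :=
  {g | Valued.v (reducedNorm (CompletionInfty k) ((g : AlgInfty k D) - 1)) < 1}

variable {D}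

variable (k D) in
/-- A choice, for every point `s ≠ 0, ∞`, of an identification of `D_s` with the `n × n` matrix
algebra over `F_s`. -/
abbrev Identifications (n : ℕ) :=
  ∀ v : FinitePlace k, v ≠ idealX k →
    (AlgAt D v ≃ₐ[CompletionAt v] Matrix (Fin n) (Fin n) (CompletionAt v))

variable {n : ℕ}

/-- The identifications are compatible with the global structure of `D`: every `d` in `D` is
an integral matrix at all but finitely many points. -/
def IsCoherent (φ : Identifications k D n) : Prop :=
  ∀ d : D, ∀ᶠ v in Filter.cofinite, ∀ (hv : v ≠ idealX k) (i j : Fin n),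
    φ v hv (1 ⊗ₜ[RatFunc k] d) i j ∈ IntegersAt v

/-- The subgroup `K_s = GL_n(𝒪_s)` of `G_s`, for `s ≠ 0, ∞`. -/
def KAt (φ : Identifications k D n) (v : FinitePlace k) (hv : v ≠ idealX k) :
    Subgroup (GAt D v) :=
  (Matrix.GeneralLinearGroup.map (n := Fin n)
    (algebraMap (IntegersAt v) (CompletionAt v))).range.comap
      (Units.map ((φ v hv : AlgAt D v →* Matrix (Fin n) (Fin n) (CompletionAt v))))

/-- The product `K¹` of all `K_s`, `s ≠ 0, ∞`, and of `K¹_∞`. -/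
abbrev K1 (φ : Identifications k D n) :=
  (∀ v : {v : FinitePlace k // v ≠ idealX k}, KAt φ v.1 v.2) × K1Infty k D

end Groups

/-! ### Adelic points with given components -/

section Components

variable {k : Type*} [Field k]
variable {D : Type*} [DivisionRing D] [Algebra (RatFunc k) D]

lemma exists_sum_mul_mul [Algebra.IsCentral (RatFunc k) D] [FiniteDimensional (RatFunc k) D]
    (f : D →ₗ[RatFunc k] RatFunc k) :
    ∃ s : Finset (D × Dᵐᵒᵖ), ∀ x : D,
      ∑ p ∈ s, p.1 * x * p.2.unop = algebraMap (RatFunc k) D (f x) := by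
  let _ : Module (D ⊗[RatFunc k] Dᵐᵒᵖ) D := TensorProduct.Algebra.module
  have hsm : ∀ (a : D) (c : Dᵐᵒᵖ) (x : D), (a ⊗ₜ[RatFunc k] c) • x = a * x * c.unop := by
    intro a c x
    rw [TensorProduct.Algebra.smul_def, smul_eq_mul, MulOpposite.smul_eq_mul_unop, mul_assoc]
  have : IsSimpleModule (D ⊗[RatFunc k] Dᵐᵒᵖ) D := by
    rw [isSimpleModule_iff_toSpanSingleton_surjective]
    refine ⟨inferInstance, fun x hx y => ⟨(y * x⁻¹) ⊗ₜ 1, ?_⟩⟩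
    rw [LinearMap.toSpanSingleton_apply, hsm]
    simp [hx]
  have hend : ∀ (g : Module.End (D ⊗[RatFunc k] Dᵐᵒᵖ) D),
      ∃ c : RatFunc k, ∀ x, g x = c • x := by
    intro g
    have h1 : ∀ x, g x = x * g 1 := by
      intro x
      have := g.map_smul (x ⊗ₜ[RatFunc k] (1 : Dᵐᵒᵖ)) 1
      rw [hsm, hsm] at this
      simpa using this
    have h2 : ∀ x, g x = g 1 * x := by
      intro x
      have := g.map_smul ((1 : D) ⊗ₜ[RatFunc k] (MulOpposite.op x)) 1
      rw [hsm, hsm] at this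
      simpa using this
    have hc : g 1 ∈ Subalgebra.center (RatFunc k) D := by
      rw [Subalgebra.mem_center_iff]
      intro x
      rw [← h1, h2]
    rw [Algebra.IsCentral.center_eq_bot, Algebra.mem_bot] at hc
    obtain ⟨c, hc⟩ := hc
    refine ⟨c, fun x => ?_⟩
    rw [h2, ← hc, Algebra.smul_def]
  let F' : Module.End (Module.End (D ⊗[RatFunc k] Dᵐᵒᵖ) D) D :=
    { toFun := fun x => algebraMap (RatFunc k) D (f x)
      map_add' := by simp
      map_smul' := by
        intro g x
        obtain ⟨c, hc⟩ := hend g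
        simp only [RingHom.id_apply, Module.End.smul_def, hc]
        rw [map_smul, smul_eq_mul, map_mul, Algebra.smul_def] }
  let b := Module.finBasis (RatFunc k) D
  classical
  obtain ⟨r, hr⟩ := jacobson_density F' (Finset.univ.image b)
  obtain ⟨s, hs⟩ := TensorProduct.exists_finset r
  refine ⟨s, ?_⟩
  have key : (∑ p ∈ s, (LinearMap.mulRight (RatFunc k) p.2.unop) ∘ₗ
      (LinearMap.mulLeft (RatFunc k) p.1)) = (Algebra.linearMap (RatFunc k) D) ∘ₗ f := by
    refine b.ext fun i => ?_
    have h := hr (b i) (by simp)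
    rw [hs, Finset.sum_smul] at h
    simp only [hsm] at h
    simpa [F'] using h.symm
  intro x
  simpa using LinearMap.congr_fun key x

lemma repr_compAt {ι : Type*} (b : Module.Basis ι (RatFunc k) D) (v : FinitePlace k)
    (x : Adele k ⊗[RatFunc k] D) (l : ι) :
    (b.baseChange (CompletionAt v)).repr (compAt v x) l =
      adeleToAt v ((b.baseChange (Adele k)).repr x l) := by
  induction x with
  | zero => simp
  | tmul a d =>
    simp only [compAt, Algebra.TensorProduct.map_tmul, AlgHom.id_apply,
      Module.Basis.baseChange_repr_tmul, map_smul]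
  | add x y hx hy => simp only [map_add, Finsupp.add_apply, hx, hy]

lemma repr_compInfty {ι : Type*} (b : Module.Basis ι (RatFunc k) D)
    (x : Adele k ⊗[RatFunc k] D) (l : ι) :
    (b.baseChange (CompletionInfty k)).repr (compInfty x) l =
      adeleToInfty k ((b.baseChange (Adele k)).repr x l) := by
  induction x with
  | zero => simp
  | tmul a d =>
    simp only [compInfty, Algebra.TensorProduct.map_tmul, AlgHom.id_apply,
      Module.Basis.baseChange_repr_tmul, map_smul]
  | add x y hx hy => simp only [map_add, Finsupp.add_apply, hx, hy]

/-- An element of `D ⊗ 𝔸` is determined by its components. -/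
lemma eq_of_components {x y : Adele k ⊗[RatFunc k] D}
    (hi : compInfty x = compInfty y) (hf : ∀ v, compAt v x = compAt v y) : x = y := by
  let b := Module.Basis.ofVectorSpace (RatFunc k) D
  refine (b.baseChange (Adele k)).repr.injective (Finsupp.ext fun l => Prod.ext ?_ ?_)
  · have := repr_compInfty b x l
    rw [hi, repr_compInfty] at this
    exact this.symm
  · refine FiniteAdeleRing.ext _ fun v => ?_
    have := repr_compAt b v x l
    rw [hf, repr_compAt] at this
    exact this.symm

variable {n : ℕ}

lemma eventually_repr_mem [Algebra.IsCentral (RatFunc k) D] [FiniteDimensional (RatFunc k) D]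
    {φ : Identifications k D n} (hφ : IsCoherent φ) {ι : Type*} [Finite ι]
    (b : Module.Basis ι (RatFunc k) D) :
    ∀ᶠ v in Filter.cofinite, ∀ (hv : v ≠ idealX k) (y : AlgAt D v),
      (∀ i j, φ v hv y i j ∈ IntegersAt v) →
        ∀ l, (b.baseChange (CompletionAt v)).repr y l ∈ IntegersAt v := by
  have H : ∀ l, ∀ᶠ v in Filter.cofinite, ∀ (hv : v ≠ idealX k) (y : AlgAt D v),
      (∀ i j, φ v hv y i j ∈ IntegersAt v) →
        (b.baseChange (CompletionAt v)).repr y l ∈ IntegersAt v := by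
    intro l
    obtain ⟨s, hs⟩ := exists_sum_mul_mul (b.coord l)
    have h1 := (Filter.eventually_all_finset s).2 fun p _ => hφ p.1
    have h2 := (Filter.eventually_all_finset s).2 fun p _ => hφ p.2.unop
    filter_upwards [h1, h2] with v h1 h2 hv y hy
    have key : ∑ p ∈ s, ((1 : CompletionAt v) ⊗ₜ[RatFunc k] p.1) * y * (1 ⊗ₜ[RatFunc k] p.2.unop)
        = algebraMap (CompletionAt v) _ ((b.baseChange (CompletionAt v)).repr y l) := by
      clear hy
      induction y using TensorProduct.induction_on with
      | zero => simp
      | tmul c d =>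
        simp only [Algebra.TensorProduct.tmul_mul_tmul, one_mul, mul_one]
        rw [← TensorProduct.tmul_sum, hs]
        simp [Algebra.algebraMap_eq_smul_one, Algebra.TensorProduct.one_def, TensorProduct.smul_tmul']
      | add x y hx hy =>
        simp only [mul_add, add_mul, Finset.sum_add_distrib, hx, hy, map_add, Finsupp.add_apply]
    rcases Nat.eq_zero_or_pos n with rfl | hn
    · have : y = 0 := (φ v hv).injective (Subsingleton.elim _ _)
      simp [this]
    · have := congrArg (fun M => φ v hv M ⟨0, hn⟩ ⟨0, hn⟩) key
      simp only [map_sum, map_mul, AlgEquiv.commutes, Matrix.sum_apply,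
        Matrix.algebraMap_matrix_apply, if_true, Algebra.algebraMap_self, RingHom.id_apply] at this
      rw [← this]
      refine sum_mem fun p hp => ?_
      rw [Matrix.mul_apply]
      refine sum_mem fun j _ => mul_mem ?_ (h2 p hp hv _ _)
      rw [Matrix.mul_apply]
      exact sum_mem fun i _ => mul_mem (h1 p hp hv _ _) (hy _ _)
  filter_upwards [Filter.eventually_all.2 H] with v h hv y hy l using h l hv y hy

lemma exists_of_components [Algebra.IsCentral (RatFunc k) D] [FiniteDimensional (RatFunc k) D]
    {φ : Identifications k D n} (hφ : IsCoherent φ) (yi : AlgInfty k D) (y : ∀ v, AlgAt D v)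
    (hy : ∀ v (hv : v ≠ idealX k) (i j), φ v hv (y v) i j ∈ IntegersAt v) :
    ∃ x : Adele k ⊗[RatFunc k] D, compInfty x = yi ∧ ∀ v, compAt v x = y v := by
  let b := Module.finBasis (RatFunc k) D
  have hX : ∀ᶠ v : FinitePlace k in Filter.cofinite, v ≠ idealX k := by
    simp [Filter.eventually_cofinite]
  have hint : ∀ l, ∀ᶠ v in Filter.cofinite,
      (b.baseChange (CompletionAt v)).repr (y v) l ∈ IntegersAt v := by
    intro l
    filter_upwards [hX, eventually_repr_mem hφ b] with v h1 h2 using h2 h1 _ (hy v h1) l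
  let a : Fin _ → Adele k := fun l =>
    ((b.baseChange (CompletionInfty k)).repr yi l,
      ⟨fun v => (b.baseChange (CompletionAt v)).repr (y v) l, hint l⟩)
  refine ⟨(b.baseChange (Adele k)).equivFun.symm a, ?_, fun v => ?_⟩
  · refine (b.baseChange (CompletionInfty k)).repr.injective (Finsupp.ext fun l => ?_)
    rw [repr_compInfty, ← Module.Basis.equivFun_apply, LinearEquiv.apply_symm_apply]
    rfl
  · refine (b.baseChange (CompletionAt v)).repr.injective (Finsupp.ext fun l => ?_)
    rw [repr_compAt, ← Module.Basis.equivFun_apply, LinearEquiv.apply_symm_apply]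
    rfl

lemma integral_of_mem_KAt {φ : Identifications k D n} {v : FinitePlace k} {hv : v ≠ idealX k}
    {u : GAt D v} (hu : u ∈ KAt φ v hv) (i j : Fin n) :
    φ v hv (u : AlgAt D v) i j ∈ IntegersAt v := by
  obtain ⟨g, hg⟩ := hu
  have := congrArg (fun M : GL (Fin n) (CompletionAt v) => M.1 i j) hg
  change _ = φ v hv (u : AlgAt D v) i j at this
  rw [← this]
  exact (g.1 i j).2

lemma exists_adelicPoint [Algebra.IsCentral (RatFunc k) D] [FiniteDimensional (RatFunc k) D]
    {φ : Identifications k D n} (hφ : IsCoherent φ) (gi : GInfty k D) (g : ∀ v, GAt D v)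
    (hg : ∀ v (hv : v ≠ idealX k), g v ∈ KAt φ v hv) :
    ∃ x : GAdele k D, compInfty (x : Adele k ⊗[RatFunc k] D) = gi ∧
      ∀ v, compAt v (x : Adele k ⊗[RatFunc k] D) = g v := by
  obtain ⟨x, hxi, hx⟩ := exists_of_components hφ gi (fun v => g v)
    fun v hv => integral_of_mem_KAt (hg v hv)
  obtain ⟨y, hyi, hy⟩ := exists_of_components hφ (gi⁻¹ : GInfty k D)
    (fun v => ((g v)⁻¹ : GAt D v)) fun v hv => integral_of_mem_KAt (inv_mem (hg v hv))
  refine ⟨⟨x, y, eq_of_components ?_ fun v => ?_, eq_of_components ?_ fun v => ?_⟩, hxi, hx⟩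
  · rw [map_mul, hxi, hyi, map_one, Units.mul_inv]
  · rw [map_mul, hx, hy, map_one, Units.mul_inv]
  · rw [map_mul, hxi, hyi, map_one, Units.inv_mul]
  · rw [map_mul, hx, hy, map_one, Units.inv_mul]

/-- The point of `G(𝔸)` with the given components `gi` at `∞` and `g v` at `v ≠ ∞`, where `g v`
lies in `K_v` for all `v ≠ 0, ∞`. It is unique by `eq_of_components`. -/
def adelicPoint [Algebra.IsCentral (RatFunc k) D] [FiniteDimensional (RatFunc k) D]
    {φ : Identifications k D n} (hφ : IsCoherent φ) (gi : GInfty k D) (g : ∀ v, GAt D v)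
    (hg : ∀ v (hv : v ≠ idealX k), g v ∈ KAt φ v hv) : GAdele k D :=
  (exists_adelicPoint hφ gi g hg).choose

lemma adelicPoint_spec [Algebra.IsCentral (RatFunc k) D] [FiniteDimensional (RatFunc k) D]
    {φ : Identifications k D n} (hφ : IsCoherent φ) (gi : GInfty k D) (g : ∀ v, GAt D v)
    (hg : ∀ v (hv : v ≠ idealX k), g v ∈ KAt φ v hv) :
    compInfty (adelicPoint hφ gi g hg : Adele k ⊗[RatFunc k] D) = gi ∧
      ∀ v, compAt v (adelicPoint hφ gi g hg : Adele k ⊗[RatFunc k] D) = g v :=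
  (exists_adelicPoint hφ gi g hg).choose_spec

open Classical in
/-- The inclusion of `G_0` in `G(𝔸)`: component `g` at `0` and `1` at all other points. -/
def inclG0 [Algebra.IsCentral (RatFunc k) D] [FiniteDimensional (RatFunc k) D]
    {φ : Identifications k D n} (hφ : IsCoherent φ) (g : GAt D (idealX k)) : GAdele k D :=
  adelicPoint hφ 1 (Function.update 1 (idealX k) g) fun v hv => by
    rw [Function.update_of_ne hv]
    exact one_mem _

open Classical in
/-- The inclusion of `K¹` in `G(𝔸)`: the given components at the points other than `0`, and `1` at
the point `0`. -/
def inclK1 [Algebra.IsCentral (RatFunc k) D] [FiniteDimensional (RatFunc k) D]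
    {φ : Identifications k D n} (hφ : IsCoherent φ) (c : K1 φ) : GAdele k D :=
  adelicPoint hφ c.2 (fun v => if hv : v ≠ idealX k then (c.1 ⟨v, hv⟩ : GAt D v) else 1)
    fun v hv => by
      rw [dif_pos hv]
      exact (c.1 ⟨v, hv⟩).2

/-- The multiplication map `κ : G_0 × K¹ × G(F) → G(𝔸)`. -/
def kappa [Algebra.IsCentral (RatFunc k) D] [FiniteDimensional (RatFunc k) D]
    {φ : Identifications k D n} (hφ : IsCoherent φ) :
    GAt D (idealX k) × K1 φ × Dˣ → GAdele k D :=
  fun x => inclG0 hφ x.1 * inclK1 hφ x.2.1 * diag k D x.2.2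

end Components

end KappaMap

end

/-! Let `Γ` be the diagonal copy of `D` in `D ⊗ 𝔸` (`globalPoints`) and `q` the order of `k`. A
family of local lattices, almost all standard, is a vector bundle on the projective line; `box` is
its group `U` of integral adeles, and `euler` is |H⁰| / |H¹| with H⁰ = Γ ∩ U and H¹ = (D ⊗ 𝔸) / (Γ +
U). A change of lattices multiplies it by the local indices (`IsLatticeFamily.euler_box`), right
multiplication by `Dˣ` preserves it (`euler_translate`, `translate_diag`), and for the trivial
bundle it is `q` to the power n² (`euler_std`).

Let `A` be the bundle of orders that is a maximal order at 0 and ∞ and consists of integral matrices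
elsewhere. Locally `D_0` and `D_∞` are matrix algebras of sizes `r₀` and `r` over division algebras.
Duality with respect to a central functional (a multiple of the reduced trace) shows that the square
of the Euler characteristic of `A` is `q ^ ((r₀ + r) * n)` (`euler_order_pow`). On the other hand
H⁰(A) is a finite subring of `D`, so its nonzero elements are invertible in it, and the first column
of the reduction at the rational point 1 embeds it into k^n (`card_inf_orderBox_le`). Hence `r₀ = r
= 1`: both `D_0` and `D_∞` are division algebras, and `A` has Euler characteristic `q ^ n`
(`euler_order`).

Injectivity: if two triples have the same image, the quotient δ of their global components is a unit
of the order off 0 and ∞ and is congruent to 1 modulo the radical at ∞. One of δ, δ⁻¹ is integral at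
0, hence lies in H⁰(A). Were it different from 1, its difference with 1 would be invertible in
H⁰(A), although it has value less than 1 at ∞.

Surjectivity: left multiplication of `x` by a uniformizer of `D_0` divides the Euler characteristic
of `A x` by `q ^ n`, so it may be assumed to lie in (1, q^n]. Then `A x` has a nonzero section `d`,
and comparing Euler characteristics turns `A d ⊆ A x` into an equality. Consequently no nonzero
section lies in the subbundle of `A x` with the radical at ∞; that subbundle has index `q ^ n` and
there are at least `q ^ n` sections, so some section `d` is congruent to `x` at ∞
(`exists_approx_global`). Now x d⁻¹ belongs to G_0 K¹.

The local input is the structure of a central division algebra over a local field of characteristic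
`p`: the norm valuation, a coefficient field of Teichmüller elements, and a uniformizer normalizing
it. They yield the dimension, the order of the residue field, the dual of the maximal order and the
existence of reduced norms. -/

noncomputable section

namespace KappaMap

/-! ### Generalized indices of commensurable subgroups -/

section Index

variable {G : Type*} [AddCommGroup G]

/-- The generalized index `[U : U ∩ V] / [V : U ∩ V]`. -/
def genIndex (U V : AddSubgroup G) : ℚ := (V.relIndex U : ℚ) / U.relIndex V

lemma genIndex_self (U : AddSubgroup G) : genIndex U U = 1 := by simp [genIndex]

lemma genIndex_inv (U V : AddSubgroup G) : (genIndex U V)⁻¹ = genIndex V U := by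
  simp [genIndex]

lemma genIndex_of_le {U V : AddSubgroup G} (h : V ≤ U) : genIndex U V = V.relIndex U := by
  simp [genIndex, AddSubgroup.relIndex_eq_one.2 h]

lemma genIndex_pos {U V : AddSubgroup G} (h : U.Commensurable V) : 0 < genIndex U V :=
  div_pos (by exact_mod_cast Nat.pos_of_ne_zero h.2) (by exact_mod_cast Nat.pos_of_ne_zero h.1)

/-- Indices multiply along `T ≤ U ⊓ V ≤ U` and `T ≤ U ⊓ V ≤ V`, and the common factor `[U ⊓ V : T]`
cancels. -/
lemma genIndex_eq_div {U V T : AddSubgroup G} (hU : T ≤ U) (hV : T ≤ V)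
    (h1 : T.relIndex U ≠ 0) :
    genIndex U V = (T.relIndex U : ℚ) / T.relIndex V := by
  have e1 := AddSubgroup.relIndex_mul_relIndex T (U ⊓ V) U (le_inf hU hV) inf_le_left
  have e2 := AddSubgroup.relIndex_mul_relIndex T (U ⊓ V) V (le_inf hU hV) inf_le_right
  rw [AddSubgroup.inf_relIndex_left] at e1
  rw [AddSubgroup.inf_relIndex_right] at e2
  have h0 : (T.relIndex (U ⊓ V) : ℚ) ≠ 0 := by
    intro h
    rw [Nat.cast_eq_zero] at h
    rw [h, zero_mul] at e1
    exact h1 e1.symm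
  rw [← e1, ← e2]
  push_cast
  rw [mul_div_mul_left _ _ h0, genIndex]

/-- All three generalized indices can be measured against the common subgroup `U ⊓ V ⊓ W`. -/
lemma genIndex_mul {U V W : AddSubgroup G} (h1 : U.Commensurable V) (h2 : V.Commensurable W) :
    genIndex U V * genIndex V W = genIndex U W := by
  have h3 := h1.trans h2
  have hU : (U ⊓ V ⊓ W).relIndex U ≠ 0 :=
    AddSubgroup.relIndex_inf_ne_zero (AddSubgroup.relIndex_inf_ne_zero (by simp) h1.2) h3.2
  have hV : (U ⊓ V ⊓ W).relIndex V ≠ 0 :=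
    AddSubgroup.relIndex_inf_ne_zero (AddSubgroup.relIndex_inf_ne_zero h1.1 (by simp)) h2.2
  have hW : (U ⊓ V ⊓ W).relIndex W ≠ 0 :=
    AddSubgroup.relIndex_inf_ne_zero (AddSubgroup.relIndex_inf_ne_zero h3.1 h2.1) (by simp)
  have hV' : ((U ⊓ V ⊓ W).relIndex V : ℚ) ≠ 0 := by exact_mod_cast hV
  rw [genIndex_eq_div (inf_le_left.trans inf_le_left) (inf_le_left.trans inf_le_right) hU,
    genIndex_eq_div (inf_le_left.trans inf_le_right) inf_le_right hV,
    genIndex_eq_div (inf_le_left.trans inf_le_left) inf_le_right hU, div_mul_div_cancel₀ hV']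

variable {H : Type*} [AddCommGroup H]

lemma genIndex_map {f : G →+ H} (hf : Function.Injective f) (U V : AddSubgroup G) :
    genIndex (U.map f) (V.map f) = genIndex U V := by
  simp only [genIndex, AddSubgroup.relIndex_map_map_of_injective _ _ hf]

lemma commensurable_map {f : G →+ H} (hf : Function.Injective f) {U V : AddSubgroup G}
    (h : U.Commensurable V) : (U.map f).Commensurable (V.map f) := by
  simpa only [AddSubgroup.Commensurable, AddSubgroup.relIndex_map_map_of_injective _ _ hf] using h

lemma commensurable_of_map {f : G →+ H} (hf : Function.Injective f) {U V : AddSubgroup G}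
    (h : (U.map f).Commensurable (V.map f)) : U.Commensurable V := by
  simpa only [AddSubgroup.Commensurable, AddSubgroup.relIndex_map_map_of_injective _ _ hf] using h

lemma commensurable_of_le {U V : AddSubgroup G} (h : V ≤ U) (h0 : V.relIndex U ≠ 0) :
    U.Commensurable V :=
  ⟨by simp [AddSubgroup.relIndex_eq_one.2 h], h0⟩

lemma eq_of_genIndex_eq_one {U V : AddSubgroup G} (h : V ≤ U) (h1 : genIndex U V = 1) : V = U := by
  rw [genIndex_of_le h, Nat.cast_eq_one, AddSubgroup.relIndex_eq_one] at h1
  exact le_antisymm h h1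

lemma one_le_genIndex {U V : AddSubgroup G} (h : V ≤ U) (hc : U.Commensurable V) :
    1 ≤ genIndex U V := by
  rw [genIndex_of_le h]
  exact_mod_cast Nat.one_le_iff_ne_zero.2 hc.2

/-! ### Multiplicative Euler characteristics -/

variable (Γ : AddSubgroup G)

/-- `U` meets `Γ` in a finite group, and `Γ + U` has finite index. -/
def IsBounded (U : AddSubgroup G) : Prop := Nat.card ↥(Γ ⊓ U) ≠ 0 ∧ (Γ ⊔ U).index ≠ 0

/-- The quotient of the orders of `Γ ∩ U` and of `G / (Γ + U)`. -/
def euler (U : AddSubgroup G) : ℚ := (Nat.card ↥(Γ ⊓ U) : ℚ) / (Γ ⊔ U).index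

variable {Γ}

/-- Insert `V + Γ ∩ U` between `V` and `U`: by the modular law the lower quotient is `(Γ ∩ U) / (Γ ∩
V)` and the upper one is `(Γ + U) / (Γ + V)`. This is the cohomology sequence in multiplicative
form. -/
lemma relIndex_eq_mul_relIndex {U V : AddSubgroup G} (h : V ≤ U) :
    V.relIndex U = (Γ ⊓ V).relIndex (Γ ⊓ U) * (Γ ⊔ V).relIndex (Γ ⊔ U) := by
  have hm : (Γ ⊔ V) ⊓ U = V ⊔ Γ ⊓ U := by
    rw [sup_comm, sup_inf_assoc_of_le _ h]
  rw [← AddSubgroup.relIndex_mul_relIndex V (V ⊔ Γ ⊓ U) U le_sup_left (sup_le h inf_le_right),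
    AddSubgroup.relIndex_sup_left, ← hm, AddSubgroup.inf_relIndex_right]
  congr 1
  · rw [← AddSubgroup.inf_relIndex_right, ← inf_assoc, inf_comm V Γ, inf_assoc,
      inf_eq_left.2 h]
  · rw [← AddSubgroup.relIndex_sup_left U (Γ ⊔ V), sup_assoc, sup_eq_right.2 h]

lemma card_inf_eq {U V : AddSubgroup G} (h : V ≤ U) :
    Nat.card ↥(Γ ⊓ U) = Nat.card ↥(Γ ⊓ V) * (Γ ⊓ V).relIndex (Γ ⊓ U) := by
  rw [← AddSubgroup.relIndex_bot_left, ← AddSubgroup.relIndex_bot_left,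
    AddSubgroup.relIndex_mul_relIndex _ _ _ bot_le (inf_le_inf_left _ h)]

lemma index_sup_eq {U V : AddSubgroup G} (h : V ≤ U) :
    (Γ ⊔ V).index = (Γ ⊔ V).relIndex (Γ ⊔ U) * (Γ ⊔ U).index :=
  (AddSubgroup.relIndex_mul_index (sup_le_sup_left h _)).symm

lemma isBounded_iff_of_le {U V : AddSubgroup G} (h : V ≤ U) (h0 : V.relIndex U ≠ 0) :
    IsBounded Γ U ↔ IsBounded Γ V := by
  rw [relIndex_eq_mul_relIndex (Γ := Γ) h, mul_ne_zero_iff] at h0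
  rw [IsBounded, IsBounded, card_inf_eq h, index_sup_eq h, mul_ne_zero_iff, mul_ne_zero_iff]
  tauto

lemma IsBounded.of_commensurable {U V : AddSubgroup G} (hV : IsBounded Γ V)
    (h : U.Commensurable V) : IsBounded Γ U := by
  have h1 : IsBounded Γ (U ⊓ V) := (isBounded_iff_of_le inf_le_right (by
    rw [AddSubgroup.inf_relIndex_right]; exact h.1)).1 hV
  exact (isBounded_iff_of_le inf_le_left (by
    rw [AddSubgroup.inf_relIndex_left]; exact h.2)).2 h1

lemma euler_eq_of_le {U V : AddSubgroup G} (h : V ≤ U) (h0 : V.relIndex U ≠ 0)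
    (hV : IsBounded Γ V) : euler Γ U = V.relIndex U * euler Γ V := by
  have hU := (isBounded_iff_of_le h h0).2 hV
  rw [relIndex_eq_mul_relIndex (Γ := Γ) h] at h0 ⊢
  rw [mul_ne_zero_iff] at h0
  have h2 : ((Γ ⊔ V).relIndex (Γ ⊔ U) : ℚ) ≠ 0 := by exact_mod_cast h0.2
  have h3 : ((Γ ⊔ U).index : ℚ) ≠ 0 := by exact_mod_cast hU.2
  rw [euler, euler, card_inf_eq h, index_sup_eq h]
  push_cast
  field_simp

/-- The Riemann–Roch principle: the Euler characteristic depends on `U` only through its index. Both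
sides are compared with `U ⊓ V`. -/
lemma euler_eq {U V : AddSubgroup G} (h : U.Commensurable V) (hV : IsBounded Γ V) :
    euler Γ U = genIndex U V * euler Γ V := by
  have h1 : (U ⊓ V).relIndex V ≠ 0 := by rw [AddSubgroup.inf_relIndex_right]; exact h.1
  have h2 : (U ⊓ V).relIndex U ≠ 0 := by rw [AddSubgroup.inf_relIndex_left]; exact h.2
  have hi := (isBounded_iff_of_le inf_le_right h1).1 hV
  rw [euler_eq_of_le inf_le_left h2 hi, euler_eq_of_le inf_le_right h1 hi,
    genIndex_eq_div inf_le_left inf_le_right h2]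
  have h1' : ((U ⊓ V).relIndex V : ℚ) ≠ 0 := by exact_mod_cast h1
  field_simp

lemma euler_map (e : G ≃+ G) (he : Γ.map (e : G →+ G) = Γ) (U : AddSubgroup G) :
    euler Γ (U.map (e : G →+ G)) = euler Γ U := by
  have h1 : Γ ⊓ U.map (e : G →+ G) = (Γ ⊓ U).map (e : G →+ G) := by
    rw [AddSubgroup.map_inf _ _ _ e.injective, he]
  have h2 : Γ ⊔ U.map (e : G →+ G) = (Γ ⊔ U).map (e : G →+ G) := by
    rw [AddSubgroup.map_sup, he]
  -- Orders and indices become relative indices from `⊥` and in `⊤`, which the automorphism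
  -- preserves.
  rw [euler, euler, h1, h2, ← AddSubgroup.relIndex_bot_left, ← AddSubgroup.relIndex_bot_left,
    ← AddSubgroup.relIndex_top_right, ← AddSubgroup.relIndex_top_right]
  have hb : (⊥ : AddSubgroup G) = (⊥ : AddSubgroup G).map (e : G →+ G) := by simp
  have ht : (⊤ : AddSubgroup G) = (⊤ : AddSubgroup G).map (e : G →+ G) :=
    (AddSubgroup.map_top_of_surjective _ e.surjective).symm
  rw [hb, AddSubgroup.relIndex_map_map_of_injective _ _ e.injective, ← hb, ht,
    AddSubgroup.relIndex_map_map_of_injective _ _ e.injective, ← ht]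

lemma euler_le_card {U : AddSubgroup G} (hU : IsBounded Γ U) :
    euler Γ U ≤ Nat.card ↥(Γ ⊓ U) := by
  refine div_le_self (by positivity) ?_
  exact_mod_cast Nat.one_le_iff_ne_zero.2 hU.2

lemma euler_pos {U : AddSubgroup G} (hU : IsBounded Γ U) : 0 < euler Γ U :=
  div_pos (by exact_mod_cast Nat.pos_of_ne_zero hU.1) (by exact_mod_cast Nat.pos_of_ne_zero hU.2)

end Index


/-! ### Lattices over discrete valuation rings with finite residue field -/

section Lattice

open WithZero
open scoped WithZero

/-- The absolute value on the value group with value `q⁻¹` at a uniformizer. -/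
def absValue (q : ℕ) (x : ℤᵐ⁰) : ℚ := if x = 0 then 0 else (q : ℚ) ^ log x

lemma absValue_one (q : ℕ) : absValue q 1 = 1 := by simp [absValue]

lemma absValue_exp (q : ℕ) (i : ℤ) : absValue q (exp i) = (q : ℚ) ^ i := by simp [absValue]

lemma absValue_mul {q : ℕ} (hq : q ≠ 0) (x y : ℤᵐ⁰) :
    absValue q (x * y) = absValue q x * absValue q y := by
  have : (q : ℚ) ≠ 0 := by exact_mod_cast hq
  rcases eq_or_ne x 0 with rfl | hx
  · simp [absValue]
  rcases eq_or_ne y 0 with rfl | hy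
  · simp [absValue]
  simp [absValue, hx, hy, log_mul, zpow_add₀ this]

lemma absValue_pow {q : ℕ} (hq : q ≠ 0) (x : ℤᵐ⁰) (m : ℕ) :
    absValue q (x ^ m) = absValue q x ^ m := by
  induction m with
  | zero => simp [absValue_one]
  | succ m ih => rw [pow_succ, pow_succ, absValue_mul hq, ih]

lemma absValue_inv {q : ℕ} (hq : q ≠ 0) (x : ℤᵐ⁰) :
    absValue q x⁻¹ = (absValue q x)⁻¹ := by
  rcases eq_or_ne x 0 with rfl | hx
  · simp [absValue]
  refine eq_inv_of_mul_eq_one_left ?_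
  rw [← absValue_mul hq, inv_mul_cancel₀ hx, absValue_one]

lemma absValue_pos {q : ℕ} (hq : q ≠ 0) {x : ℤᵐ⁰} (hx : x ≠ 0) : 0 < absValue q x := by
  rw [absValue, if_neg hx]
  have : (0 : ℚ) < q := by exact_mod_cast Nat.pos_of_ne_zero hq
  positivity

lemma eq_exp_of_ne_zero {x : ℤᵐ⁰} (hx : x ≠ 0) : ∃ i : ℤ, x = exp i := ⟨log x, (exp_log hx).symm⟩

variable {K : Type*} [Field K] (v : Valuation K ℤᵐ⁰)

/-- The group of all elements of valuation at most `r`. -/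
def ball {R : Type*} [Ring R] (v : Valuation R ℤᵐ⁰) (r : ℤᵐ⁰) : AddSubgroup R where
  carrier := {x | v x ≤ r}
  add_mem' := fun ha hb => (v.map_add _ _).trans (max_le ha hb)
  zero_mem' := by simp
  neg_mem' := by simp

lemma mem_ball {R : Type*} [Ring R] {v : Valuation R ℤᵐ⁰} {r : ℤᵐ⁰} {x : R} : x ∈ ball v r ↔ v x ≤ r := Iff.rfl

/-- `v` is a normalized discrete valuation whose residue field has `q` elements. -/
structure IsDiscreteWithCard (q : ℕ) : Prop where
  exists_uniformizer : ∃ ϖ, v ϖ = exp (-1 : ℤ)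
  relIndex_eq : (ball v (exp (-1 : ℤ))).relIndex (ball v 1) = q
  ne_zero : q ≠ 0

/-- The lattice of vectors with integral coordinates. -/
def stdLattice (ι : Type*) : AddSubgroup (ι → K) where
  carrier := {x | ∀ i, v (x i) ≤ 1}
  add_mem' := fun ha hb i => (v.map_add _ _).trans (max_le (ha i) (hb i))
  zero_mem' := by simp
  neg_mem' := by simp

variable {v}

lemma ne_zero_of_valuation_eq_exp {x : K} {i : ℤ} (h : v x = exp i) : x ≠ 0 := by
  rintro rfl
  rw [map_zero] at h
  exact exp_ne_zero h.symm

variable {ι : Type*} [Fintype ι] [DecidableEq ι] {q : ℕ}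

/-- The effect of a matrix on the index of lattices is given by its determinant. -/
def ScalesIndex (v : Valuation K ℤᵐ⁰) (q : ℕ) (g : Matrix ι ι K) : Prop :=
  (stdLattice v ι).Commensurable ((stdLattice v ι).map g.mulVecLin.toAddMonoidHom) ∧
    genIndex (stdLattice v ι) ((stdLattice v ι).map g.mulVecLin.toAddMonoidHom) *
      absValue q (v g.det) = 1

omit [DecidableEq ι] in
lemma map_mulVecLin_mul (g h : Matrix ι ι K) (L : AddSubgroup (ι → K)) :
    L.map (g * h).mulVecLin.toAddMonoidHom =
      (L.map h.mulVecLin.toAddMonoidHom).map g.mulVecLin.toAddMonoidHom := by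
  rw [Matrix.mulVecLin_mul, AddSubgroup.map_map]
  rfl

lemma mulVecLin_injective {g : Matrix ι ι K} (hg : g.det ≠ 0) :
    Function.Injective g.mulVecLin.toAddMonoidHom := by
  have := Matrix.mulVec_injective_of_isUnit ((Matrix.isUnit_iff_isUnit_det g).2 hg.isUnit)
  exact this

/-- For the standard lattice L one has [L : ghL] = [L : gL] · [gL : ghL], and the last factor is [L
: hL] because `g` is injective. This reduces the index formula to generators. -/
lemma ScalesIndex.mul (hq : q ≠ 0) {g h : Matrix ι ι K} (hg0 : g.det ≠ 0)
    (hg : ScalesIndex v q g) (hh : ScalesIndex v q h) : ScalesIndex v q (g * h) := by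
  rw [ScalesIndex, map_mulVecLin_mul]
  have hc := commensurable_map (mulVecLin_injective hg0) hh.1
  refine ⟨hg.1.trans hc, ?_⟩
  rw [← genIndex_mul hg.1 hc, genIndex_map (mulVecLin_injective hg0), Matrix.det_mul, map_mul,
    absValue_mul hq]
  rw [mul_mul_mul_comm, hg.2, hh.2, one_mul]

omit [DecidableEq ι] in
lemma map_stdLattice_le {g : Matrix ι ι K} (hg : ∀ i j, v (g i j) ≤ 1) :
    (stdLattice v ι).map g.mulVecLin.toAddMonoidHom ≤ stdLattice v ι := by
  rintro _ ⟨x, hx, rfl⟩ i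
  refine v.map_sum_le fun j _ => ?_
  rw [map_mul]
  exact mul_le_one' (hg i j) (hx j)

lemma scalesIndex_of_integral {g h : Matrix ι ι K} (hgh : g * h = 1)
    (hg : ∀ i j, v (g i j) ≤ 1) (hh : ∀ i j, v (h i j) ≤ 1) (hd : v g.det = 1) :
    ScalesIndex v q g := by
  have : (stdLattice v ι).map g.mulVecLin.toAddMonoidHom = stdLattice v ι := by
    refine le_antisymm (map_stdLattice_le hg) ?_
    have := AddSubgroup.map_mono (f := g.mulVecLin.toAddMonoidHom) (map_stdLattice_le hh)
    rw [← map_mulVecLin_mul, hgh] at this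
    intro x hx
    exact this ⟨x, hx, by simp⟩
  rw [ScalesIndex, this, genIndex_self, hd, absValue_one, one_mul]
  exact ⟨AddSubgroup.Commensurable.refl _, rfl⟩

lemma scalesIndex_diagonal_uniformizer (hv : IsDiscreteWithCard v q) {ϖ : K}
    (hϖ : v ϖ = exp (-1 : ℤ)) (i : ι) :
    ScalesIndex v q (Matrix.diagonal (Function.update 1 i ϖ)) := by
  have hϖ0 : ϖ ≠ 0 := ne_zero_of_valuation_eq_exp hϖ
  have h1 : (exp (-1 : ℤ) : ℤᵐ⁰) ≤ 1 := by rw [← exp_zero, exp_le_exp]; norm_num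
  set L := (stdLattice v ι).map
    (Matrix.diagonal (Function.update 1 i ϖ)).mulVecLin.toAddMonoidHom with hL
  have hle : L ≤ stdLattice v ι := by
    refine map_stdLattice_le fun a b => ?_
    rw [Matrix.diagonal_apply]
    split_ifs
    · rcases eq_or_ne a i with rfl | ha
      · simpa [hϖ] using h1
      · simp [ha]
    · simp
  let pr : (ι → K) →+ K := Pi.evalAddMonoidHom _ i
  -- The image is cut out of the lattice by a single condition on the `i`-th coordinate, so its
  -- index is that of the maximal ideal.
  have hinf : L = (ball v (exp (-1 : ℤ))).comap pr ⊓ stdLattice v ι := by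
    ext x
    constructor
    · intro hx
      refine ⟨?_, hle hx⟩
      obtain ⟨y, hy, rfl⟩ := hx
      change v ((Matrix.diagonal (Function.update (1 : ι → K) i ϖ)).mulVec y i) ≤ _
      rw [Matrix.mulVec_diagonal, Function.update_self, map_mul, hϖ]
      exact mul_le_of_le_one_right' (hy i)
    · rintro ⟨hx1, hx2⟩
      refine ⟨fun j => (Function.update (1 : ι → K) i ϖ j)⁻¹ * x j, fun j => ?_, ?_⟩
      · rcases eq_or_ne j i with rfl | hj
        · simp only [Function.update_self, map_mul, map_inv₀, hϖ]
          rw [inv_mul_le_iff₀ (by simp [exp_pos]), mul_one]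
          exact hx1
        · simpa [hj] using hx2 j
      · ext j
        simp only [LinearMap.toAddMonoidHom_coe, Matrix.mulVecLin_apply, Matrix.mulVec_diagonal]
        refine mul_inv_cancel_left₀ ?_ _
        rcases eq_or_ne j i with rfl | hj
        · simpa using hϖ0
        · simp [hj]
  have hmap : (stdLattice v ι).map pr = ball v 1 := by
    ext x
    constructor
    · rintro ⟨y, hy, rfl⟩
      exact hy i
    · intro hx
      refine ⟨Pi.single i x, fun j => ?_, by simp [pr]⟩
      rcases eq_or_ne j i with rfl | hj
      · simpa using (show v x ≤ 1 from hx)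
      · simp [hj]
  have hrel : L.relIndex (stdLattice v ι) = q := by
    rw [hinf, AddSubgroup.inf_relIndex_right, AddSubgroup.relIndex_comap, hmap, hv.relIndex_eq]
  have hq : (q : ℚ) ≠ 0 := by exact_mod_cast hv.ne_zero
  refine ⟨commensurable_of_le hle (by rw [hrel]; exact hv.ne_zero), ?_⟩
  rw [genIndex_of_le hle, hrel, Matrix.det_diagonal,
    Finset.prod_update_of_mem (Finset.mem_univ i)]
  simp only [Pi.one_apply, Finset.prod_const_one, mul_one]
  rw [hϖ, absValue_exp, zpow_neg_one, mul_inv_cancel₀ hq]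

lemma scalesIndex_diagonal_update (hv : IsDiscreteWithCard v q) (i : ι) {u : K} (hu : u ≠ 0) :
    ScalesIndex v q (Matrix.diagonal (Function.update 1 i u)) := by
  obtain ⟨ϖ, hϖ⟩ := hv.exists_uniformizer
  have hϖ0 : ϖ ≠ 0 := ne_zero_of_valuation_eq_exp hϖ
  have hmul : ∀ a b : K, Matrix.diagonal (Function.update (1 : ι → K) i (a * b)) =
      Matrix.diagonal (Function.update 1 i a) * Matrix.diagonal (Function.update 1 i b) := by
    intro a b
    rw [Matrix.diagonal_mul_diagonal]
    congr 1
    ext j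
    rcases eq_or_ne j i with rfl | hj <;> simp [*]
  have hdet : ∀ a : K, (Matrix.diagonal (Function.update (1 : ι → K) i a)).det = a := by
    intro a
    rw [Matrix.det_diagonal, Finset.prod_update_of_mem (Finset.mem_univ i)]
    simp
  have hunit : ∀ a : K, v a = 1 → ScalesIndex v q (Matrix.diagonal (Function.update 1 i a)) := by
    intro a ha
    have ha0 : a ≠ 0 := by rintro rfl; simp at ha
    have hint : ∀ c : K, v c = 1 →
        ∀ j l, v (Matrix.diagonal (Function.update (1 : ι → K) i c) j l) ≤ 1 := by
      intro c hc j l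
      rw [Matrix.diagonal_apply]
      split_ifs
      · rcases eq_or_ne j i with rfl | hj
        · simp [hc]
        · rw [Function.update_of_ne hj]
          simp
      · simp
    refine scalesIndex_of_integral (h := Matrix.diagonal (Function.update 1 i a⁻¹)) ?_
      (hint a ha) (hint _ (by simp [ha])) (by rw [hdet, ha])
    rw [← hmul, mul_inv_cancel₀ ha0, Function.update_eq_self_iff.2 (by simp)]
    simp
  have hpow : ∀ m : ℕ, ScalesIndex v q (Matrix.diagonal (Function.update 1 i (ϖ ^ m))) := by
    intro m
    induction m with
    | zero => exact hunit _ (by simp)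
    | succ m ih =>
      rw [pow_succ, hmul]
      exact ih.mul hv.ne_zero (by rw [hdet]; exact pow_ne_zero _ hϖ0)
        (scalesIndex_diagonal_uniformizer hv hϖ i)
  have hint : ∀ a : K, a ≠ 0 → v a ≤ 1 →
      ScalesIndex v q (Matrix.diagonal (Function.update 1 i a)) := by
    intro a ha ha1
    obtain ⟨m, hm⟩ := eq_exp_of_ne_zero ((v.ne_zero_iff).2 ha)
    have hm0 : m ≤ 0 := by rwa [hm, ← exp_zero, exp_le_exp] at ha1
    obtain ⟨l, rfl⟩ : ∃ l : ℕ, m = -l := ⟨m.natAbs, by omega⟩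
    have : a = ϖ ^ l * (a * (ϖ ^ l)⁻¹) := by field_simp
    rw [this, hmul]
    refine (hpow l).mul hv.ne_zero (by rw [hdet]; exact pow_ne_zero _ hϖ0) (hunit _ ?_)
    rw [map_mul, map_inv₀, map_pow, hm, hϖ, ← exp_nsmul, ← exp_neg, ← exp_add, ← exp_zero]
    simp
  rcases le_total (v u) 1 with h | h
  · exact hint u hu h
  -- A non-integral `u` is handled through its inverse: applying `g` to the pair of the standard
  -- lattice and its image under `g'` exchanges the roles and inverts the index.
  · have hi := hint u⁻¹ (inv_ne_zero hu) (by rw [map_inv₀]; exact inv_le_one_of_one_le₀ h)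
    set g := Matrix.diagonal (Function.update (1 : ι → K) i u) with hg
    set g' := Matrix.diagonal (Function.update (1 : ι → K) i u⁻¹) with hg'
    have hgg : g * g' = 1 := by
      rw [← hmul, mul_inv_cancel₀ hu, Function.update_eq_self_iff.2 (by simp)]
      simp
    have hinj := mulVecLin_injective (g := g) (by rw [hdet]; exact hu)
    have hS : ((stdLattice v ι).map g'.mulVecLin.toAddMonoidHom).map g.mulVecLin.toAddMonoidHom
        = stdLattice v ι := by
      rw [← map_mulVecLin_mul, hgg, Matrix.mulVecLin_one]
      exact AddSubgroup.map_id _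
    have h1 := commensurable_map hinj hi.1
    have h2 := genIndex_map hinj (stdLattice v ι) ((stdLattice v ι).map g'.mulVecLin.toAddMonoidHom)
    rw [hS] at h1 h2
    refine ⟨h1.symm, ?_⟩
    have h3 := hi.2
    have hv0 := (absValue_pos hv.ne_zero ((v.ne_zero_iff).2 hu)).ne'
    rw [← h2, hdet, map_inv₀, absValue_inv hv.ne_zero, mul_inv_eq_one₀ hv0] at h3
    rw [← genIndex_inv, h3, hdet, inv_mul_cancel₀ hv0]

lemma scalesIndex_diagonal (hv : IsDiscreteWithCard v q) {d : ι → K} (hd : ∀ i, d i ≠ 0) :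
    ScalesIndex v q (Matrix.diagonal d) := by
  have : ∀ s : Finset ι, ScalesIndex v q (Matrix.diagonal fun i => if i ∈ s then d i else 1) := by
    intro s
    induction s using Finset.induction_on with
    | empty =>
      have h1 : ∀ i j, v ((1 : Matrix ι ι K) i j) ≤ 1 := by
        intro i j
        rw [Matrix.one_apply]
        split_ifs <;> simp
      have h2 : (Matrix.diagonal fun i => if i ∈ (∅ : Finset ι) then d i else 1) = 1 := by simp
      rw [h2]
      exact scalesIndex_of_integral (h := 1) (by simp) h1 h1 (by simp)
    | insert a s ha ih =>
      have : (Matrix.diagonal fun i => if i ∈ insert a s then d i else 1) =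
          Matrix.diagonal (Function.update 1 a (d a)) *
            Matrix.diagonal fun i => if i ∈ s then d i else 1 := by
        rw [Matrix.diagonal_mul_diagonal]
        congr 1
        ext j
        rcases eq_or_ne j a with rfl | hj
        · simp [ha]
        · simp [hj]
      rw [this]
      refine (scalesIndex_diagonal_update hv a (hd a)).mul hv.ne_zero ?_ ih
      rw [Matrix.det_diagonal, Finset.prod_update_of_mem (Finset.mem_univ a)]
      simpa using hd a
  simpa using this Finset.univ

/-- Invertible matrices are products of diagonal matrices and transvections. A transvection with
nonzero entry is a diagonal conjugate of the one with entry 1, which preserves the standard lattice.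
-/
lemma scalesIndex_of_det_ne_zero (hv : IsDiscreteWithCard v q) {g : Matrix ι ι K}
    (hg : g.det ≠ 0) : ScalesIndex v q g := by
  refine Matrix.diagonal_transvection_induction_of_det_ne_zero (ScalesIndex v q) g hg ?_ ?_ ?_
  · intro d hd
    rw [Matrix.det_diagonal, Finset.prod_ne_zero_iff] at hd
    exact scalesIndex_diagonal hv fun i => hd i (Finset.mem_univ i)
  · rintro ⟨i, j, hij, c⟩
    rw [Matrix.TransvectionStruct.toMatrix_mk]
    have hint : ∀ c : K, v c ≤ 1 → ScalesIndex v q (Matrix.transvection i j c) := by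
      intro c hc
      have h1 : ∀ c : K, v c ≤ 1 → ∀ a b, v (Matrix.transvection i j c a b) ≤ 1 := by
        intro c hc a b
        rw [Matrix.transvection, Matrix.add_apply]
        refine (v.map_add _ _).trans (max_le ?_ ?_)
        · rw [Matrix.one_apply]; split_ifs <;> simp
        · rw [Matrix.single_apply]; split_ifs <;> simp [hc]
      refine scalesIndex_of_integral (h := Matrix.transvection i j (-c)) ?_ (h1 c hc)
        (h1 _ (by simpa using hc)) (by rw [Matrix.det_transvection_of_ne _ _ hij, map_one])
      rw [Matrix.transvection_mul_transvection_same _ _ hij]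
      simp
    rcases eq_or_ne c 0 with rfl | hc
    · exact hint 0 (by simp)
    have hmat : Matrix.transvection i j c = Matrix.diagonal (Function.update 1 i c) *
        (Matrix.transvection i j 1 * Matrix.diagonal (Function.update 1 i c⁻¹)) := by
      ext a b
      simp only [Matrix.diagonal_mul, Matrix.mul_diagonal, Matrix.transvection, Matrix.add_apply,
        Matrix.one_apply, Matrix.single_apply]
      rcases eq_or_ne a i with rfl | ha
      · rcases eq_or_ne b a with rfl | hb
        · simp [hij.symm, hc]
        · simp [hb, hb.symm]
      · rcases eq_or_ne a b with rfl | hb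
        · simp [ha, ha.symm]
        · simp [ha.symm, hb]
    rw [hmat]
    have hdet : (Matrix.diagonal (Function.update (1 : ι → K) i c)).det ≠ 0 := by
      rw [Matrix.det_diagonal, Finset.prod_update_of_mem (Finset.mem_univ i)]
      simpa using hc
    refine (scalesIndex_diagonal_update hv i hc).mul hv.ne_zero hdet ?_
    refine (hint 1 (by simp)).mul hv.ne_zero ?_ (scalesIndex_diagonal_update hv i (inv_ne_zero hc))
    rw [Matrix.det_transvection_of_ne _ _ hij]
    exact one_ne_zero
  · intro A B hA _ h1 h2
    exact h1.mul hv.ne_zero hA h2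

end Lattice


/-! ### Lattices in an algebra: change of basis, scaling and duality. -/

section BasisLattice

open WithZero
open scoped WithZero

variable {K : Type*} [Field K] (v : Valuation K ℤᵐ⁰) {q : ℕ}
variable {ι : Type*} [Fintype ι]
variable {A : Type*} [Ring A] [Algebra K A]

/-- The lattice spanned by a basis over the valuation ring. -/
def basisLattice (b : Module.Basis ι K A) : AddSubgroup A :=
  (stdLattice v ι).comap (b.equivFun : A →+ (ι → K))

variable {v}

lemma mem_basisLattice {b : Module.Basis ι K A} {x : A} :
    x ∈ basisLattice v b ↔ ∀ i, v (b.repr x i) ≤ 1 := Iff.rfl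

lemma basisLattice_eq_map (b : Module.Basis ι K A) :
    basisLattice v b = (stdLattice v ι).map (b.equivFun.symm : (ι → K) →+ A) := by
  ext x
  constructor
  · intro hx
    exact ⟨b.equivFun x, hx, b.equivFun.symm_apply_apply x⟩
  · rintro ⟨c, hc, rfl⟩
    change b.equivFun (b.equivFun.symm c) ∈ stdLattice v ι
    rwa [LinearEquiv.apply_symm_apply]

lemma self_mem_basisLattice (b : Module.Basis ι K A) (i : ι) : b i ∈ basisLattice v b := by
  classical
  intro j
  change v (b.repr (b i) j) ≤ 1
  rw [b.repr_self, Finsupp.single_apply]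
  split_ifs <;> simp

lemma smul_mem_basisLattice {b : Module.Basis ι K A} {c : K} (hc : v c ≤ 1) {x : A}
    (hx : x ∈ basisLattice v b) : c • x ∈ basisLattice v b := by
  intro i
  change v (b.repr (c • x) i) ≤ 1
  rw [map_smul, Finsupp.smul_apply, smul_eq_mul, map_mul]
  exact mul_le_one' hc (hx i)

/-- A subgroup stable under the valuation ring contains the lattice spanned by any basis lying
in it. -/
lemma basisLattice_le {b : Module.Basis ι K A} {U : AddSubgroup A}
    (hU : ∀ c : K, v c ≤ 1 → ∀ x ∈ U, c • x ∈ U) (hb : ∀ i, b i ∈ U) : basisLattice v b ≤ U := by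
  intro x hx
  rw [← b.sum_repr x]
  exact sum_mem fun i _ => hU _ (hx i) _ (hb i)

variable [DecidableEq ι]

omit [DecidableEq ι] in
lemma basisLattice_eq_map_toMatrix (b b' : Module.Basis ι K A) :
    basisLattice v b' = ((stdLattice v ι).map
      (b.toMatrix b').mulVecLin.toAddMonoidHom).map (b.equivFun.symm : (ι → K) →+ A) := by
  rw [basisLattice_eq_map, AddSubgroup.map_map]
  congr 1
  refine DFunLike.ext _ _ fun c => ?_
  change b'.equivFun.symm c = b.equivFun.symm ((b.toMatrix b').mulVec c)
  rw [LinearEquiv.eq_symm_apply]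
  ext i
  rw [Module.Basis.equivFun_symm_apply, map_sum, Finset.sum_apply]
  simp [Matrix.mulVec, dotProduct, Module.Basis.toMatrix_apply, mul_comm]

omit [Fintype ι] [DecidableEq ι] in
lemma det_toMatrix_ne_zero [Fintype ι] [DecidableEq ι] (b b' : Module.Basis ι K A) :
    (b.toMatrix b').det ≠ 0 := by
  have h := congrArg Matrix.det (b.toMatrix_mul_toMatrix_flip b')
  rw [Matrix.det_mul, Matrix.det_one] at h
  exact left_ne_zero_of_mul_eq_one h

lemma commensurable_basisLattice (hv : IsDiscreteWithCard v q) (b b' : Module.Basis ι K A) :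
    (basisLattice v b).Commensurable (basisLattice v b') := by
  rw [basisLattice_eq_map_toMatrix b b', basisLattice_eq_map b]
  exact commensurable_map b.equivFun.symm.injective
    (scalesIndex_of_det_ne_zero hv (det_toMatrix_ne_zero b b')).1

lemma genIndex_basisLattice (hv : IsDiscreteWithCard v q) (b b' : Module.Basis ι K A) :
    genIndex (basisLattice v b) (basisLattice v b') * absValue q (v (b.toMatrix b').det) = 1 := by
  rw [basisLattice_eq_map_toMatrix b b', basisLattice_eq_map b,
    genIndex_map (f := (b.equivFun.symm : (ι → K) →+ A)) b.equivFun.symm.injective]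
  exact (scalesIndex_of_det_ne_zero hv (det_toMatrix_ne_zero b b')).2

/-- The subgroup of all `x` with `c • x ∈ U`. -/
def scaleDown (c : K) (U : AddSubgroup A) : AddSubgroup A :=
  U.comap (DistribSMul.toAddMonoidHom A c)

omit [Fintype ι] [DecidableEq ι] in
lemma mem_scaleDown {c : K} {U : AddSubgroup A} {x : A} : x ∈ scaleDown c U ↔ c • x ∈ U := Iff.rfl

omit [Fintype ι] [DecidableEq ι] in
lemma smul_injective_of_ne_zero {c : K} (hc : c ≠ 0) :
    Function.Injective (DistribSMul.toAddMonoidHom A c) := fun x y h => by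
  have h : c • x = c • y := h
  simpa [smul_smul, hc] using congrArg (c⁻¹ • ·) h

omit [Fintype ι] [DecidableEq ι] in
lemma map_scaleDown {c : K} (hc : c ≠ 0) (U : AddSubgroup A) :
    (scaleDown c U).map (DistribSMul.toAddMonoidHom A c) = U := by
  refine AddSubgroup.map_comap_eq_self_of_surjective (fun x => ⟨c⁻¹ • x, ?_⟩) U
  simp [smul_smul, hc]

omit [Fintype ι] [DecidableEq ι] in
lemma genIndex_scaleDown {c : K} (hc : c ≠ 0) (U V : AddSubgroup A) :
    genIndex (scaleDown c U) (scaleDown c V) = genIndex U V := by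
  rw [← genIndex_map (smul_injective_of_ne_zero hc), map_scaleDown hc, map_scaleDown hc]

omit [Fintype ι] [DecidableEq ι] in
lemma commensurable_scaleDown {c : K} (hc : c ≠ 0) {U V : AddSubgroup A}
    (h : U.Commensurable V) : (scaleDown c U).Commensurable (scaleDown c V) := by
  refine commensurable_of_map (smul_injective_of_ne_zero hc) ?_
  rwa [map_scaleDown hc, map_scaleDown hc]

omit [DecidableEq ι] in
-- In coordinates multiplication by `c` is a scalar matrix, with determinant `c ^ Fintype.card ι`.
lemma scalesIndex_scaleDown (hv : IsDiscreteWithCard v q) {c : K} (hc : c ≠ 0)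
    (b : Module.Basis ι K A) :
    (scaleDown c (basisLattice v b)).Commensurable (basisLattice v b) ∧
    genIndex (scaleDown c (basisLattice v b)) (basisLattice v b) *
      absValue q (v c) ^ Fintype.card ι = 1 := by
  classical
  have hdet : (Matrix.diagonal fun _ : ι => c).det = c ^ Fintype.card ι := by
    rw [Matrix.det_diagonal, Finset.prod_const, Finset.card_univ]
  have h := scalesIndex_of_det_ne_zero hv (g := Matrix.diagonal fun _ : ι => c)
    (by rw [hdet]; exact pow_ne_zero _ hc)
  have hm : (basisLattice v b).map (DistribSMul.toAddMonoidHom A c) =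
      ((stdLattice v ι).map (Matrix.diagonal fun _ : ι => c).mulVecLin.toAddMonoidHom).map
        (b.equivFun.symm : (ι → K) →+ A) := by
    rw [basisLattice_eq_map, AddSubgroup.map_map, AddSubgroup.map_map]
    congr 1
    refine DFunLike.ext _ _ fun x => ?_
    change c • b.equivFun.symm x = b.equivFun.symm ((Matrix.diagonal fun _ : ι => c).mulVec x)
    rw [← map_smul]
    congr 1
    ext i
    simp [Matrix.mulVec_diagonal]
  have h1 := commensurable_map (f := (b.equivFun.symm : (ι → K) →+ A))
    b.equivFun.symm.injective h.1
  have h2 := genIndex_map (f := (b.equivFun.symm : (ι → K) →+ A)) b.equivFun.symm.injective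
    (stdLattice v ι)
    ((stdLattice v ι).map (Matrix.diagonal fun _ : ι => c).mulVecLin.toAddMonoidHom)
  rw [← hm, ← basisLattice_eq_map] at h1 h2
  constructor
  · refine commensurable_of_map (smul_injective_of_ne_zero hc) ?_
    rwa [map_scaleDown hc]
  · rw [← genIndex_map (smul_injective_of_ne_zero hc), map_scaleDown hc, h2,
      ← absValue_pow hv.ne_zero, ← map_pow, ← hdet]
    exact h.2

/-! ### Duality for the form `(x, y) ↦ l (x * y)` -/

/-- The Gram matrix of the form `l (x * y)`. -/
def gram (l : A →ₗ[K] K) (b : ι → A) : Matrix ι ι K := Matrix.of fun i j => l (b i * b j)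

variable (v) in
/-- The dual of a lattice with respect to the form `l (x * y)`. -/
def dualLattice (l : A →ₗ[K] K) (U : AddSubgroup A) : AddSubgroup A where
  carrier := {x | ∀ y ∈ U, v (l (x * y)) ≤ 1}
  add_mem' := fun ha hb y hy => by
    rw [add_mul, map_add]
    exact (v.map_add _ _).trans (max_le (ha y hy) (hb y hy))
  zero_mem' := by simp
  neg_mem' := fun ha y hy => by
    rw [neg_mul, map_neg, Valuation.map_neg]
    exact ha y hy

omit [DecidableEq ι] in
lemma gram_mulVec (l : A →ₗ[K] K) (b : Module.Basis ι K A) (x : A) (j : ι) :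
    ((gram l b).transpose.mulVec (b.equivFun x)) j = l (x * b j) := by
  conv_rhs => rw [← b.sum_repr x]
  simp only [Finset.sum_mul, map_sum, smul_mul_assoc, map_smul, smul_eq_mul]
  simp [Matrix.mulVec, dotProduct, gram, mul_comm]

omit [DecidableEq ι] in
lemma mem_dualLattice_iff (l : A →ₗ[K] K) (b : Module.Basis ι K A) (x : A) :
    x ∈ dualLattice v l (basisLattice v b) ↔ ∀ j, v (l (x * b j)) ≤ 1 := by
  refine ⟨fun h j => h _ (self_mem_basisLattice b j), fun h y hy => ?_⟩
  rw [← b.sum_repr y, Finset.mul_sum, map_sum]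
  refine v.map_sum_le fun j _ => ?_
  rw [mul_smul_comm, map_smul, smul_eq_mul, map_mul]
  exact mul_le_one' (hy j) (h j)

/-- The map sending `x` to the vector of all `l (x * b j)` is the transposed Gram matrix in
coordinates. Under it the dual lattice becomes the standard lattice, and the lattice itself becomes
the image of the standard one under that matrix. -/
lemma genIndex_dualLattice_self (hv : IsDiscreteWithCard v q) (l : A →ₗ[K] K)
    (b : Module.Basis ι K A) (hG : (gram l b).det ≠ 0) :
    genIndex (dualLattice v l (basisLattice v b)) (basisLattice v b) *
      absValue q (v (gram l b).det) = 1 := by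
  rw [← Matrix.det_transpose] at hG ⊢
  have h := (scalesIndex_of_det_ne_zero hv hG).2
  set g := (gram l b).transpose
  let f : A →+ (ι → K) := g.mulVecLin.toAddMonoidHom.comp (b.equivFun : A →+ (ι → K))
  have hf : Function.Injective f := (mulVecLin_injective hG).comp b.equivFun.injective
  have h1 : (basisLattice v b).map f = (stdLattice v ι).map g.mulVecLin.toAddMonoidHom := by
    rw [← AddSubgroup.map_map]
    congr 1
    exact AddSubgroup.map_comap_eq_self_of_surjective b.equivFun.surjective _
  have h2 : (dualLattice v l (basisLattice v b)).map f = stdLattice v ι := by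
    have hs : Function.Surjective f := by
      intro y
      obtain ⟨x, hx⟩ := b.equivFun.surjective (g⁻¹.mulVec y)
      refine ⟨x, ?_⟩
      change g.mulVec (b.equivFun x) = y
      rw [hx, Matrix.mulVec_mulVec, Matrix.mul_nonsing_inv _ hG.isUnit, Matrix.one_mulVec]
    have : dualLattice v l (basisLattice v b) = (stdLattice v ι).comap f := by
      ext x
      rw [mem_dualLattice_iff]
      exact forall_congr' fun j => by rw [← gram_mulVec]; rfl
    rw [this]
    exact AddSubgroup.map_comap_eq_self_of_surjective hs _
  rw [← genIndex_map hf, h1, h2]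
  exact h

omit [DecidableEq ι] in
lemma gram_eq (l : A →ₗ[K] K) (b b' : Module.Basis ι K A) :
    gram l b' = (b.toMatrix b').transpose * gram l b * b.toMatrix b' := by
  ext i j
  conv_lhs => rw [gram, Matrix.of_apply, ← b.sum_repr (b' i), ← b.sum_repr (b' j)]
  simp only [Matrix.mul_apply, Matrix.transpose_apply, Module.Basis.toMatrix_apply, gram,
    Matrix.of_apply, Finset.mul_sum, Finset.sum_mul, map_sum, smul_mul_assoc, mul_smul_comm,
    map_smul, smul_eq_mul]
  refine Finset.sum_congr rfl fun y _ => Finset.sum_congr rfl fun x _ => ?_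
  ring

/-- The index of a lattice in its dual determines, up to sign, its index in another lattice. -/
lemma genIndex_dualLattice (hv : IsDiscreteWithCard v q) (l : A →ₗ[K] K)
    (b b' : Module.Basis ι K A) (hG : (gram l b).det ≠ 0) :
    genIndex (dualLattice v l (basisLattice v b')) (basisLattice v b') *
      absValue q (v (gram l b).det) = genIndex (basisLattice v b) (basisLattice v b') ^ 2 := by
  have hP := det_toMatrix_ne_zero b b'
  have hG' : (gram l b').det = (b.toMatrix b').det ^ 2 * (gram l b).det := by
    rw [gram_eq l b b', Matrix.det_mul, Matrix.det_mul, Matrix.det_transpose]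
    ring
  have h1 := genIndex_dualLattice_self hv l b' (by rw [hG']; positivity)
  have h2 := genIndex_basisLattice hv b b'
  rw [hG', map_mul, map_pow, absValue_mul hv.ne_zero, absValue_pow hv.ne_zero] at h1
  set P := absValue q (v (b.toMatrix b').det)
  set D := genIndex (basisLattice v b) (basisLattice v b')
  -- Eliminates the absolute value `P` of the determinant of the base change by means of `D * P =
  -- 1`.
  linear_combination D ^ 2 * h1 -
    (genIndex (dualLattice v l (basisLattice v b')) (basisLattice v b') *
      absValue q (v (gram l b).det)) * (D * P + 1) * h2

end BasisLattice


/-! ### The norm valuation of a division algebra over a local field. -/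

section DivisionValuation

open WithZero
open scoped WithZero Valued

variable {K : Type*} [Field K] [Valued K ℤᵐ⁰]

lemma isClopen_setOf_valuation_le {ϖ : K} (hϖ : Valued.v ϖ = (exp (-1 : ℤ) : ℤᵐ⁰)) (i : ℤ) :
    IsClopen {x : K | Valued.v x ≤ exp i} := by
  have h0 := ne_zero_of_valuation_eq_exp hϖ
  have : {x : K | Valued.v x ≤ exp i} =
      (fun x => ϖ ^ i * x) ⁻¹' ((Valued.v : Valuation K ℤᵐ⁰).integer : Set K) := by
    ext x
    rw [Set.mem_preimage, SetLike.mem_coe, Valuation.mem_integer_iff, map_mul, map_zpow₀, hϖ,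
      ← exp_zsmul, ← le_inv_mul_iff₀ exp_pos, mul_one, ← exp_neg]
    simp
  rw [this]
  exact (Valued.isClopen_integer K).preimage (by fun_prop)

variable [CompactSpace 𝒪[K]]
variable {Δ : Type*} [DivisionRing Δ] [Algebra K Δ] [FiniteDimensional K Δ]

lemma isCompact_stdLattice (ι : Type*) :
    IsCompact (stdLattice (Valued.v : Valuation K ℤᵐ⁰) ι : Set (ι → K)) := by
  have h : IsCompact ((Valued.v : Valuation K ℤᵐ⁰).integer : Set K) :=
    isCompact_iff_compactSpace.2 ‹_›
  convert isCompact_univ_pi fun _ : ι => h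
  ext x
  simp [stdLattice, Valuation.mem_integer_iff]

omit [CompactSpace 𝒪[K]] in
lemma continuous_norm [TopologicalSpace Δ] [IsModuleTopology K Δ] :
    Continuous (Algebra.norm K : Δ → K) := by
  let b := Module.finBasis K Δ
  have h : (Algebra.norm K : Δ → K) = fun x => (Algebra.leftMulMatrix b x).det := by
    ext x
    rw [Algebra.norm_eq_matrix_det b]
  rw [h]
  refine Continuous.matrix_det (continuous_pi fun i => continuous_pi fun j => ?_)
  exact IsModuleTopology.continuous_of_linearMap
    (((LinearMap.proj j).comp (LinearMap.proj i)).comp (Algebra.leftMulMatrix b).toLinearMap :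
      Δ →ₗ[K] K)

omit [CompactSpace 𝒪[K]] [FiniteDimensional K Δ] in
lemma continuous_linearMap_pi [TopologicalSpace Δ] [IsModuleTopology K Δ] {ι : Type*} [Finite ι]
    (f : (ι → K) →ₗ[K] Δ) : Continuous f := by
  have := IsModuleTopology.toContinuousAdd K Δ
  exact IsModuleTopology.continuous_of_linearMap f

omit [FiniteDimensional K Δ] in
lemma isCompact_map_stdLattice [TopologicalSpace Δ] [IsModuleTopology K Δ] {ι : Type*} [Finite ι]
    (f : (ι → K) →ₗ[K] Δ) :
    IsCompact (f '' (stdLattice (Valued.v : Valuation K ℤᵐ⁰) ι : Set (ι → K))) :=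
  (isCompact_stdLattice ι).image (continuous_linearMap_pi f)

omit [CompactSpace 𝒪[K]] [FiniteDimensional K Δ] in
lemma image_stdLattice {ι : Type*} [Fintype ι] (b : Module.Basis ι K Δ) :
    (b.equivFun.symm : (ι → K) →ₗ[K] Δ) '' (stdLattice (Valued.v : Valuation K ℤᵐ⁰) ι :
      Set (ι → K)) = basisLattice (Valued.v : Valuation K ℤᵐ⁰) b := by
  rw [basisLattice_eq_map]
  rfl

/-- The norm is bounded on lattices. -/
lemma exists_norm_le {ϖ : K} (hϖ : Valued.v ϖ = (exp (-1 : ℤ) : ℤᵐ⁰)) {ι : Type*} [Fintype ι]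
    (b : Module.Basis ι K Δ) : ∃ C : ℕ, ∀ x ∈ basisLattice (Valued.v : Valuation K ℤᵐ⁰) b,
      Valued.v (Algebra.norm K x) ≤ exp (C : ℤ) := by
  let _ : TopologicalSpace Δ := moduleTopology K Δ
  have : IsModuleTopology K Δ := ⟨rfl⟩
  have hc := isCompact_map_stdLattice (b.equivFun.symm : (ι → K) →ₗ[K] Δ)
  rw [image_stdLattice] at hc
  -- The lattice is compact and the norm is continuous, so one member of an increasing open cover by
  -- bounds on the norm suffices.
  obtain ⟨C, hC⟩ := hc.elim_directed_cover
    (fun C : ℕ => {x : Δ | Valued.v (Algebra.norm K x) ≤ exp (C : ℤ)})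
    (fun C => (isClopen_setOf_valuation_le hϖ C).isOpen.preimage continuous_norm)
    (fun x _ => by
      rw [Set.mem_iUnion]
      rcases eq_or_ne (Valued.v (Algebra.norm K x)) (0 : ℤᵐ⁰) with h | h
      · exact ⟨0, by simp [h]⟩
      · obtain ⟨i, hi⟩ := eq_exp_of_ne_zero h
        refine ⟨i.toNat, ?_⟩
        rw [Set.mem_ofPred_eq, hi, exp_le_exp]
        exact Int.self_le_toNat i)
    (directed_of_isDirected_le fun i j hij x hx =>
      le_trans hx (exp_le_exp.2 (by exact_mod_cast hij)))
  exact ⟨C, fun x hx => hC hx⟩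

/-- Elements of bounded norm lie in a lattice. -/
lemma exists_smul_mem_of_norm_le {ϖ : K} (hϖ : Valued.v ϖ = (exp (-1 : ℤ) : ℤᵐ⁰))
    {ι : Type*} [Fintype ι] (b : Module.Basis ι K Δ) : ∃ C : ℕ, ∀ x : Δ,
      Valued.v (Algebra.norm K x) ≤ (1 : ℤᵐ⁰) →
        ϖ ^ C • x ∈ basisLattice (Valued.v : Valuation K ℤᵐ⁰) b := by
  let _ : TopologicalSpace Δ := moduleTopology K Δ
  have : IsModuleTopology K Δ := ⟨rfl⟩
  have hϖ0 := ne_zero_of_valuation_eq_exp hϖ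
  let f := (b.equivFun.symm : (ι → K) →ₗ[K] Δ)
  have hf : Continuous fun c => Algebra.norm K (f c) :=
    continuous_norm.comp (continuous_linearMap_pi f)
  -- The primitive vectors of the lattice form a compact set that avoids 0. In a division algebra
  -- the norm does not vanish there, so its valuation is bounded below.
  have hS : IsCompact ((stdLattice (Valued.v : Valuation K ℤᵐ⁰) ι : Set (ι → K)) \
      {c | ∀ i, Valued.v (c i) ≤ (exp (-1 : ℤ) : ℤᵐ⁰)}) := by
    refine (isCompact_stdLattice ι).diff ?_
    rw [Set.ofPred_forall]
    exact isOpen_iInter_of_finite fun i =>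
      (isClopen_setOf_valuation_le hϖ (-1)).isOpen.preimage
        (continuous_apply (A := fun _ : ι => K) i)
  obtain ⟨C, hC⟩ := hS.elim_directed_cover
    (fun C : ℕ => {c | ¬ Valued.v (Algebra.norm K (f c)) ≤ (exp (-(C : ℤ)) : ℤᵐ⁰)})
    (fun C => ((isClopen_setOf_valuation_le hϖ _).isClosed.preimage hf).isOpen_compl)
    (fun c hc => by
      rw [Set.mem_iUnion]
      have hne : f c ≠ 0 := by
        intro h
        have : c = 0 := b.equivFun.symm.injective (by simpa [f] using h)
        exact hc.2 (by simp [this])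
      have hN : Valued.v (Algebra.norm K (f c)) ≠ (0 : ℤᵐ⁰) := by
        rw [Valuation.ne_zero_iff]
        exact (Ne.isUnit hne).map (Algebra.norm K) |>.ne_zero
      obtain ⟨i, hi⟩ := eq_exp_of_ne_zero hN
      refine ⟨(-i).toNat + 1, ?_⟩
      rw [Set.mem_ofPred_eq, hi, exp_le_exp]
      omega)
    (directed_of_isDirected_le fun i j hij x hx h =>
      hx (le_trans h (exp_le_exp.2 (by omega))))
  refine ⟨C, fun x hx => ?_⟩
  by_contra hmem
  obtain ⟨i, hi⟩ : ∃ i, ¬ Valued.v (b.repr (ϖ ^ C • x) i) ≤ (1 : ℤᵐ⁰) := by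
    by_contra h
    push Not at h
    exact hmem h
  -- rescale by the exact power of the uniformizer
  have hbd : ∃ m : ℕ, ϖ ^ m • x ∈ basisLattice (Valued.v : Valuation K ℤᵐ⁰) b := by
    choose e he using fun j => show ∃ m : ℕ, Valued.v (b.repr x j) ≤ (exp (m : ℤ) : ℤᵐ⁰) by
      rcases eq_or_ne (Valued.v (b.repr x j)) (0 : ℤᵐ⁰) with h | h
      · exact ⟨0, by simp [h]⟩
      · obtain ⟨i, hi⟩ := eq_exp_of_ne_zero h
        exact ⟨i.toNat, by rw [hi, exp_le_exp]; exact Int.self_le_toNat i⟩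
    refine ⟨∑ j, e j, fun j => ?_⟩
    change Valued.v (b.repr (ϖ ^ (∑ j, e j) • x) j) ≤ (1 : ℤᵐ⁰)
    rw [map_smul, Finsupp.smul_apply, smul_eq_mul, map_mul, map_pow, hϖ, ← exp_nsmul]
    refine (mul_le_mul_right (he j) _).trans ?_
    rw [← exp_add, ← exp_zero, exp_le_exp]
    have : e j ≤ ∑ j, e j := Finset.single_le_sum (fun _ _ => Nat.zero_le _) (Finset.mem_univ j)
    have : (e j : ℤ) ≤ ((∑ j, e j : ℕ) : ℤ) := by exact_mod_cast this
    simp only [nsmul_eq_mul]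
    linarith
  classical
  have hspec := Nat.find_spec hbd
  set m := Nat.find hbd with hm
  have hCm : C < m := by
    by_contra h
    apply hmem
    have : ϖ ^ C • x = ϖ ^ (C - m) • ϖ ^ m • x := by
      rw [smul_smul, ← pow_add, Nat.sub_add_cancel (by omega)]
    rw [this]
    refine smul_mem_basisLattice ?_ hspec
    rw [map_pow, hϖ]
    exact pow_le_one' (by rw [← exp_zero, exp_le_exp]; norm_num) _
  -- Minimality of `m` makes `ϖ ^ m • x` primitive, while `m > C` makes its norm too small for a
  -- primitive vector.
  have hcS : b.equivFun (ϖ ^ m • x) ∈ ((stdLattice (Valued.v : Valuation K ℤᵐ⁰) ι : Set (ι → K)) \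
      {c | ∀ i, Valued.v (c i) ≤ (exp (-1 : ℤ) : ℤᵐ⁰)}) := by
    refine ⟨hspec, fun h => ?_⟩
    refine Nat.find_min hbd (m := m - 1) (by omega) fun j => ?_
    have hj := h j
    have e1 : ϖ ^ m • x = ϖ • ϖ ^ (m - 1) • x := by
      rw [smul_smul, ← pow_succ', Nat.sub_add_cancel (by omega)]
    rw [e1, map_smul, Pi.smul_apply, smul_eq_mul, map_mul, hϖ,
      ← le_inv_mul_iff₀ exp_pos, inv_mul_cancel₀ exp_ne_zero] at hj
    exact hj
  have h1 := hC hcS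
  rw [Set.mem_ofPred_eq] at h1
  apply h1
  change Valued.v (Algebra.norm K (b.equivFun.symm (b.equivFun (ϖ ^ m • x)))) ≤ _
  rw [LinearEquiv.symm_apply_apply, Algebra.smul_def, map_mul, Algebra.norm_algebraMap, map_mul,
    map_pow, map_pow, hϖ, ← exp_nsmul, ← exp_nsmul]
  refine (mul_le_of_le_one_right' hx).trans ?_
  rw [exp_le_exp]
  have h2 : 1 ≤ Module.finrank K Δ := Module.finrank_pos
  have h3 : C ≤ m * Module.finrank K Δ := by nlinarith
  simp only [nsmul_eq_mul]
  have : (C : ℤ) ≤ m * Module.finrank K Δ := by exact_mod_cast h3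
  linarith

/-- The binomial expansion of a power of `1 + x` involves only powers of `x`, all of norm at most 1
and hence all in one fixed lattice, on which the norm is bounded. A norm of `1 + x` of value greater
than 1 would have unbounded powers. -/
lemma norm_one_add_le {ϖ : K} (hϖ : Valued.v ϖ = (exp (-1 : ℤ) : ℤᵐ⁰)) {x : Δ}
    (hx : Valued.v (Algebra.norm K x) ≤ (1 : ℤᵐ⁰)) :
    Valued.v (Algebra.norm K (1 + x)) ≤ (1 : ℤᵐ⁰) := by
  let b := Module.finBasis K Δ
  obtain ⟨C, hC⟩ := exists_smul_mem_of_norm_le hϖ b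
  obtain ⟨B, hB⟩ := exists_norm_le hϖ b
  by_contra hlt
  rw [not_le] at hlt
  have hne : Valued.v (Algebra.norm K (1 + x)) ≠ (0 : ℤᵐ⁰) := (zero_lt_one.trans hlt).ne'
  obtain ⟨i, hi⟩ := eq_exp_of_ne_zero hne
  rw [hi, ← exp_zero, exp_lt_exp] at hlt
  have hpow : ∀ m : ℕ, ϖ ^ C • (1 + x) ^ m ∈ basisLattice (Valued.v : Valuation K ℤᵐ⁰) b := by
    intro m
    rw [(Commute.one_left x).add_pow, Finset.smul_sum]
    refine sum_mem fun j _ => ?_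
    rw [one_pow, one_mul, ← nsmul_eq_mul', smul_comm]
    refine nsmul_mem (hC _ ?_) _
    rw [map_pow, map_pow]
    exact pow_le_one' hx _
  -- The exponent is large enough to exceed the bound `B` even after the loss caused by the factor
  -- `ϖ ^ C`.
  have h := hB _ (hpow (B + C * Module.finrank K Δ + 1))
  rw [Algebra.smul_def, map_mul, Algebra.norm_algebraMap, map_mul, map_pow, map_pow, map_pow,
    map_pow, hϖ, hi, ← exp_nsmul, ← exp_nsmul, ← exp_nsmul, ← exp_add, exp_le_exp] at h
  simp only [nsmul_eq_mul] at h
  push_cast at h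
  have h1 : (0 : ℤ) ≤ B + C * Module.finrank K Δ + 1 := by positivity
  have h2 := mul_le_mul_of_nonneg_left (show (1 : ℤ) ≤ i from hlt) h1
  linarith

variable (K Δ) in
/-- The valuation of a division algebra given by the norm. -/
def divValuation (h : ∃ ϖ : K, Valued.v ϖ = (exp (-1 : ℤ) : ℤᵐ⁰)) : Valuation Δ ℤᵐ⁰ where
  toFun x := Valued.v (Algebra.norm K x)
  map_zero' := by simp [Algebra.norm_zero]
  map_one' := by simp
  map_mul' x y := by rw [map_mul, map_mul]
  map_add_le_max' := by
    obtain ⟨ϖ, hϖ⟩ := h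
    have key : ∀ x y : Δ, Valued.v (Algebra.norm K x) ≤ (Valued.v (Algebra.norm K y) : ℤᵐ⁰) →
        Valued.v (Algebra.norm K (x + y)) ≤ (Valued.v (Algebra.norm K y) : ℤᵐ⁰) := by
      intro x y hxy
      rcases eq_or_ne y 0 with rfl | hy
      · rw [Algebra.norm_zero, map_zero, le_zero_iff, Valuation.zero_iff] at hxy
        have : x = 0 := by
          by_contra hx
          exact ((Ne.isUnit hx).map (Algebra.norm K)).ne_zero hxy
        simp [this, Algebra.norm_zero]
      have hy0 : Valued.v (Algebra.norm K y) ≠ (0 : ℤᵐ⁰) := by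
        rw [Valuation.ne_zero_iff]
        exact ((Ne.isUnit hy).map (Algebra.norm K)).ne_zero
      have e : x + y = (1 + x * y⁻¹) * y := by
        rw [add_mul, mul_assoc, inv_mul_cancel₀ hy]; simp [add_comm]
      have hx : Valued.v (Algebra.norm K (x * y⁻¹)) ≤ (1 : ℤᵐ⁰) := by
        have e2 : Valued.v (Algebra.norm K (x * y⁻¹)) * Valued.v (Algebra.norm K y) =
            (Valued.v (Algebra.norm K x) : ℤᵐ⁰) := by
          rw [← map_mul, ← map_mul, mul_assoc, inv_mul_cancel₀ hy, mul_one]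
        rw [← e2] at hxy
        exact (mul_le_iff_le_one_left (zero_lt_iff.2 hy0)).1 hxy
      rw [e, map_mul, map_mul]
      exact mul_le_of_le_one_left' (norm_one_add_le hϖ hx)
    intro x y
    rcases le_total (Valued.v (Algebra.norm K x) : ℤᵐ⁰) (Valued.v (Algebra.norm K y)) with h | h
    · exact (key x y h).trans (le_max_right _ _)
    · rw [add_comm]
      exact (key y x h).trans (le_max_left _ _)

end DivisionValuation


/-! ### Finite residue fields and Teichmüller representatives. -/

section ResidueField

open WithZero
open scoped WithZero Valued

/-- `T` maps isomorphically onto `U / J`. Residue fields are counted by exhibiting such a complement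
of the maximal ideal. -/
lemma relIndex_eq_card_of_complement {G : Type*} [AddCommGroup G] {J T U : AddSubgroup G}
    (h1 : T ⊔ J = U) (h2 : T ⊓ J = ⊥) : J.relIndex U = Nat.card T := by
  rw [← h1, sup_comm, AddSubgroup.relIndex_sup_left, ← AddSubgroup.inf_relIndex_left, inf_comm, inf_comm, h2,
    AddSubgroup.relIndex_bot_left]

lemma lt_one_iff_le_exp {x : ℤᵐ⁰} : x < 1 ↔ x ≤ exp (-1 : ℤ) := by
  rcases eq_or_ne x 0 with rfl | hx
  · simp
  · obtain ⟨i, rfl⟩ := eq_exp_of_ne_zero hx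
    rw [← exp_zero, exp_lt_exp, exp_le_exp]
    omega

variable {K : Type*} [Field K] [Valued K ℤᵐ⁰] [CompactSpace 𝒪[K]] {q : ℕ}
variable {Δ : Type*} [DivisionRing Δ] [Algebra K Δ] [FiniteDimensional K Δ]

lemma divValuation_apply (h : ∃ ϖ : K, Valued.v ϖ = (exp (-1 : ℤ) : ℤᵐ⁰)) (x : Δ) :
    divValuation K Δ h x = Valued.v (Algebra.norm K x) := rfl

lemma divValuation_algebraMap (h : ∃ ϖ : K, Valued.v ϖ = (exp (-1 : ℤ) : ℤᵐ⁰)) (c : K) :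
    divValuation K Δ h (algebraMap K Δ c) = Valued.v c ^ Module.finrank K Δ := by
  rw [divValuation_apply, Algebra.norm_algebraMap, map_pow]

/-- Elements of norm at most 1 lie in one rescaling of the lattice, and rescaling changes a lattice
by a finite index. -/
lemma basisLattice_relIndex_ball_ne_zero (hK : IsDiscreteWithCard (Valued.v : Valuation K ℤᵐ⁰) q)
    {ι : Type*} [Fintype ι] (b : Module.Basis ι K Δ) :
    (basisLattice (Valued.v : Valuation K ℤᵐ⁰) b).relIndex
      (ball (divValuation K Δ hK.exists_uniformizer) 1) ≠ 0 := by
  obtain ⟨ϖ, hϖ⟩ := hK.exists_uniformizer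
  obtain ⟨C, hC⟩ := exists_smul_mem_of_norm_le hϖ b
  have h := (scalesIndex_scaleDown hK (pow_ne_zero C (ne_zero_of_valuation_eq_exp hϖ)) b).1.2
  intro h0
  apply h
  exact AddSubgroup.relIndex_eq_zero_of_le_right (fun x hx => hC x hx) h0

lemma ball_relIndex_basisLattice_ne_zero (hK : IsDiscreteWithCard (Valued.v : Valuation K ℤᵐ⁰) q)
    {ι : Type*} [Fintype ι] (b : Module.Basis ι K Δ) (i : ℤ) :
    (ball (divValuation K Δ hK.exists_uniformizer) (exp i)).relIndex
      (basisLattice (Valued.v : Valuation K ℤᵐ⁰) b) ≠ 0 := by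
  obtain ⟨ϖ, hϖ⟩ := hK.exists_uniformizer
  have hϖ0 := ne_zero_of_valuation_eq_exp hϖ
  obtain ⟨B, hB⟩ := exists_norm_le hϖ b
  have h := (scalesIndex_scaleDown hK (inv_ne_zero (pow_ne_zero (B + i.natAbs) hϖ0)) b).1.1
  intro h0
  apply h
  refine Nat.eq_zero_of_zero_dvd ?_
  rw [← h0]
  refine AddSubgroup.relIndex_dvd_of_le_left _ fun x hx => ?_
  have hx := hB _ hx
  change Valued.v (Algebra.norm K ((ϖ ^ (B + i.natAbs))⁻¹ • x)) ≤ _ at hx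
  change Valued.v (Algebra.norm K x) ≤ _
  rw [Algebra.smul_def, map_mul, Algebra.norm_algebraMap, map_mul, map_pow, map_inv₀, map_pow, hϖ,
    ← exp_nsmul, ← exp_neg, ← exp_nsmul, ← le_inv_mul_iff₀ exp_pos, ← exp_neg, ← exp_add] at hx
  refine hx.trans ?_
  rw [exp_le_exp]
  have h2 : (1 : ℤ) ≤ Module.finrank K Δ := by exact_mod_cast Module.finrank_pos
  simp only [nsmul_eq_mul]
  push_cast
  have h3 : (0 : ℤ) ≤ B + |i| := by positivity
  have h4 := mul_le_mul_of_nonneg_right h2 h3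
  have h5 := neg_abs_le i
  linarith

lemma commensurable_ball (hK : IsDiscreteWithCard (Valued.v : Valuation K ℤᵐ⁰) q)
    {ι : Type*} [Fintype ι] (b : Module.Basis ι K Δ) :
    (ball (divValuation K Δ hK.exists_uniformizer) 1).Commensurable
      (basisLattice (Valued.v : Valuation K ℤᵐ⁰) b) :=
  ⟨by simpa using ball_relIndex_basisLattice_ne_zero hK b 0,
    basisLattice_relIndex_ball_ne_zero hK b⟩

lemma ball_relIndex_ball_ne_zero (hK : IsDiscreteWithCard (Valued.v : Valuation K ℤᵐ⁰) q) (i : ℤ) :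
    (ball (divValuation K Δ hK.exists_uniformizer) (exp i)).relIndex
      (ball (divValuation K Δ hK.exists_uniformizer) 1) ≠ 0 :=
  AddSubgroup.relIndex_ne_zero_trans
    (ball_relIndex_basisLattice_ne_zero hK (Module.finBasis K Δ) i)
    (basisLattice_relIndex_ball_ne_zero hK (Module.finBasis K Δ))

omit [Field K] [Valued K ℤᵐ⁰] [CompactSpace 𝒪[K]] [Algebra K Δ] [FiniteDimensional K Δ] in
/-- A nontrivial discrete valuation on a division ring has a uniformizer. -/
lemma exists_uniformizer (w : Valuation Δ ℤᵐ⁰) (hw : ∃ x, x ≠ 0 ∧ w x < 1) :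
    ∃ (m : ℕ) (π : Δ), 0 < m ∧ w π = exp (-(m : ℤ)) ∧
      ∀ x, x ≠ 0 → ∃ j : ℤ, w x = exp (-(m * j : ℤ)) := by
  classical
  have hex : ∃ m : ℕ, 0 < m ∧ ∃ x, w x = exp (-(m : ℤ)) := by
    obtain ⟨x, hx0, hx1⟩ := hw
    obtain ⟨i, hi⟩ := eq_exp_of_ne_zero ((w.ne_zero_iff).2 hx0)
    rw [hi, ← exp_zero, exp_lt_exp] at hx1
    refine ⟨(-i).toNat, by omega, x, ?_⟩
    rw [hi, Int.toNat_of_nonneg (by omega), neg_neg]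
  obtain ⟨hm, π, hπ⟩ := Nat.find_spec hex
  set m := Nat.find hex
  refine ⟨m, π, hm, hπ, fun x hx => ?_⟩
  obtain ⟨i, hi⟩ := eq_exp_of_ne_zero ((w.ne_zero_iff).2 hx)
  have hm' : (0 : ℤ) < m := by exact_mod_cast hm
  refine ⟨(-i) / m, ?_⟩
  have hr0 := Int.emod_nonneg (-i) hm'.ne'
  have hr1 := Int.emod_lt_of_pos (-i) hm'
  have hdm := Int.mul_ediv_add_emod (-i) m
  -- A nonzero remainder would be the exponent of the value of `x` times a power of `π`,
  -- contradicting the minimality of `m`.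
  have hz : (-i) % m = 0 := by
    by_contra hne
    refine Nat.find_min hex (m := ((-i) % m).toNat) (by omega)
      ⟨by omega, x * π ^ (-((-i) / m)), ?_⟩
    rw [map_mul, map_zpow₀, hi, hπ, ← exp_zsmul, ← exp_add, exp_inj, smul_eq_mul,
      Int.toNat_of_nonneg hr0]
    linarith
  rw [hi, exp_inj]
  linarith

section

variable (w : Valuation Δ ℤᵐ⁰)

/-- The ideal of elements of valuation less than one in the valuation ring. -/
def valIdeal : Ideal w.integer where
  carrier := {x | w x < 1}
  add_mem' := fun ha hb => (w.map_add _ _).trans_lt (max_lt ha hb)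
  zero_mem' := by simp
  smul_mem' := fun c x hx => by
    change w (c.1 * x.1) < 1
    rw [map_mul]
    exact mul_lt_one_of_nonneg_of_lt_one_right c.2 zero_le hx

instance : (valIdeal w).IsTwoSided where
  mul_mem_of_left := fun {a} b ha => by
    change w (a.1 * b.1) < 1
    rw [map_mul]
    exact mul_lt_one_of_nonneg_of_lt_one_left zero_le ha b.2

omit [Field K] [Valued K ℤᵐ⁰] [CompactSpace 𝒪[K]] [Algebra K Δ] [FiniteDimensional K Δ] in
lemma mk_valIdeal_eq {x y : w.integer} :
    Ideal.Quotient.mk (valIdeal w) x = Ideal.Quotient.mk (valIdeal w) y ↔ w (x - y : Δ) < 1 :=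
  Ideal.Quotient.eq

omit [Field K] [Valued K ℤᵐ⁰] [CompactSpace 𝒪[K]] [Algebra K Δ] [FiniteDimensional K Δ] in
lemma finite_residue (h : (ball w (exp (-1 : ℤ))).relIndex (ball w 1) ≠ 0) :
    Finite (w.integer ⧸ valIdeal w) := by
  have e : Nat.card (w.integer ⧸ valIdeal w) = (ball w (exp (-1 : ℤ))).relIndex (ball w 1) := by
    rw [AddSubgroup.relIndex, AddSubgroup.index]
    let e : w.integer ≃ ball w 1 :=
      ⟨fun x => ⟨x.1, x.2⟩, fun x => ⟨x.1, x.2⟩, fun _ => rfl, fun _ => rfl⟩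
    refine Nat.card_congr (Quotient.congr e fun a b => ?_)
    have h1 : (Submodule.quotientRel (valIdeal w)) a b ↔ w (-a.1 + b.1) < 1 := by
      change (QuotientAddGroup.leftRel _) a b ↔ _
      rw [QuotientAddGroup.leftRel_apply]
      rfl
    have h2 : (QuotientAddGroup.leftRel ((ball w (exp (-1 : ℤ))).addSubgroupOf (ball w 1)))
        (e a) (e b) ↔ w (-a.1 + b.1) ≤ exp (-1 : ℤ) := by
      rw [QuotientAddGroup.leftRel_apply]
      rfl
    exact h1.trans (lt_one_iff_le_exp.trans h2.symm)
  exact Nat.finite_of_card_ne_zero (by rw [e]; exact h)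

omit [Field K] [Valued K ℤᵐ⁰] [CompactSpace 𝒪[K]] [Algebra K Δ] [FiniteDimensional K Δ] in
/-- The residue ring of a division ring with finite residue ring is a finite field. -/
lemma residue_properties (h : (ball w (exp (-1 : ℤ))).relIndex (ball w 1) ≠ 0) (p : ℕ)
    [Fact p.Prime] [CharP Δ p] :
    (∀ x y, w x ≤ 1 → w y ≤ 1 → w (x * y - y * x) < 1) ∧
    (∃ g, w g = 1 ∧ ∀ x, w x = 1 → ∃ i : ℕ, w (x - g ^ i) < 1) ∧
    ∃ m : ℕ, m ≠ 0 ∧ ∀ x, w x ≤ 1 → w (x ^ p ^ m - x) < 1 := by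
  classical
  have hfin := finite_residue w h
  let k := w.integer ⧸ valIdeal w
  let mk := Ideal.Quotient.mk (valIdeal w)
  have hnt : Nontrivial k := Ideal.Quotient.nontrivial_iff.2 fun ht => by
    have : (1 : w.integer) ∈ valIdeal w := by rw [ht]; trivial
    have : w (1 : Δ) < 1 := this
    simp at this
  have hdom : IsDomain k := by
    have : NoZeroDivisors k := ⟨fun {a b} hab => by
      obtain ⟨a, rfl⟩ := Ideal.Quotient.mk_surjective a
      obtain ⟨b, rfl⟩ := Ideal.Quotient.mk_surjective b
      rw [← map_mul, Ideal.Quotient.eq_zero_iff_mem] at hab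
      rw [Ideal.Quotient.eq_zero_iff_mem, Ideal.Quotient.eq_zero_iff_mem]
      have hab : w (a.1 * b.1) < 1 := hab
      rw [map_mul] at hab
      by_contra hcon
      push Not at hcon
      have ha : w a.1 = 1 := le_antisymm a.2 (not_lt.1 hcon.1)
      have hb : w b.1 = 1 := le_antisymm b.2 (not_lt.1 hcon.2)
      simp [ha, hb] at hab⟩
    exact NoZeroDivisors.to_isDomain _
  -- Wedderburn: a finite domain is a commutative field.
  have hF : IsField k := Finite.isDomain_to_isField k
  let _ : Field k := hF.toField
  have hchar : CharP k p := by
    have : (p : k) = 0 := by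
      have h1 : ((p : w.integer) : Δ) = 0 := by simp
      have h2 : (p : w.integer) = 0 := Subtype.ext h1
      rw [← map_natCast mk, h2, map_zero]
    exact (CharP.charP_iff_prime_eq_zero Fact.out).2 this
  refine ⟨fun x y hx hy => ?_, ?_, ?_⟩
  · have := mk_valIdeal_eq w (x := ⟨x, hx⟩ * ⟨y, hy⟩) (y := ⟨y, hy⟩ * ⟨x, hx⟩)
    exact this.1 (by rw [map_mul, map_mul]; exact hF.mul_comm _ _)
  · obtain ⟨g, hg⟩ := IsCyclic.exists_generator (α := kˣ)
    obtain ⟨g', hg'⟩ := Ideal.Quotient.mk_surjective (I := valIdeal w) (g : k)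
    have hunit : ∀ x : w.integer, mk x ≠ 0 → w x = 1 := by
      intro x hx
      refine le_antisymm x.2 (not_lt.1 fun hlt => hx ?_)
      exact Ideal.Quotient.eq_zero_iff_mem.2 hlt
    refine ⟨g', hunit g' (by change Ideal.Quotient.mk _ g' ≠ 0; rw [hg']; exact g.ne_zero),
      fun x hx => ?_⟩
    have hx0 : mk ⟨x, hx.le⟩ ≠ 0 := by
      intro h0
      have : w x < 1 := Ideal.Quotient.eq_zero_iff_mem.1 h0
      exact this.ne hx
    obtain ⟨i, hi⟩ := (mem_powers_iff_mem_zpowers).2 (hg (Units.mk0 _ hx0))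
    refine ⟨i, ?_⟩
    have := mk_valIdeal_eq w (x := ⟨x, hx.le⟩) (y := g' ^ i)
    refine this.1 ?_
    rw [map_pow, hg']
    have := congrArg Units.val hi
    simp only [Units.val_pow_eq_pow_val, Units.val_mk0] at this
    exact this.symm
  · let _ : Fintype k := Fintype.ofFinite k
    obtain ⟨m, -, hm⟩ := FiniteField.card k p
    refine ⟨m, m.ne_zero, fun x hx => ?_⟩
    have := mk_valIdeal_eq w (x := ⟨x, hx⟩ ^ p ^ (m : ℕ)) (y := ⟨x, hx⟩)
    refine this.1 ?_
    rw [map_pow, ← hm]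
    exact FiniteField.pow_card _

end

/-- Teichmüller lifts. -/
lemma exists_teichmuller_lift (hK : IsDiscreteWithCard (Valued.v : Valuation K ℤᵐ⁰) q) (p : ℕ)
    [Fact p.Prime] [CharP Δ p] {m : ℕ} (hm : m ≠ 0)
    (h : ∀ x, divValuation K Δ hK.exists_uniformizer x ≤ 1 →
      divValuation K Δ hK.exists_uniformizer (x ^ p ^ m - x) < 1) (x : Δ)
    (hx : divValuation K Δ hK.exists_uniformizer x ≤ 1) :
    ∃ z, z ^ p ^ m = z ∧ divValuation K Δ hK.exists_uniformizer (x - z) < 1 := by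
  set w := divValuation K Δ hK.exists_uniformizer with hw
  let _ : TopologicalSpace Δ := moduleTopology K Δ
  have : IsModuleTopology K Δ := ⟨rfl⟩
  have := IsModuleTopology.isTopologicalRing K Δ
  obtain ⟨ϖ, hϖ⟩ := hK.exists_uniformizer
  let b := Module.finBasis K Δ
  obtain ⟨C, hC⟩ := exists_smul_mem_of_norm_le (Δ := Δ) hϖ b
  have hϖ0 := ne_zero_of_valuation_eq_exp hϖ
  have hp := (Fact.out : p.Prime)
  -- a compact set containing the valuation ring
  let f : (Fin (Module.finrank K Δ) → K) →ₗ[K] Δ :=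
    (ϖ ^ C)⁻¹ • (b.equivFun.symm : (Fin (Module.finrank K Δ) → K) →ₗ[K] Δ)
  have hcomp := isCompact_map_stdLattice f
  have hsub : ∀ y, w y ≤ 1 → y ∈ f '' (stdLattice (Valued.v : Valuation K ℤᵐ⁰) (Fin (Module.finrank K Δ)) : Set _) := by
    intro y hy
    refine ⟨b.equivFun (ϖ ^ C • y), hC y hy, ?_⟩
    change (ϖ ^ C)⁻¹ • b.equivFun.symm (b.equivFun (ϖ ^ C • y)) = y
    rw [LinearEquiv.symm_apply_apply, smul_smul, inv_mul_cancel₀ (pow_ne_zero _ hϖ0), one_smul]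
  have hclosed : ∀ (g : Δ → Δ) (_ : Continuous g) (i : ℤ), IsClosed {y | w (g y) ≤ exp i} :=
    fun g hg i => (isClopen_setOf_valuation_le hϖ i).isClosed.preimage (continuous_norm.comp hg)
  -- Approximate solutions of `z ^ p ^ m = z` close to `x`: nested nonempty closed subsets of a
  -- compact set. A common point is an exact solution.
  let Z : ℕ → Set Δ := fun i => {y | w y ≤ exp 0} ∩
    ({y | w (x - y) ≤ exp (-1)} ∩ {y | w (y ^ p ^ m - y) ≤ exp (-(i : ℤ))})
  have hZc : ∀ i, IsClosed (Z i) := fun i => (hclosed id continuous_id 0).inter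
    ((hclosed (fun y => x - y) (by fun_prop) _).inter
      (hclosed (fun y => y ^ p ^ m - y) (by fun_prop) _))
  have hZn : ∀ i, (Z i).Nonempty := by
    intro i
    let y := x ^ (p ^ m) ^ i
    have hle : ∀ j : ℕ, w (x ^ j) ≤ 1 := fun j => by rw [map_pow]; exact pow_le_one' hx _
    have hstep : ∀ j : ℕ, w (x - x ^ (p ^ m) ^ j) < 1 := by
      intro j
      induction j with
      | zero => simp
      | succ j ih =>
        have e : x - x ^ (p ^ m) ^ (j + 1) = (x - x ^ (p ^ m) ^ j) -
            ((x ^ (p ^ m) ^ j) ^ p ^ m - x ^ (p ^ m) ^ j) := by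
          rw [← pow_mul x, ← pow_succ (p ^ m)]
          abel
        rw [e]
        exact (w.map_sub _ _).trans_lt (max_lt ih (h _ (hle _)))
    refine ⟨y, show w y ≤ exp 0 by rw [exp_zero]; exact hle _, lt_one_iff_le_exp.1 (hstep i), ?_⟩
    change w ((x ^ (p ^ m) ^ i) ^ p ^ m - x ^ (p ^ m) ^ i) ≤ _
    -- In characteristic `p` raising to a power of `p` is additive on commuting elements, so
    -- consecutive iterates differ by a high power of `x ^ p ^ m - x`, an element of value less than
    -- 1.
    have e : (x ^ (p ^ m) ^ i) ^ p ^ m - x ^ (p ^ m) ^ i = (x ^ p ^ m - x) ^ (p ^ m) ^ i := by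
      rw [← pow_mul p m i, sub_pow_char_pow_of_commute _ _ (Commute.pow_self x _), ← pow_mul,
        ← pow_mul, mul_comm]
    rw [e, map_pow]
    refine (pow_le_pow_left₀ zero_le (lt_one_iff_le_exp.1 (h x hx)) _).trans ?_
    rw [← exp_nsmul, exp_le_exp, nsmul_eq_mul]
    have : i < (p ^ m) ^ i := Nat.lt_pow_self (Nat.one_lt_pow hm hp.one_lt)
    have : (i : ℤ) < ((p ^ m) ^ i : ℕ) := by exact_mod_cast this
    linarith
  obtain ⟨z, hz⟩ := IsCompact.nonempty_iInter_of_sequence_nonempty_isCompact_isClosed Z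
    (fun i y hy => ⟨hy.1, hy.2.1, le_trans hy.2.2 (exp_le_exp.2 (by push_cast; omega))⟩) hZn
    (hcomp.of_isClosed_subset (hZc 0) fun y hy => hsub y (by simpa using hy.1)) hZc
  rw [Set.mem_iInter] at hz
  refine ⟨z, ?_, lt_one_iff_le_exp.2 (hz 0).2.1⟩
  rw [← sub_eq_zero, ← w.zero_iff]
  by_contra hne
  obtain ⟨i, hi⟩ := eq_exp_of_ne_zero hne
  have := (hz ((-i).toNat + 1)).2.2
  rw [Set.mem_ofPred_eq, hi, exp_le_exp] at this
  omega

end ResidueField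


/-! ### A coefficient field and a uniformizer normalizing it. -/

section CoefficientField

open WithZero
open scoped WithZero Valued

section

variable {Δ : Type*} [DivisionRing Δ]

/-- `κ` is a system of representatives of the residue field of `w` closed under the ring
operations, and `π` is a uniformizer normalizing `κ`. -/
structure IsCyclicData (w : Valuation Δ ℤᵐ⁰) (κ : Subring Δ) (π : Δ) (m : ℕ) : Prop where
  mul_comm : ∀ x ∈ κ, ∀ y ∈ κ, x * y = y * x
  eq_one : ∀ y ∈ κ, y ≠ 0 → w y = 1
  approx : ∀ x, w x ≤ 1 → ∃ y ∈ κ, w (x - y) < 1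
  pos : 0 < m
  val_uniformizer : w π = exp (-(m : ℤ))
  values : ∀ x, x ≠ 0 → ∃ j : ℤ, w x = exp (-(m * j : ℤ))
  conj : ∀ y ∈ κ, π * y * π⁻¹ ∈ κ

lemma val_mul_sub_mul_lt {w : Valuation Δ ℤᵐ⁰} {x x' y y' : Δ} (hx : w x ≤ 1) (hy : w y' ≤ 1)
    (h1 : w (x - x') < 1) (h2 : w (y - y') < 1) : w (x * y - x' * y') < 1 := by
  have e : x * y - x' * y' = x * (y - y') + (x - x') * y' := by noncomm_ring
  rw [e]
  refine (w.map_add _ _).trans_lt (max_lt ?_ ?_)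
  · rw [map_mul]
    exact mul_lt_one_of_nonneg_of_lt_one_right hx zero_le h2
  · rw [map_mul]
    exact mul_lt_one_of_nonneg_of_lt_one_left zero_le h1 hy

lemma val_pow_sub_pow_lt {w : Valuation Δ ℤᵐ⁰} {x y : Δ} (hx : w x ≤ 1) (hy : w y ≤ 1)
    (h : w (x - y) < 1) (i : ℕ) : w (x ^ i - y ^ i) < 1 := by
  induction i with
  | zero => simp
  | succ i ih =>
    rw [pow_succ, pow_succ]
    exact val_mul_sub_mul_lt (by rw [map_pow]; exact pow_le_one' hx _) hy ih h

lemma eq_of_val_sub_lt {w : Valuation Δ ℤᵐ⁰} {κ : Subring Δ}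
    (h : ∀ y ∈ κ, y ≠ 0 → w y = 1) {x y : Δ} (hx : x ∈ κ) (hy : y ∈ κ) (hxy : w (x - y) < 1) :
    x = y := by
  by_contra hne
  exact hxy.ne (h _ (sub_mem hx hy) (sub_ne_zero.2 hne))

lemma val_le_one_of_mem {w : Valuation Δ ℤᵐ⁰} {κ : Subring Δ}
    (h : ∀ y ∈ κ, y ≠ 0 → w y = 1) {x : Δ} (hx : x ∈ κ) : w x ≤ 1 := by
  rcases eq_or_ne x 0 with rfl | h0
  · simp
  · exact (h x hx h0).le

lemma relIndex_eq_card_coefficientField {w : Valuation Δ ℤᵐ⁰} {κ : Subring Δ}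
    (h : ∀ y ∈ κ, y ≠ 0 → w y = 1) (h' : ∀ x, w x ≤ 1 → ∃ y ∈ κ, w (x - y) < 1) :
    (ball w (exp (-1 : ℤ))).relIndex (ball w 1) = Nat.card κ := by
  refine relIndex_eq_card_of_complement (T := κ.toAddSubgroup) (le_antisymm ?_ ?_) ?_
  · refine sup_le (fun x hx => val_le_one_of_mem h hx) fun x hx => ?_
    exact (lt_one_iff_le_exp.2 hx).le
  · intro x hx
    obtain ⟨y, hy, hxy⟩ := h' x hx
    exact AddSubgroup.mem_sup.2 ⟨y, hy, x - y, lt_one_iff_le_exp.1 hxy, by simp⟩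
  · rw [eq_bot_iff]
    intro x hx
    refine eq_of_val_sub_lt h hx.1 (zero_mem _) ?_
    rw [sub_zero]
    exact lt_one_iff_le_exp.2 hx.2

/-- A uniformizer can be changed so that it normalizes a given coefficient field. -/
lemma exists_normalizing_uniformizer {w : Valuation Δ ℤᵐ⁰} {κ : Subring Δ} [Finite κ]
    (h : ∀ y ∈ κ, y ≠ 0 → w y = 1) (h' : ∀ x, w x ≤ 1 → ∃ y ∈ κ, w (x - y) < 1)
    {π₀ : Δ} (hπ₀ : π₀ ≠ 0) : ∃ π, w π = w π₀ ∧ ∀ y ∈ κ, π * y * π⁻¹ ∈ κ := by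
  classical
  let _ : Fintype κ := Fintype.ofFinite κ
  have hw0 : w π₀ ≠ 0 := (w.ne_zero_iff).2 hπ₀
  have hconj : ∀ a : κ, w (π₀ * a * π₀⁻¹) ≤ 1 := by
    intro a
    rw [map_mul, map_mul, map_inv₀, mul_right_comm, mul_inv_cancel₀ hw0, one_mul]
    exact val_le_one_of_mem h a.2
  choose s hs1 hs2 using fun a : κ => h' _ (hconj a)
  have hs0 : s 0 = 0 := eq_of_val_sub_lt h (hs1 0) (zero_mem _) (by
    have := hs2 0
    rw [Valuation.map_sub_swap] at this
    simpa using this)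
  have hsmul : ∀ a b : κ, s (a * b) = s a * s b := by
    intro a b
    refine eq_of_val_sub_lt h (hs1 _) (mul_mem (hs1 a) (hs1 b)) ?_
    have e : s (a * b) - s a * s b = (π₀ * a * π₀⁻¹ * (π₀ * b * π₀⁻¹) - s a * s b) -
        (π₀ * ((a * b : κ) : Δ) * π₀⁻¹ - s (a * b)) := by
      have : π₀ * a * π₀⁻¹ * (π₀ * b * π₀⁻¹) = π₀ * ((a * b : κ) : Δ) * π₀⁻¹ := by
        simp only [Subring.coe_mul, mul_assoc, inv_mul_cancel_left₀ hπ₀]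
      rw [this]
      abel
    rw [e]
    exact (w.map_sub _ _).trans_lt (max_lt
      (val_mul_sub_mul_lt (hconj a) (val_le_one_of_mem h (hs1 b)) (hs2 a) (hs2 b)) (hs2 _))
  have hsne : ∀ a : κ, a ≠ 0 → s a ≠ 0 := by
    intro a ha hsa
    have h1 := hs2 a
    rw [hsa, sub_zero, map_mul, map_mul, map_inv₀, mul_right_comm, mul_inv_cancel₀ hw0, one_mul,
      h a a.2 (by simpa using ha)] at h1
    exact lt_irrefl _ h1
  -- A twisted average of `π₀`, where `s` is the map that conjugation by `π₀` induces on
  -- representatives of residues. The term of 0 vanishes and the others are congruent to `π₀`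
  -- relative to its value, so the sum is congruent to (|κ| - 1) π₀ = -π₀ and has the value of `π₀`.
  let π := ∑ a : κ, (s a)⁻¹ * π₀ * a
  have hπ : w (π * π₀⁻¹ + 1) < 1 := by
    have e : π * π₀⁻¹ + 1 = ∑ a : κ, ((s a)⁻¹ * π₀ * a * π₀⁻¹ - if a = 0 then 0 else 1) := by
      rw [Finset.sum_sub_distrib, ← Finset.sum_mul, sub_eq_add_neg]
      congr 1
      have h1 : ∑ a : κ, (if a = 0 then (0 : Δ) else 1) = ∑ a : κ, (1 - if a = 0 then (1 : Δ) else 0) :=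
        Finset.sum_congr rfl fun a _ => by split_ifs <;> simp
      have h2 : ((Fintype.card κ : κ) : Δ) = 0 := by rw [Nat.cast_card_eq_zero]; rfl
      rw [h1, Finset.sum_sub_distrib]
      simp only [Finset.sum_const, Finset.card_univ, nsmul_eq_mul, mul_one, Finset.sum_ite_eq',
        Finset.mem_univ, if_true]
      have h3 : ((Fintype.card κ : κ) : Δ) = (Fintype.card κ : Δ) :=
        map_natCast κ.subtype _
      rw [← h3, h2]
      simp
    rw [e]
    refine w.map_sum_lt one_ne_zero fun a _ => ?_
    split_ifs with ha
    · simp [ha]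
    · have hsa := hsne a ha
      have e2 : (s a)⁻¹ * π₀ * a * π₀⁻¹ - 1 = (s a)⁻¹ * (π₀ * a * π₀⁻¹ - s a) := by
        rw [mul_sub, inv_mul_cancel₀ hsa]
        simp only [mul_assoc]
      rw [e2, map_mul, map_inv₀, h _ (hs1 a) hsa, inv_one, one_mul]
      exact hs2 a
  have hval : w (π * π₀⁻¹) = 1 := by
    have := w.map_sub_eq_of_lt_right (x := π * π₀⁻¹ + 1) (y := 1) (by simpa using hπ)
    simpa using this
  have hwπ : w π = w π₀ := by
    rw [map_mul, map_inv₀] at hval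
    exact eq_of_mul_inv_eq_one hval
  have hπ0 : π ≠ 0 := (w.ne_zero_iff).1 (by rw [hwπ]; exact hw0)
  refine ⟨π, hwπ, fun z hz => ?_⟩
  rcases eq_or_ne z 0 with rfl | hz0
  · simp
  have hz0' : (⟨z, hz⟩ : κ) ≠ 0 := fun hh => hz0 (congrArg Subtype.val hh)
  -- Replacing `a` by `a * z` permutes the summands and moves `z` across the sum as `s z`.
  have hkey : s ⟨z, hz⟩ * π = π * z := by
    have hinj : Function.Injective fun a : κ => a * ⟨z, hz⟩ := by
      intro a b hab
      have : (a : Δ) * z = b * z := congrArg Subtype.val hab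
      exact Subtype.ext (mul_right_cancel₀ hz0 this)
    let e := Equiv.ofBijective _ (Finite.injective_iff_bijective.1 hinj)
    have hL : π = ∑ a : κ, (s (e a))⁻¹ * π₀ * ((e a : κ) : Δ) :=
      (Equiv.sum_comp e fun a : κ => (s a)⁻¹ * π₀ * (a : Δ)).symm
    have hR : π * z = ∑ a : κ, (s a)⁻¹ * π₀ * a * z := Finset.sum_mul _ _ _
    rw [hR, hL, Finset.mul_sum]
    refine Finset.sum_congr rfl fun a _ => ?_
    change s ⟨z, hz⟩ * ((s (a * ⟨z, hz⟩))⁻¹ * π₀ * ((a * ⟨z, hz⟩ : κ) : Δ)) = _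
    rw [hsmul, mul_inv_rev]
    simp only [Subring.coe_mul, mul_assoc, mul_inv_cancel_left₀ (hsne _ hz0')]
  rw [← hkey, mul_inv_cancel_right₀ hπ0]
  exact hs1 _

end

variable {K : Type*} [Field K] [Valued K ℤᵐ⁰] [CompactSpace 𝒪[K]] {q : ℕ}
variable {Δ : Type*} [DivisionRing Δ] [Algebra K Δ] [FiniteDimensional K Δ]

/-- Lift a generator of the multiplicative group of the residue field to a Teichmüller element `ζ`.
In the commutative ring generated by `ζ`, the elements fixed by the `p ^ m`-th power map form a
subring because the characteristic is `p`. Its nonzero elements are roots of unity, hence of value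
1, and the powers of `ζ` represent all nonzero residues. -/
lemma exists_coefficientField (hK : IsDiscreteWithCard (Valued.v : Valuation K ℤᵐ⁰) q) (p : ℕ)
    [Fact p.Prime] [CharP Δ p] : ∃ κ : Subring Δ, (∀ x ∈ κ, ∀ y ∈ κ, x * y = y * x) ∧
      (∀ y ∈ κ, y ≠ 0 → divValuation K Δ hK.exists_uniformizer y = 1) ∧
      ∀ x, divValuation K Δ hK.exists_uniformizer x ≤ 1 →
        ∃ y ∈ κ, divValuation K Δ hK.exists_uniformizer (x - y) < 1 := by
  obtain ⟨-, ⟨g, hg1, hg⟩, m, hm, hpow⟩ := residue_properties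
    (divValuation K Δ hK.exists_uniformizer) (ball_relIndex_ball_ne_zero hK _) p
  obtain ⟨ζ, hζ, hζg⟩ := exists_teichmuller_lift hK p hm hpow g hg1.le
  set w := divValuation K Δ hK.exists_uniformizer
  have hcomm : ∀ x ∈ Subring.closure {ζ}, ∀ y ∈ Subring.closure {ζ}, x * y = y * x := by
    intro x hx y hy
    have h1 : Subring.closure {ζ} ≤ Subring.centralizer ({ζ} : Set Δ) := by
      rw [Subring.closure_le]
      rintro _ rfl
      exact Subring.mem_centralizer_iff.2 fun _ h => by rw [Set.mem_singleton_iff.1 h]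
    have h2 := Subring.closure_le_centralizer_centralizer ({ζ} : Set Δ) hx
    exact ((Subring.mem_centralizer_iff.1 h2) y (h1 hy)).symm
  have hp := (Fact.out : p.Prime)
  have hζmem : ζ ∈ Subring.closure {ζ} := Subring.subset_closure (Set.mem_singleton ζ)
  let κ : Subring Δ :=
    { carrier := {y | y ∈ Subring.closure {ζ} ∧ y ^ p ^ m = y}
      mul_mem' := fun {a b} ha hb => ⟨mul_mem ha.1 hb.1, by
        rw [Commute.mul_pow (hcomm a ha.1 b hb.1), ha.2, hb.2]⟩
      one_mem' := ⟨one_mem _, one_pow _⟩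
      add_mem' := fun {a b} ha hb => ⟨add_mem ha.1 hb.1, by
        rw [add_pow_char_pow_of_commute _ _ (hcomm a ha.1 b hb.1), ha.2, hb.2]⟩
      zero_mem' := ⟨zero_mem _, zero_pow (pow_ne_zero _ hp.ne_zero)⟩
      neg_mem' := fun {a} ha => ⟨neg_mem ha.1, by
        have h := sub_pow_char_pow_of_commute p m (Commute.zero_left a)
        rw [zero_pow (pow_ne_zero _ hp.ne_zero), ha.2, zero_sub] at h
        exact h⟩ }
  refine ⟨κ, fun x hx y hy => hcomm x hx.1 y hy.1, fun y hy hy0 => ?_, fun x hx => ?_⟩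
  · have h1 : 1 < p ^ m := Nat.one_lt_pow hm hp.one_lt
    have h2 : y ^ (p ^ m - 1) = 1 := by
      refine mul_right_cancel₀ hy0 ?_
      rw [← pow_succ, Nat.sub_add_cancel h1.le, one_mul, hy.2]
    have h3 : w y ^ (p ^ m - 1) = 1 := by rw [← map_pow, h2, map_one]
    exact (pow_eq_one_iff.1 h3).resolve_right (by omega)
  · rcases hx.lt_or_eq with hlt | heq
    · exact ⟨0, zero_mem _, by simpa using hlt⟩
    · obtain ⟨i, hi⟩ := hg x heq
      have hζ1 : w ζ ≤ 1 := by
        have : ζ = g - (g - ζ) := by abel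
        rw [this]
        exact (w.map_sub _ _).trans (max_le hg1.le hζg.le)
      refine ⟨ζ ^ i, ⟨pow_mem hζmem i, ?_⟩, ?_⟩
      · exact (pow_right_comm ζ i (p ^ m)).trans (by rw [hζ])
      · have e : x - ζ ^ i = (x - g ^ i) + (g ^ i - ζ ^ i) := by abel
        rw [e]
        exact (w.map_add _ _).trans_lt (max_lt hi (val_pow_sub_pow_lt hg1.le hζ1 hζg i))

lemma exists_isCyclicData (hK : IsDiscreteWithCard (Valued.v : Valuation K ℤᵐ⁰) q) (p : ℕ)
    [Fact p.Prime] [CharP Δ p] : ∃ (κ : Subring Δ) (π : Δ) (m : ℕ), Finite κ ∧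
      IsCyclicData (divValuation K Δ hK.exists_uniformizer) κ π m := by
  obtain ⟨κ, h1, h2, h3⟩ := exists_coefficientField (Δ := Δ) hK p
  have hfin : Finite κ := Nat.finite_of_card_ne_zero (by
    rw [← relIndex_eq_card_coefficientField h2 h3]
    exact ball_relIndex_ball_ne_zero hK _)
  obtain ⟨m, π₀, hm, hπ₀, hval⟩ := exists_uniformizer (divValuation K Δ hK.exists_uniformizer) (by
    obtain ⟨ϖ, hϖ⟩ := hK.exists_uniformizer
    refine ⟨algebraMap K Δ ϖ, by simpa using ne_zero_of_valuation_eq_exp hϖ, ?_⟩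
    rw [divValuation_algebraMap, hϖ]
    refine pow_lt_one₀ zero_le ?_ Module.finrank_pos.ne'
    rw [← exp_zero, exp_lt_exp]
    norm_num)
  have h0 : π₀ ≠ 0 := by
    rintro rfl
    rw [map_zero] at hπ₀
    exact exp_ne_zero hπ₀.symm
  obtain ⟨π, hπ, hconj⟩ := exists_normalizing_uniformizer h2 h3 h0
  exact ⟨κ, π, m, hfin, h1, h2, h3, hm, hπ.trans hπ₀, hval, hconj⟩

end CoefficientField


/-! ### Expansions in the uniformizer and the centre of the division algebra. -/

section CyclicStructure

open WithZero
open scoped WithZero Valued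

variable {K : Type*} [Field K] [Valued K ℤᵐ⁰] [CompactSpace 𝒪[K]] {q : ℕ}
variable {Δ : Type*} [DivisionRing Δ] [Algebra K Δ] [FiniteDimensional K Δ]
variable (hK : IsDiscreteWithCard (Valued.v : Valuation K ℤᵐ⁰) q) {κ : Subring Δ} {π : Δ} {m : ℕ}

section

omit [Field K] [Valued K ℤᵐ⁰] [CompactSpace 𝒪[K]] [Algebra K Δ] [FiniteDimensional K Δ]

variable {w : Valuation Δ ℤᵐ⁰}

lemma IsCyclicData.ne_zero (h : IsCyclicData w κ π m) : π ≠ 0 := by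
  rintro rfl
  have := h.val_uniformizer
  rw [map_zero] at this
  exact exp_ne_zero this.symm

lemma IsCyclicData.val_pow (h : IsCyclicData w κ π m) (i : ℕ) :
    w (π ^ i) = exp (-(m * i : ℤ)) := by
  rw [map_pow, h.val_uniformizer, ← exp_nsmul, exp_inj, nsmul_eq_mul]
  ring

lemma IsCyclicData.conj_pow (h : IsCyclicData w κ π m) (l : ℕ) {y : Δ} (hy : y ∈ κ) :
    π ^ l * y * (π ^ l)⁻¹ ∈ κ := by
  induction l with
  | zero => simpa using hy
  | succ l ih =>
    have e : π ^ (l + 1) * y * (π ^ (l + 1))⁻¹ = π * (π ^ l * y * (π ^ l)⁻¹) * π⁻¹ := by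
      rw [pow_succ', mul_inv_rev]
      simp only [mul_assoc]
    rw [e]
    exact h.conj _ ih

lemma IsCyclicData.le_one_of_mem (h : IsCyclicData w κ π m) {y : Δ} (hy : y ∈ κ) : w y ≤ 1 :=
  val_le_one_of_mem h.eq_one hy

lemma IsCyclicData.eq_of_sub_lt (h : IsCyclicData w κ π m) {x y : Δ} (hx : x ∈ κ) (hy : y ∈ κ)
    (hxy : w (x - y) < 1) : x = y :=
  eq_of_val_sub_lt h.eq_one hx hy hxy

lemma IsCyclicData.val_le_of_lt_one (h : IsCyclicData w κ π m) {x : Δ} (hx : w x < 1) :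
    w x ≤ exp (-(m : ℤ)) := by
  rcases eq_or_ne x 0 with rfl | hx0
  · simp
  obtain ⟨j, hj⟩ := h.values x hx0
  rw [hj, ← exp_zero, exp_lt_exp] at hx
  rw [hj, exp_le_exp]
  have hm : (0 : ℤ) < m := by exact_mod_cast h.pos
  have : 1 ≤ j := by
    by_contra hj'
    have := mul_nonpos_of_nonneg_of_nonpos hm.le (show j ≤ 0 by omega)
    omega
  nlinarith

lemma IsCyclicData.val_mul_inv_le (h : IsCyclicData w κ π m) {x : Δ} (i : ℕ)
    (hx : w x ≤ exp (-(m * i : ℤ))) : w (x * (π ^ i)⁻¹) ≤ 1 := by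
  rw [map_mul, map_inv₀, h.val_pow, mul_inv_le_iff₀ exp_pos, one_mul]
  exact hx

/-- Truncated expansions in powers of the uniformizer. -/
lemma IsCyclicData.exists_expansion (h : IsCyclicData w κ π m) {x : Δ} (hx : w x ≤ 1) (l : ℕ) :
    ∃ (y : ℕ → Δ) (x' : Δ), (∀ i, y i ∈ κ) ∧ w x' ≤ 1 ∧
      x = ∑ i ∈ Finset.range l, y i * π ^ i + x' * π ^ l := by
  induction l with
  | zero => exact ⟨0, x, fun _ => zero_mem _, hx, by simp⟩
  | succ l ih =>
    obtain ⟨y, x', hy, hx', hxe⟩ := ih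
    obtain ⟨z, hz, hxz⟩ := h.approx x' hx'
    refine ⟨Function.update y l z, (x' - z) * (π ^ 1)⁻¹, fun i => ?_,
      h.val_mul_inv_le 1 (by simpa using h.val_le_of_lt_one hxz), ?_⟩
    · rcases eq_or_ne i l with rfl | hi
      · simpa using hz
      · simpa [hi] using hy i
    · rw [Finset.sum_range_succ, Function.update_self, pow_one, pow_succ', mul_assoc,
        inv_mul_cancel_left₀ h.ne_zero, sub_mul, add_assoc, add_sub_cancel]
      conv_lhs => rw [hxe]
      congr 1
      refine Finset.sum_congr rfl fun i hi => ?_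
      rw [Function.update_of_ne (Finset.mem_range.1 hi).ne]

/-- Right multiplication by powers of `π` identifies each layer of the filtration with the residue
field. -/
lemma IsCyclicData.relIndex_ball (h : IsCyclicData w κ π m) (i : ℕ) :
    (ball w (exp (-(m * i : ℤ)))).relIndex (ball w 1) = Nat.card κ ^ i := by
  have hmap : ∀ (i : ℕ) (j : ℤ), (ball w (exp j)).map (AddMonoidHom.mulRight (π ^ i)) =
      ball w (exp (j - m * i)) := by
    intro i j
    have hp := h.val_pow i
    ext x
    constructor
    · rintro ⟨y, hy, rfl⟩
      change w (y * π ^ i) ≤ _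
      rw [map_mul, hp, sub_eq_add_neg, exp_add]
      exact mul_le_mul_left hy _
    · intro hx
      refine ⟨x * (π ^ i)⁻¹, ?_, by simp [h.ne_zero]⟩
      change w (x * (π ^ i)⁻¹) ≤ _
      rw [map_mul, map_inv₀, hp, mul_inv_le_iff₀ exp_pos, ← exp_add, ← sub_eq_add_neg]
      exact hx
  have hJ : ball w (exp (-(m : ℤ))) = ball w (exp (-1 : ℤ)) := by
    ext x
    refine ⟨fun hx => show w x ≤ _ from le_trans (show w x ≤ _ from hx) ?_, fun hx => h.val_le_of_lt_one (lt_one_iff_le_exp.2 hx)⟩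
    rw [exp_le_exp]
    have := h.pos
    omega
  have hcard := relIndex_eq_card_coefficientField h.eq_one h.approx
  induction i with
  | zero => simp
  | succ i ih =>
    have hinj : Function.Injective (AddMonoidHom.mulRight (π ^ i)) :=
      mul_left_injective₀ (pow_ne_zero _ h.ne_zero)
    have hle : ∀ {a b : ℤ}, a ≤ b → ball w (exp a) ≤ ball w (exp b) := fun hab x hx =>
      le_trans hx (exp_le_exp.2 hab)
    have hm := h.pos
    rw [← AddSubgroup.relIndex_mul_relIndex _ (ball w (exp (-(m * i : ℤ)))) _
      (hle (by push_cast; nlinarith)) (by rw [← exp_zero]; exact hle (by nlinarith)), ih, pow_succ',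
      ← hcard, ← hJ]
    congr 1
    have h0 := hmap i 0
    rw [zero_sub, exp_zero] at h0
    have h1 := hmap i (-m)
    rw [← h0, show (-(m * ((i + 1 : ℕ) : ℤ))) = -m - m * i by push_cast; ring, ← h1,
      AddSubgroup.relIndex_map_map_of_injective _ _ hinj]

end

variable (h : IsCyclicData (divValuation K Δ hK.exists_uniformizer) κ π m)

include hK h

/-- The norm gives a uniformizer of `K` the value `exp (-finrank)`, which must be a power of the
value of `π`. The exponent `e` is the ramification index. -/
lemma IsCyclicData.exists_ramification : ∃ e : ℕ, 0 < e ∧ Module.finrank K Δ = m * e := by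
  obtain ⟨ϖ, hϖ⟩ := hK.exists_uniformizer
  obtain ⟨j, hj⟩ := h.values (algebraMap K Δ ϖ)
    (by simpa using ne_zero_of_valuation_eq_exp hϖ)
  rw [divValuation_algebraMap, hϖ, ← exp_nsmul, exp_inj, nsmul_eq_mul] at hj
  have hN : (0 : ℤ) < Module.finrank K Δ := by exact_mod_cast Module.finrank_pos
  have hm : (0 : ℤ) < m := by exact_mod_cast h.pos
  have hj0 : 0 < j := by
    by_contra hcon
    have := mul_nonpos_of_nonneg_of_nonpos hm.le (not_lt.1 hcon)
    linarith
  refine ⟨j.toNat, by omega, ?_⟩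
  have : (Module.finrank K Δ : ℤ) = m * (j.toNat : ℤ) := by
    rw [Int.toNat_of_nonneg hj0.le]
    linarith
  exact_mod_cast this

variable {e : ℕ} (he : Module.finrank K Δ = m * e)

include he

omit h in
lemma divValuation_smul (c : K) (x : Δ) :
    divValuation K Δ hK.exists_uniformizer (c • x) =
      Valued.v c ^ (m * e) * divValuation K Δ hK.exists_uniformizer x := by
  rw [Algebra.smul_def, map_mul, divValuation_algebraMap, he]

/-- Since a uniformizer `ϖ` of `K` is central and `u = ϖ * (π ^ e)⁻¹` has value 1, conjugation by `π
^ e` is conjugation by `u⁻¹`. It is trivial on residues, which commute, and elements of `κ` are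
determined by their residues. -/
lemma IsCyclicData.pow_comm {y : Δ} (hy : y ∈ κ) : π ^ e * y = y * π ^ e := by
  set w := divValuation K Δ hK.exists_uniformizer with hw
  obtain ⟨ϖ, hϖ⟩ := hK.exists_uniformizer
  have hπ := pow_ne_zero e h.ne_zero
  set u := algebraMap K Δ ϖ * (π ^ e)⁻¹ with hu
  have hwu : w u = 1 := by
    rw [hu, map_mul, map_inv₀, h.val_pow, hw, divValuation_algebraMap, hϖ, he, ← exp_nsmul,
      ← exp_neg, ← exp_add, ← exp_zero, exp_inj]
    simp
  obtain ⟨u₀, hu₀, huu₀⟩ := h.approx u hwu.le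
  have hu₀0 : u₀ ≠ 0 := by
    rintro rfl
    rw [sub_zero, hwu] at huu₀
    exact lt_irrefl _ huu₀
  set y' := π ^ e * y * (π ^ e)⁻¹ with hy'
  have hy'κ : y' ∈ κ := h.conj_pow e hy
  have hcomm : u * y' = y * u := by
    have h1 : u * y' = algebraMap K Δ ϖ * (y * (π ^ e)⁻¹) := by
      rw [hu, hy']
      simp only [mul_assoc, inv_mul_cancel_left₀ hπ]
    rw [h1, hu, ← mul_assoc, ← mul_assoc, Algebra.commutes]
  have hlt : w (u₀ * y' - y * u₀) < 1 := by
    have e1 : u₀ * y' - y * u₀ = (y * u - y * u₀) - (u * y' - u₀ * y') := by rw [hcomm]; abel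
    rw [e1]
    refine (w.map_sub _ _).trans_lt (max_lt ?_ ?_)
    · exact val_mul_sub_mul_lt (h.le_one_of_mem hy) (h.le_one_of_mem hu₀) (by simp) huu₀
    · exact val_mul_sub_mul_lt hwu.le (h.le_one_of_mem hy'κ) huu₀ (by simp)
  have heq := h.eq_of_sub_lt (mul_mem hu₀ hy'κ) (mul_mem hy hu₀) hlt
  rw [h.mul_comm y hy u₀ hu₀] at heq
  have heq := mul_left_cancel₀ hu₀0 heq
  rw [hy'] at heq
  conv_rhs => rw [← heq]
  rw [inv_mul_cancel_right₀ hπ]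

/-- The valuation ring is generated by the products of elements of `κ` and powers of `π`. -/
lemma IsCyclicData.exists_eq_sum [Finite κ] {x : Δ}
    (hx : divValuation K Δ hK.exists_uniformizer x ≤ 1) :
    ∃ c : κ × Fin e → K, (∀ i, Valued.v (c i) ≤ (1 : ℤᵐ⁰)) ∧
      letI := Fintype.ofFinite κ
      x = ∑ i, c i • ((i.1 : Δ) * π ^ (i.2 : ℕ)) := by
  classical
  let _ := Fintype.ofFinite κ
  set w := divValuation K Δ hK.exists_uniformizer with hw
  obtain ⟨ϖ, hϖ⟩ := hK.exists_uniformizer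
  have hϖ0 := ne_zero_of_valuation_eq_exp hϖ
  have hme : 1 ≤ m * e := by rw [← he]; exact Module.finrank_pos
  let f : (κ × Fin e → K) →ₗ[K] Δ :=
    Fintype.linearCombination K fun i : κ × Fin e => (i.1 : Δ) * π ^ (i.2 : ℕ)
  have hf : ∀ c, f c = ∑ i, c i • ((i.1 : Δ) * π ^ (i.2 : ℕ)) := fun c => rfl
  have hstep : ∀ x, w x ≤ 1 → ∃ c ∈ stdLattice (Valued.v : Valuation K ℤᵐ⁰) (κ × Fin e),
      ∃ x', w x' ≤ 1 ∧ x = f c + ϖ • x' := by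
    intro x hx
    obtain ⟨y, x', hy, hx', hxe⟩ := h.exists_expansion hx e
    -- The coefficients are 0 or 1: for each exponent they select the one representative that occurs
    -- in the expansion. The remainder after `e` terms is divisible by `ϖ`.
    refine ⟨fun i => if (i.1 : Δ) = y i.2 then 1 else 0, fun i => ?_, ϖ⁻¹ • (x' * π ^ e), ?_, ?_⟩
    · change Valued.v (if _ then (1 : K) else 0) ≤ _
      split_ifs <;> simp
    · rw [divValuation_smul hK he, map_mul, h.val_pow, map_inv₀, hϖ, ← exp_neg, ← exp_nsmul,
        mul_left_comm, ← exp_add]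
      refine mul_le_one' hx' ?_
      rw [← exp_zero, exp_le_exp]
      simp
    · rw [smul_smul, mul_inv_cancel₀ hϖ0, one_smul, hf, Fintype.sum_prod_type_right]
      conv_lhs => rw [hxe]
      congr 1
      rw [Finset.sum_range]
      refine Finset.sum_congr rfl fun l _ => ?_
      rw [Finset.sum_eq_single (⟨y l, hy l⟩ : κ)]
      · simp
      · intro z _ hz
        rw [if_neg (fun hh => hz (Subtype.ext hh)), zero_smul]
      · simp
  have happrox : ∀ (i : ℕ) (x : Δ), w x ≤ 1 →
      ∃ c ∈ stdLattice (Valued.v : Valuation K ℤᵐ⁰) (κ × Fin e), w (x - f c) ≤ exp (-(i : ℤ)) := by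
    intro i
    induction i with
    | zero => exact fun x hx => ⟨0, zero_mem _, by simpa using hx⟩
    | succ i ih =>
      intro x hx
      obtain ⟨c, hc, x', hx', hxe⟩ := hstep x hx
      obtain ⟨c', hc', hxc'⟩ := ih x' hx'
      refine ⟨c + ϖ • c', add_mem hc fun j => ?_, ?_⟩
      · change Valued.v (ϖ * c' j) ≤ _
        rw [map_mul, hϖ]
        exact mul_le_one' (by rw [← exp_zero, exp_le_exp]; norm_num) (hc' j)
      · have e1 : x - f (c + ϖ • c') = ϖ • (x' - f c') := by
          rw [map_add, map_smul, smul_sub]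
          conv_lhs => rw [hxe]
          abel
        rw [e1, divValuation_smul hK he, hϖ, ← exp_nsmul]
        refine (mul_le_mul_right hxc' _).trans ?_
        rw [← exp_add, exp_le_exp, nsmul_eq_mul]
        have : (1 : ℤ) ≤ (m * e : ℕ) := by exact_mod_cast hme
        push_cast at this ⊢
        linarith
  let _ : TopologicalSpace Δ := moduleTopology K Δ
  have : IsModuleTopology K Δ := ⟨rfl⟩
  have := IsModuleTopology.isTopologicalRing K Δ
  have hcont : Continuous f := continuous_linearMap_pi f
  -- Compactness of the lattice of coefficients turns approximations of arbitrary precision into an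
  -- equality.
  let Z : ℕ → Set (κ × Fin e → K) := fun i =>
    (stdLattice (Valued.v : Valuation K ℤᵐ⁰) (κ × Fin e) : Set (κ × Fin e → K)) ∩ {c | w (x - f c) ≤ exp (-(i : ℤ))}
  have hcl : ∀ i : ℕ, IsClosed {c | w (x - f c) ≤ exp (-(i : ℤ))} := fun i =>
    (isClopen_setOf_valuation_le hϖ _).isClosed.preimage
      (continuous_norm.comp (continuous_const.sub hcont))
  have hclosed : IsClosed (stdLattice (Valued.v : Valuation K ℤᵐ⁰) (κ × Fin e) : Set (κ × Fin e → K)) := by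
    have e2 : (stdLattice (Valued.v : Valuation K ℤᵐ⁰) (κ × Fin e) : Set (κ × Fin e → K)) =
        ⋂ i, (fun c : κ × Fin e → K => c i) ⁻¹' {x | Valued.v x ≤ (exp 0 : ℤᵐ⁰)} := by
      ext c
      simp [stdLattice]
    rw [e2]
    exact isClosed_iInter fun i =>
      (isClopen_setOf_valuation_le hϖ 0).isClosed.preimage (continuous_apply i)
  obtain ⟨c, hc⟩ := IsCompact.nonempty_iInter_of_sequence_nonempty_isCompact_isClosed Z
    (fun i c hc => ⟨hc.1, le_trans hc.2 (exp_le_exp.2 (by push_cast; omega))⟩)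
    (fun i => happrox i x hx)
    ((isCompact_stdLattice _).inter_right (hcl 0)) (fun i => hclosed.inter (hcl i))
  rw [Set.mem_iInter] at hc
  refine ⟨c, (hc 0).1, ?_⟩
  change x = f c
  rw [← sub_eq_zero, ← w.zero_iff]
  by_contra hne
  obtain ⟨i, hi⟩ := eq_exp_of_ne_zero hne
  have := (hc ((-i).toNat + 1)).2
  rw [Set.mem_ofPred_eq, hi, exp_le_exp] at this
  omega

omit he in
lemma exists_pow_smul_val_le (x : Δ) {ϖ : K} (hϖ : Valued.v ϖ = (exp (-1 : ℤ) : ℤᵐ⁰)) :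
    ∃ i : ℕ, divValuation K Δ hK.exists_uniformizer (ϖ ^ i • x) ≤ 1 := by
  obtain ⟨e, -, he⟩ := h.exists_ramification hK
  have hme : (1 : ℤ) ≤ (m * e : ℕ) := by
    rw [← he]; exact_mod_cast Module.finrank_pos
  rcases eq_or_ne x 0 with rfl | hx
  · exact ⟨0, by simp⟩
  obtain ⟨j, hj⟩ := h.values x hx
  refine ⟨(-(m * j : ℤ)).toNat, ?_⟩
  rw [divValuation_smul hK he, hj, map_pow, hϖ, ← exp_nsmul, ← exp_nsmul, ← exp_add, ← exp_zero, exp_le_exp,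
    nsmul_eq_mul, nsmul_eq_mul]
  have h1 := Int.self_le_toNat (-(m * j : ℤ))
  have h2 := mul_le_mul_of_nonneg_right hme (Int.natCast_nonneg ((-(m * j : ℤ)).toNat))
  linarith

/-- `κ` and `π` generate the algebra over `K`, so an element commuting with them is central. -/
lemma IsCyclicData.mem_range_algebraMap [Finite κ] [Algebra.IsCentral K Δ] {z : Δ}
    (h1 : ∀ y ∈ κ, z * y = y * z) (h2 : z * π = π * z) : ∃ c, algebraMap K Δ c = z := by
  have hmem : z ∈ Subalgebra.center K Δ := by
    rw [Subalgebra.mem_center_iff]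
    intro x
    obtain ⟨ϖ, hϖ⟩ := hK.exists_uniformizer
    obtain ⟨i, hi⟩ := exists_pow_smul_val_le hK h x hϖ
    obtain ⟨c, -, hc⟩ := h.exists_eq_sum hK he hi
    have hc' : Commute (ϖ ^ i • x) z := by
      rw [hc]
      refine Commute.sum_left _ _ _ fun j _ => Commute.smul_left ?_ _
      exact (Commute.mul_left (h1 _ j.1.2).symm (Commute.pow_left (show Commute π z from h2.symm) _))
    have : Commute ((ϖ ^ i)⁻¹ • ϖ ^ i • x) z := hc'.smul_left _
    rwa [smul_smul, inv_mul_cancel₀ (pow_ne_zero _ (ne_zero_of_valuation_eq_exp hϖ)),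
      one_smul] at this
  rw [Algebra.IsCentral.center_eq_bot, Algebra.mem_bot] at hmem
  exact hmem

lemma IsCyclicData.exists_pow_eq [Finite κ] [Algebra.IsCentral K Δ] :
    ∃ ϖ : K, Valued.v ϖ = (exp (-1 : ℤ) : ℤᵐ⁰) ∧ π ^ e = algebraMap K Δ ϖ := by
  obtain ⟨ϖ, hϖ⟩ := h.mem_range_algebraMap hK he (z := π ^ e) (fun y hy => h.pow_comm hK he hy)
    (pow_mul_comm' π e)
  refine ⟨ϖ, ?_, hϖ.symm⟩
  have h1 := h.val_pow e
  have hN : Module.finrank K Δ ≠ 0 := Module.finrank_pos.ne'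
  rw [← hϖ, divValuation_algebraMap] at h1
  have h2 : Valued.v ϖ ^ Module.finrank K Δ = (exp (-1 : ℤ) : ℤᵐ⁰) ^ Module.finrank K Δ := by
    rw [h1, ← exp_nsmul, exp_inj, he]
    simp
  exact (pow_left_inj₀ zero_le zero_le hN).1 h2

/-- Otherwise `π ^ l` would be a scalar, but the exponents of values of scalars are divisible by `m
* e`. -/
lemma IsCyclicData.exists_not_comm [Finite κ] [Algebra.IsCentral K Δ] {l : ℕ} (hl : 0 < l)
    (hle : l < e) : ∃ y ∈ κ, π ^ l * y ≠ y * π ^ l := by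
  by_contra! hcon
  obtain ⟨c, hc⟩ := h.mem_range_algebraMap hK he hcon (pow_mul_comm' π l)
  have h1 := h.val_pow l
  have hc0 : c ≠ 0 := by
    rintro rfl
    rw [map_zero] at hc
    exact pow_ne_zero l h.ne_zero hc.symm
  obtain ⟨i, hi⟩ := eq_exp_of_ne_zero (((Valued.v : Valuation K ℤᵐ⁰).ne_zero_iff).2 hc0)
  rw [← hc, divValuation_algebraMap, hi, ← exp_nsmul, exp_inj, he, nsmul_eq_mul] at h1
  have hm : (m : ℤ) ≠ 0 := by exact_mod_cast h.pos.ne'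
  push_cast at h1
  have h2 : (e : ℤ) * (-i) = l := mul_left_cancel₀ hm (by linarith)
  have h3 : (e : ℤ) ∣ l := ⟨_, h2.symm⟩
  have h4 : e ∣ l := by exact_mod_cast h3
  exact absurd (Nat.le_of_dvd hl h4) (by omega)

end CyclicStructure


/-! ### Residue degree, ramification index and an integral basis. -/

section CyclicBasis

open WithZero
open scoped WithZero Valued

/-- Artin's theorem for a cyclic group of automorphisms of a finite field. -/
lemma exists_basis_of_orderOf {L : Type*} [Field L] [Finite L] (σ : RingAut L) :
    (∃ ζ : Fin (orderOf σ) → L, ∀ y, ∃ c : Fin (orderOf σ) → L,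
      (∀ i, σ (c i) = c i) ∧ y = ∑ i, c i * ζ i) ∧
    Nat.card L = Nat.card {y : L // σ y = y} ^ orderOf σ := by
  have : Finite (RingAut L) := Finite.of_injective (fun f : RingAut L => (f : L → L))
    DFunLike.coe_injective
  let G := Subgroup.zpowers σ
  let _ : Fintype G := Fintype.ofFinite G
  have hmem : ∀ y : L, y ∈ FixedPoints.subfield G L ↔ σ y = y := by
    intro y
    refine ⟨fun h => h ⟨σ, Subgroup.mem_zpowers σ⟩, fun h g => ?_⟩
    have : G ≤ MulAction.stabilizer (RingAut L) y := by
      rw [Subgroup.zpowers_le]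
      exact h
    exact this g.2
  have hfin : Module.finrank (FixedPoints.subfield G L) L = orderOf σ := by
    rw [FixedPoints.finrank_eq_card, ← Nat.card_eq_fintype_card, Nat.card_zpowers]
  have : Module.Finite (FixedPoints.subfield G L) L := Module.Finite.of_finite
  let b := Module.finBasisOfFinrankEq (FixedPoints.subfield G L) L hfin
  refine ⟨⟨b, fun y => ⟨fun i => b.repr y i, fun i => (hmem _).1 (b.repr y i).2, ?_⟩⟩, ?_⟩
  · conv_lhs => rw [← b.sum_repr y]
    rfl
  · rw [Module.natCard_eq_pow_finrank (K := FixedPoints.subfield G L), hfin]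
    congr 1
    exact Nat.card_congr (Equiv.subtypeEquivRight hmem)

/-- Scaling preserves the index between two lattices, so the scaling factor found for a basis
lattice holds for every commensurable group. -/
lemma genIndex_scaleDown_self {K : Type*} [Field K] {v : Valuation K ℤᵐ⁰} {q : ℕ} {ι : Type*}
    [Fintype ι] {A : Type*} [Ring A] [Algebra K A] (hv : IsDiscreteWithCard v q) {c : K}
    (hc : c ≠ 0) (b : Module.Basis ι K A) {U : AddSubgroup A}
    (hU : U.Commensurable (basisLattice v b)) :
    (scaleDown c U).Commensurable U ∧
      genIndex (scaleDown c U) U * absValue q (v c) ^ Fintype.card ι = 1 := by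
  obtain ⟨h1, h2⟩ := scalesIndex_scaleDown hv hc b
  have h3 := commensurable_scaleDown hc hU
  refine ⟨(h3.trans h1).trans hU.symm, ?_⟩
  rw [← genIndex_mul (h3.trans h1) hU.symm, ← genIndex_mul h3 h1, genIndex_scaleDown hc,
    ← genIndex_inv U, mul_right_comm (genIndex U _), mul_inv_cancel₀ (genIndex_pos hU).ne', one_mul,
    h2]

variable {K : Type*} [Field K] [Valued K ℤᵐ⁰] [CompactSpace 𝒪[K]] {q : ℕ}
variable {Δ : Type*} [DivisionRing Δ] [Algebra K Δ] [FiniteDimensional K Δ]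
variable (hK : IsDiscreteWithCard (Valued.v : Valuation K ℤᵐ⁰) q) {κ : Subring Δ} {π : Δ} {m : ℕ}
variable (h : IsCyclicData (divValuation K Δ hK.exists_uniformizer) κ π m)
variable {e : ℕ} (he : Module.finrank K Δ = m * e) [Finite κ] [Algebra.IsCentral K Δ]

include h he

lemma IsCyclicData.mem_range_of_comm {y : Δ} (hy : y ∈ κ) (hπ : y * π = π * y) :
    ∃ c : K, Valued.v c ≤ (1 : ℤᵐ⁰) ∧ algebraMap K Δ c = y := by
  obtain ⟨c, rfl⟩ := h.mem_range_algebraMap hK he (fun z hz => h.mul_comm _ hy z hz) hπ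
  refine ⟨c, ?_, rfl⟩
  have h1 := h.le_one_of_mem hy
  rw [divValuation_algebraMap] at h1
  exact (pow_le_one_iff Module.finrank_pos.ne').1 h1

/-- The elements of `κ` commuting with `π` are scalars, and these scalars represent the residue
field of `K`. -/
lemma IsCyclicData.card_comm :
    Nat.card {y : κ // (y : Δ) * π = π * y} = q := by
  have hN : Module.finrank K Δ ≠ 0 := Module.finrank_pos.ne'
  set w := divValuation K Δ hK.exists_uniformizer with hw
  let T : AddSubgroup K := κ.toAddSubgroup.comap (algebraMap K Δ : K →+ Δ)
  have hT : ∀ c, c ∈ T ↔ algebraMap K Δ c ∈ κ := fun c => Iff.rfl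
  have hT1 : ∀ c ∈ T, Valued.v c ≤ (1 : ℤᵐ⁰) := by
    intro c hc
    have h1 : w (algebraMap K Δ c) ≤ 1 := h.le_one_of_mem hc
    rw [hw, divValuation_algebraMap] at h1
    exact (pow_le_one_iff hN).1 h1
  have hJ : ∀ c : K, c ∈ ball (Valued.v : Valuation K ℤᵐ⁰) (exp (-1 : ℤ)) ↔
      Valued.v c < (1 : ℤᵐ⁰) := fun c => (lt_one_iff_le_exp).symm
  have hlt : ∀ c : K, w (algebraMap K Δ c) < 1 ↔ Valued.v c < (1 : ℤᵐ⁰) := by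
    intro c
    rw [hw, divValuation_algebraMap]
    exact pow_lt_one_iff hN
  rw [← hK.relIndex_eq, relIndex_eq_card_of_complement (T := T)]
  · refine Nat.card_congr (Equiv.ofBijective
      (fun y => ⟨(h.mem_range_of_comm hK he y.1.2 y.2).choose, ?_⟩) ⟨fun y z hyz => ?_, ?_⟩)
    · rw [hT, (h.mem_range_of_comm hK he y.1.2 y.2).choose_spec.2]
      exact y.1.2
    · have hyz := congrArg (algebraMap K Δ) (Subtype.ext_iff.1 hyz)
      simp only at hyz
      rw [(h.mem_range_of_comm hK he y.1.2 y.2).choose_spec.2,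
        (h.mem_range_of_comm hK he z.1.2 z.2).choose_spec.2] at hyz
      exact Subtype.ext (Subtype.ext hyz)
    · rintro ⟨c, hc⟩
      have hc' : algebraMap K Δ c * π = π * algebraMap K Δ c := Algebra.commutes _ _
      refine ⟨⟨⟨algebraMap K Δ c, hc⟩, hc'⟩, Subtype.ext ?_⟩
      exact (algebraMap K Δ).injective (h.mem_range_of_comm hK he hc hc').choose_spec.2
  · refine le_antisymm (sup_le hT1 fun c hc => ((hJ c).1 hc).le) fun c hc => ?_
    have hc : Valued.v c ≤ (1 : ℤᵐ⁰) := hc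
    obtain ⟨y, hy, hcy⟩ := h.approx (algebraMap K Δ c) (by
      rw [divValuation_algebraMap]
      exact pow_le_one' hc _)
    -- As `algebraMap K Δ c` is central, its representative `y` and the conjugate of `y` by `π` have
    -- the same residue; both lie in `κ`.
    have hcomm : y * π = π * y := by
      have h1 : w (y - π * y * π⁻¹) < 1 := by
        have e1 : y - π * y * π⁻¹ =
            π * (algebraMap K Δ c - y) * π⁻¹ - (algebraMap K Δ c - y) := by
          rw [mul_sub, sub_mul, ← Algebra.commutes, mul_inv_cancel_right₀ h.ne_zero]
          abel
        rw [e1]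
        refine (w.map_sub _ _).trans_lt (max_lt ?_ hcy)
        rw [map_mul, map_mul, map_inv₀, _root_.mul_comm (w π),
          mul_inv_cancel_right₀ ((w.ne_zero_iff).2 h.ne_zero)]
        exact hcy
      have h2 := h.eq_of_sub_lt hy (h.conj y hy) h1
      conv_lhs => rw [h2]
      rw [inv_mul_cancel_right₀ h.ne_zero]
    obtain ⟨c', -, hc'⟩ := h.mem_range_of_comm hK he hy hcomm
    refine AddSubgroup.mem_sup.2 ⟨c', by rw [hT, hc']; exact hy, c - c', ?_, by abel⟩
    rw [hJ, ← hlt, map_sub, hc']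
    exact hcy
  · rw [eq_bot_iff]
    rintro c ⟨hc, hc2⟩
    rw [AddSubgroup.mem_bot, ← map_eq_zero (algebraMap K Δ)]
    by_contra hc0
    have h1 := h.eq_one _ hc hc0
    exact ((hlt c).2 ((hJ c).1 hc2)).ne h1

/-- Conjugation by `π` is an automorphism of the finite field `κ` of order exactly `e`, by
`IsCyclicData.pow_comm` and `IsCyclicData.exists_not_comm`, and its fixed field has `q` elements.
Artin's theorem gives the degree and a basis. -/
lemma IsCyclicData.exists_coefficient_basis :
    (∃ ζ : Fin e → Δ, (∀ a, ζ a ∈ κ) ∧ ∀ y ∈ κ, ∃ c : Fin e → K,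
      (∀ i, Valued.v (c i) ≤ (1 : ℤᵐ⁰)) ∧ y = ∑ i, c i • ζ i) ∧ Nat.card κ = q ^ e := by
  have he0 : 0 < e := Nat.pos_of_ne_zero fun h0 => by
    have := Module.finrank_pos (R := K) (M := Δ)
    rw [he, h0] at this
    simp at this
  have hπ := h.ne_zero
  let _ : CommRing κ := { (inferInstance : Ring κ) with
    mul_comm := fun x y => Subtype.ext (h.mul_comm x x.2 y y.2) }
  let _ : Field κ := (Finite.isDomain_to_isField κ).toField
  let f : κ →+* κ :=
    { toFun := fun y => ⟨π * y * π⁻¹, h.conj y y.2⟩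
      map_one' := Subtype.ext (by simp [hπ])
      map_zero' := Subtype.ext (by simp)
      map_add' := fun x y => Subtype.ext (by simp [mul_add, add_mul])
      map_mul' := fun x y => Subtype.ext (by simp [mul_assoc, hπ]) }
  have hf : Function.Bijective f := Finite.injective_iff_bijective.1 fun x y hxy => by
    have hxy : π * (x : Δ) * π⁻¹ = π * y * π⁻¹ := congrArg Subtype.val hxy
    exact Subtype.ext (mul_left_cancel₀ hπ (mul_right_cancel₀ (inv_ne_zero hπ) hxy))
  let σ : RingAut κ := RingEquiv.ofBijective f hf
  have hσ : ∀ y : κ, (σ y : Δ) = π * y * π⁻¹ := fun y => rfl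
  have hσl : ∀ (l : ℕ) (y : κ), ((σ ^ l) y : Δ) = π ^ l * y * (π ^ l)⁻¹ := by
    intro l
    induction l with
    | zero => intro y; simp
    | succ l ih =>
      intro y
      rw [pow_succ', RingAut.mul_apply, hσ, ih, pow_succ', mul_inv_rev]
      simp only [mul_assoc]
  have hord : orderOf σ = e := by
    rw [orderOf_eq_iff he0]
    refine ⟨RingEquiv.ext fun y => Subtype.ext ?_, fun l hle hl h1 => ?_⟩
    · rw [hσl, h.pow_comm hK he y.2, mul_inv_cancel_right₀ (pow_ne_zero _ hπ)]
      rfl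
    · obtain ⟨y, hy, hne⟩ := h.exists_not_comm hK he hl hle
      refine hne ?_
      have := hσl l ⟨y, hy⟩
      rw [h1] at this
      have this : y = π ^ l * y * (π ^ l)⁻¹ := this
      conv_rhs => rw [this]
      rw [inv_mul_cancel_right₀ (pow_ne_zero _ hπ)]
  have hfix : ∀ y : κ, σ y = y ↔ (y : Δ) * π = π * y := by
    intro y
    rw [Subtype.ext_iff, hσ, mul_inv_eq_iff_eq_mul₀ hπ, eq_comm]
  obtain ⟨⟨ζ, hζ⟩, hcard⟩ := exists_basis_of_orderOf σ
  rw [hord] at hcard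
  refine ⟨⟨fun a => ζ (Fin.cast hord.symm a), fun a => (ζ _).2, fun y hy => ?_⟩, ?_⟩
  · obtain ⟨c, hc, hyc⟩ := hζ ⟨y, hy⟩
    choose d hd1 hd2 using fun i => h.mem_range_of_comm hK he (c i).2 ((hfix _).1 (hc i))
    refine ⟨fun a => d (Fin.cast hord.symm a), fun a => hd1 _, ?_⟩
    have := congrArg Subtype.val hyc
    rw [← Equiv.sum_comp (finCongr hord.symm)] at this
    simp only [AddSubmonoidClass.coe_finsetSum, finCongr_apply] at this
    refine this.trans (Finset.sum_congr rfl fun i _ => ?_)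
    rw [Algebra.smul_def, hd2]
    rfl
  · rw [hcard, ← h.card_comm hK he]
    congr 1
    exact Nat.card_congr (Equiv.subtypeEquivRight hfix)

/-- Count the valuation ring modulo `ϖ` twice: as a lattice of rank `m * e` it gives `q ^ (m * e)`,
and through `e` layers isomorphic to `κ` it gives `(q ^ e) ^ e`. -/
lemma IsCyclicData.finrank_eq : m = e := by
  obtain ⟨ϖ, hϖ⟩ := hK.exists_uniformizer
  have hϖ0 := ne_zero_of_valuation_eq_exp hϖ
  have hN : 0 < m * e := by rw [← he]; exact Module.finrank_pos
  set w := divValuation K Δ hK.exists_uniformizer with hw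
  have hO : scaleDown ϖ⁻¹ (ball w 1) = ball w (exp (-(m * e : ℤ))) := by
    ext x
    change w (ϖ⁻¹ • x) ≤ 1 ↔ w x ≤ _
    rw [hw, divValuation_smul hK he, map_inv₀, hϖ, ← exp_neg, ← exp_nsmul, ← hw, nsmul_eq_mul, neg_neg,
      mul_one, exp_neg, ← le_inv_mul_iff₀ exp_pos, mul_one]
    push_cast
    rfl
  have h1 := (genIndex_scaleDown_self hK (inv_ne_zero hϖ0) (Module.finBasis K Δ)
    (commensurable_ball (Δ := Δ) hK (Module.finBasis K Δ))).2
  rw [← hw, ← genIndex_inv, hO, genIndex_of_le, h.relIndex_ball,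
    (h.exists_coefficient_basis hK he).2, map_inv₀, hϖ, ← exp_neg, absValue_exp, neg_neg, zpow_one,
    Fintype.card_fin, he, inv_mul_eq_one₀] at h1
  · have hq : 1 < q := by
      have := h.card_comm hK he
      have hnt : Nontrivial {y : κ // (y : Δ) * π = π * y} :=
        ⟨⟨⟨0, by simp⟩, ⟨1, by simp⟩, fun h01 => zero_ne_one
          (congrArg (fun y => ((y : κ) : Δ)) (Subtype.ext_iff.1 h01))⟩⟩
      rw [← this]
      exact Finite.one_lt_card_iff_nontrivial.2 hnt
    rw [← pow_mul] at h1
    have h2 : q ^ (e * e) = q ^ (m * e) := by exact_mod_cast h1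
    exact (Nat.eq_of_mul_eq_mul_right (Nat.pos_of_mul_pos_left hN) (Nat.pow_right_injective hq h2)).symm
  · have hq := hK.ne_zero
    positivity
  · intro x hx
    refine show w x ≤ 1 from le_trans (show w x ≤ _ from hx) ?_
    rw [← exp_zero, exp_le_exp]
    simp only [Left.neg_nonpos_iff]
    positivity

/-- The products of a basis of `κ` over its fixed field with the powers of `π` of exponent below `e`
span the valuation ring integrally. There are `e * e` of them, which is the dimension, so they form
a basis. -/
lemma IsCyclicData.exists_basis : ∃ β : Module.Basis (Fin e × Fin e) K Δ,
    (∀ i, ∃ y ∈ κ, β i = y * π ^ (i.2 : ℕ)) ∧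
    basisLattice (Valued.v : Valuation K ℤᵐ⁰) β =
      ball (divValuation K Δ hK.exists_uniformizer) 1 := by
  obtain ⟨⟨ζ, hζ, hspan⟩, -⟩ := h.exists_coefficient_basis hK he
  let _ := Fintype.ofFinite κ
  set w := divValuation K Δ hK.exists_uniformizer with hw
  have hint : ∀ x, w x ≤ 1 → ∃ c : Fin e × Fin e → K, (∀ i, Valued.v (c i) ≤ (1 : ℤᵐ⁰)) ∧
      x = ∑ i, c i • (ζ i.1 * π ^ (i.2 : ℕ)) := by
    intro x hx
    obtain ⟨c, hc, hx⟩ := h.exists_eq_sum hK he hx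
    choose d hd1 hd2 using fun y : κ => hspan y y.2
    refine ⟨fun i => ∑ y, c (y, i.2) * d y i.1, fun i => ?_, ?_⟩
    · refine (Valued.v : Valuation K ℤᵐ⁰).map_sum_le fun y _ => ?_
      rw [map_mul]
      exact mul_le_one' (hc _) (hd1 _ _)
    · rw [hx, Fintype.sum_prod_type_right, Fintype.sum_prod_type_right]
      refine Finset.sum_congr rfl fun l _ => ?_
      simp only [Finset.sum_smul, mul_smul]
      rw [Finset.sum_comm]
      refine Finset.sum_congr rfl fun y _ => ?_
      conv_lhs => rw [hd2 y]
      rw [Finset.sum_mul, Finset.smul_sum]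
      simp only [smul_mul_assoc]
  have hmem : ∀ i : Fin e × Fin e, w (ζ i.1 * π ^ (i.2 : ℕ)) ≤ 1 := by
    intro i
    rw [map_mul, h.val_pow]
    refine mul_le_one' (h.le_one_of_mem (hζ _)) ?_
    rw [← exp_zero, exp_le_exp]
    simp only [Left.neg_nonpos_iff]
    positivity
  have htop : ⊤ ≤ Submodule.span K (Set.range fun i : Fin e × Fin e => ζ i.1 * π ^ (i.2 : ℕ)) := by
    intro x _
    obtain ⟨ϖ, hϖ⟩ := hK.exists_uniformizer
    obtain ⟨i, hi⟩ := exists_pow_smul_val_le hK h x hϖ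
    obtain ⟨c, -, hc⟩ := hint _ hi
    rw [← inv_smul_smul₀ (pow_ne_zero i (ne_zero_of_valuation_eq_exp hϖ)) x, hc]
    exact Submodule.smul_mem _ _ (sum_mem fun j _ => Submodule.smul_mem _ _
      (Submodule.subset_span ⟨j, rfl⟩))
  have hcard : Fintype.card (Fin e × Fin e) = Module.finrank K Δ := by
    rw [he, h.finrank_eq hK he, Fintype.card_prod, Fintype.card_fin]
  let β := basisOfTopLeSpanOfCardEqFinrank _ htop hcard
  have hβ : ∀ i, β i = ζ i.1 * π ^ (i.2 : ℕ) := fun i => by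
    rw [coe_basisOfTopLeSpanOfCardEqFinrank]
  refine ⟨β, fun i => ⟨_, hζ _, hβ i⟩, le_antisymm ?_ fun x hx => ?_⟩
  · refine basisLattice_le (fun c hc x hx => ?_) fun i => by rw [hβ]; exact hmem i
    change w (c • x) ≤ 1
    rw [divValuation_smul hK he]
    exact mul_le_one' (pow_le_one' hc _) hx
  · obtain ⟨c, hc, hx⟩ := hint x hx
    intro i
    change Valued.v (β.repr x i) ≤ 1
    have : x = ∑ i, c i • β i := by simp only [hβ]; exact hx
    rw [this, β.repr_sum_self]
    exact hc i

end CyclicBasis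


/-! ### Central simple algebras and base change through two-sided multiplications. -/

section Enveloping

variable (K : Type*) [Field K] (A : Type*) [Ring A] [Algebra K A]

/-- The coordinates with respect to some basis can be expressed by two-sided multiplications; this
holds for central simple algebras and is stable under base change. -/
def HasCoordinateOperators : Prop :=
  ∃ (m : ℕ) (b : Module.Basis (Fin m) K A), ∀ i, ∃ s : List (A × A), ∀ x,
    (s.map fun p => p.1 * x * p.2).sum = algebraMap K A (b.repr x i)

/-- A division algebra is a simple module over its enveloping algebra, with endomorphisms the
scalars. By Jacobson density every linear endomorphism is then a sum of two-sided multiplications.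
-/
lemma hasCoordinateOperators_of_divisionRing (D : Type*) [DivisionRing D] [Algebra K D]
    [Algebra.IsCentral K D] [FiniteDimensional K D] : HasCoordinateOperators K D := by
  let _ : Module (D ⊗[K] Dᵐᵒᵖ) D := TensorProduct.Algebra.module
  have hsm : ∀ (a : D) (c : Dᵐᵒᵖ) (x : D), (a ⊗ₜ[K] c) • x = a * x * c.unop := by
    intro a c x
    rw [TensorProduct.Algebra.smul_def, smul_eq_mul, MulOpposite.smul_eq_mul_unop, mul_assoc]
  have : IsSimpleModule (D ⊗[K] Dᵐᵒᵖ) D := by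
    rw [isSimpleModule_iff_toSpanSingleton_surjective]
    refine ⟨inferInstance, fun x hx y => ⟨(y * x⁻¹) ⊗ₜ 1, ?_⟩⟩
    rw [LinearMap.toSpanSingleton_apply, hsm]
    simp [hx]
  have hend : ∀ (g : Module.End (D ⊗[K] Dᵐᵒᵖ) D), ∃ c : K, ∀ x, g x = c • x := by
    intro g
    have h1 : ∀ x, g x = x * g 1 := by
      intro x
      have := g.map_smul (x ⊗ₜ[K] (1 : Dᵐᵒᵖ)) 1
      rw [hsm, hsm] at this
      simpa using this
    have h2 : ∀ x, g x = g 1 * x := by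
      intro x
      have := g.map_smul ((1 : D) ⊗ₜ[K] (MulOpposite.op x)) 1
      rw [hsm, hsm] at this
      simpa using this
    have hc : g 1 ∈ Subalgebra.center K D := by
      rw [Subalgebra.mem_center_iff]
      intro x
      rw [← h1, h2]
    rw [Algebra.IsCentral.center_eq_bot, Algebra.mem_bot] at hc
    obtain ⟨c, hc⟩ := hc
    refine ⟨c, fun x => ?_⟩
    rw [h2, ← hc, Algebra.smul_def]
  let b := Module.finBasis K D
  refine ⟨_, b, fun i => ?_⟩
  let F' : Module.End (Module.End (D ⊗[K] Dᵐᵒᵖ) D) D :=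
    { toFun := fun x => algebraMap K D (b.coord i x)
      map_add' := by simp
      map_smul' := by
        intro g x
        obtain ⟨c, hc⟩ := hend g
        simp only [RingHom.id_apply, Module.End.smul_def, hc]
        rw [map_smul, smul_eq_mul, map_mul, Algebra.smul_def] }
  classical
  obtain ⟨r, hr⟩ := jacobson_density F' (Finset.univ.image b)
  obtain ⟨s, hs⟩ := TensorProduct.exists_finset r
  refine ⟨s.toList.map fun p => (p.1, p.2.unop), ?_⟩
  have key : (∑ p ∈ s, (LinearMap.mulRight K p.2.unop) ∘ₗ
      (LinearMap.mulLeft K p.1)) = (Algebra.linearMap K D) ∘ₗ b.coord i := by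
    refine b.ext fun i => ?_
    have h := hr (b i) (by simp)
    rw [hs, Finset.sum_smul] at h
    simp only [hsm] at h
    simpa [F'] using h.symm
  intro x
  rw [List.map_map]
  have := LinearMap.congr_fun key x
  rw [LinearMap.sum_apply, ← Finset.sum_map_toList] at this
  exact this

variable {K A}

lemma HasCoordinateOperators.baseChange (h : HasCoordinateOperators K A) (L : Type*) [Field L]
    [Algebra K L] : HasCoordinateOperators L (L ⊗[K] A) := by
  obtain ⟨m, b, hb⟩ := h
  refine ⟨m, b.baseChange L, fun i => ?_⟩
  obtain ⟨s, hs⟩ := hb i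
  refine ⟨s.map fun p => ((1 : L) ⊗ₜ[K] p.1, (1 : L) ⊗ₜ[K] p.2), fun y => ?_⟩
  rw [List.map_map]
  induction y using TensorProduct.induction_on with
  | zero => simp [Function.comp_def]
  | tmul c d =>
    have h1 : ∀ l : List (A × A), (l.map ((fun p : (L ⊗[K] A) × (L ⊗[K] A) =>
        p.1 * c ⊗ₜ[K] d * p.2) ∘ fun p => ((1 : L) ⊗ₜ[K] p.1, (1 : L) ⊗ₜ[K] p.2))).sum =
        c ⊗ₜ[K] (l.map fun p => p.1 * d * p.2).sum := by
      intro l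
      induction l with
      | nil => simp
      | cons a l ih => simp [ih, TensorProduct.tmul_add]
    rw [h1, hs]
    simp [Algebra.algebraMap_eq_smul_one, Algebra.TensorProduct.one_def, TensorProduct.smul_tmul']
  | add x y hx hy =>
    rw [map_add, Finsupp.add_apply, map_add, ← hx, ← hy, ← List.sum_map_add]
    simp [Function.comp_def, mul_add, add_mul]

/-- A nonzero coordinate of an element of a two-sided ideal is an invertible scalar in that ideal.
-/
lemma HasCoordinateOperators.isSimpleRing [Nontrivial A] (h : HasCoordinateOperators K A) :
    IsSimpleRing A := by
  obtain ⟨m, b, hb⟩ := h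
  refine IsSimpleRing.of_eq_bot_or_eq_top fun I => or_iff_not_imp_left.2 fun hI => ?_
  obtain ⟨x, hx, hx0⟩ : ∃ x ∈ I, x ≠ 0 := by
    by_contra! hcon
    exact hI (eq_bot_iff.2 fun x hx => hcon x hx)
  obtain ⟨i, hi⟩ : ∃ i, b.repr x i ≠ 0 := by
    by_contra! hcon
    exact hx0 (b.repr.map_eq_zero_iff.1 (Finsupp.ext hcon))
  obtain ⟨s, hs⟩ := hb i
  have h1 : ∀ l : List (A × A), (l.map fun p => p.1 * x * p.2).sum ∈ I := by
    intro l
    induction l with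
    | nil => simp [I.zero_mem]
    | cons a l ih =>
      rw [List.map_cons, List.sum_cons]
      exact I.add_mem (I.mul_mem_right _ _ (I.mul_mem_left _ _ hx)) ih
  have h2 := I.mul_mem_left (algebraMap K A (b.repr x i)⁻¹) _ (h1 s)
  rw [hs, ← map_mul, inv_mul_cancel₀ hi, map_one] at h2
  exact I.one_mem_iff.1 h2

/-- A central `x` can be pulled out of the two-sided multiplications. Hence each coordinate of `x`
is `x` times the same coordinate of 1, and some coordinate of 1 is nonzero. -/
lemma HasCoordinateOperators.isCentral [Nontrivial A] (h : HasCoordinateOperators K A) :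
    Algebra.IsCentral K A := by
  obtain ⟨m, b, hb⟩ := h
  refine ⟨fun x hx => ?_⟩
  rw [Subalgebra.mem_center_iff] at hx
  obtain ⟨i, hi⟩ : ∃ i, b.repr 1 i ≠ 0 := by
    by_contra! hcon
    exact one_ne_zero (b.repr.map_eq_zero_iff.1 (Finsupp.ext hcon))
  obtain ⟨s, hs⟩ := hb i
  have h1 : ∀ l : List (A × A), (l.map fun p => p.1 * x * p.2).sum =
      x * (l.map fun p => p.1 * 1 * p.2).sum := by
    intro l
    induction l with
    | nil => simp
    | cons a l ih =>
      rw [List.map_cons, List.sum_cons, ih, List.map_cons, List.sum_cons, mul_add, mul_one, hx,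
        mul_assoc]
  have h2 := h1 s
  rw [hs, hs, ← Algebra.commutes, ← Algebra.smul_def] at h2
  rw [Algebra.mem_bot]
  refine ⟨(b.repr 1 i)⁻¹ * b.repr x i, ?_⟩
  rw [map_mul, h2, ← Algebra.smul_def, smul_smul, inv_mul_cancel₀ hi, one_smul]

lemma HasCoordinateOperators.exists_algEquiv_matrix [Nontrivial A] (h : HasCoordinateOperators K A)
    (L : Type*) [Field L] [Algebra K L] [IsAlgClosed L] :
    ∃ (m : ℕ) (_ : NeZero m), Nonempty (L ⊗[K] A ≃ₐ[L] Matrix (Fin m) (Fin m) L) := by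
  have h' := h.baseChange L
  have : FiniteDimensional K A := by
    obtain ⟨m, b, -⟩ := h
    exact b.finiteDimensional_of_finite
  have := h'.isSimpleRing
  exact IsSimpleRing.exists_algEquiv_matrix_of_isAlgClosed L _

end Enveloping

/-! ### Central functionals and their Frobenius factors. -/

section CentralFunctional

/-- In characteristic `p` the characteristic polynomial of `M ^ p` arises from that of `M` by
raising the coefficients to the `p`-th power, and the trace is up to sign one of them. -/
lemma Matrix.trace_pow_char {ι : Type*} [Fintype ι] [DecidableEq ι] {L : Type*} [Field L] (p : ℕ)
    [Fact p.Prime] [CharP L p] (M : Matrix ι ι L) : (M ^ p).trace = M.trace ^ p := by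
  cases (isEmpty_or_nonempty ι).symm
  · have h1 : Polynomial.expand L p (M ^ p).charpoly = M.charpoly ^ p := by
      unfold Matrix.charpoly
      rw [AlgHom.map_det, ← Matrix.coe_detMonoidHom,
        ← (Matrix.detMonoidHom : Matrix ι ι L[X] →* L[X]).map_pow]
      apply congr_arg Matrix.det
      refine matPolyEquiv.injective ?_
      rw [map_pow, Matrix.matPolyEquiv_charmatrix, sub_pow_char_of_commute, ← C_pow]
      · exact (id (matPolyEquiv_eq_X_pow_sub_C p M) :)
      · exact (C M).commute_X
    rw [← Polynomial.map_frobenius_expand (p := p), Polynomial.map_expand] at h1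
    have h2 := Polynomial.expand_injective (Fact.out : p.Prime).pos h1
    rw [Matrix.trace_eq_neg_charpoly_coeff, Matrix.trace_eq_neg_charpoly_coeff, h2,
      Polynomial.coeff_map, ← map_neg, frobenius_def]
  · simp [Matrix.trace, (Fact.out : p.Prime).ne_zero]

variable {K : Type*} [Field K]

/-- Off-diagonal matrix units with entries are commutators, and all diagonal positions have equal
weight; so a central functional factors through the diagonal sum. -/
lemma eq_sum_diag_of_central {B : Type*} [Ring B] [Algebra K B] {r : ℕ} [NeZero r]
    (l : Matrix (Fin r) (Fin r) B →ₗ[K] K) (hl : ∀ x y, l (x * y) = l (y * x))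
    (X : Matrix (Fin r) (Fin r) B) : l X = ∑ i, l (Matrix.single 0 0 (X i i)) := by
  have h1 : ∀ i j x, l (Matrix.single i j x) = if i = j then l (Matrix.single 0 0 x) else 0 := by
    intro i j x
    have e : Matrix.single i j x = Matrix.single i 0 x * Matrix.single (0 : Fin r) j 1 := by simp
    rw [e, hl]
    split_ifs with hij
    · subst hij
      simp
    · rw [Matrix.single_mul_single_of_ne _ _ _ _ (Ne.symm hij), map_zero]
  conv_lhs => rw [Matrix.matrix_eq_sum_single X]
  rw [map_sum]
  refine Finset.sum_congr rfl fun i _ => ?_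
  rw [map_sum, Finset.sum_eq_single i]
  · rw [h1, if_pos rfl]
  · intro j _ hj
    rw [h1, if_neg hj.symm]
  · simp

variable {A : Type*} [Ring A] [Algebra K A]

/-- Over an algebraic closure `l` is `c` times the trace, and the trace commutes with `p`-th powers,
so the factor is `c` to the power 1 - p. Evaluating at one `y` with `l y ≠ 0` shows that it lies in
`K`. The factor records the scale of `l` in every completion, without reference to a reduced trace.
-/
lemma exists_frobenius_factor [Nontrivial A] (h : HasCoordinateOperators K A) (p : ℕ)
    [Fact p.Prime] [CharP K p] (l : A →ₗ[K] K) (hl : ∀ x y, l (x * y) = l (y * x)) :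
    ∃ c : K, (l ≠ 0 → c ≠ 0) ∧ ∀ x, l (x ^ p) = c * l x ^ p := by
  by_cases h0 : l = 0
  · refine ⟨0, fun h => absurd h0 h, fun x => by simp [h0]⟩
  obtain ⟨y, hy⟩ : ∃ y, l y ≠ 0 := by
    by_contra! hcon
    exact h0 (LinearMap.ext hcon)
  let L := AlgebraicClosure K
  have : CharP L p := charP_of_injective_algebraMap (algebraMap K L).injective p
  obtain ⟨m, hm, ⟨ψ⟩⟩ := h.exists_algEquiv_matrix L
  let g : Matrix (Fin m) (Fin m) L →ₗ[L] L :=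
    (TensorProduct.AlgebraTensorModule.rid K L L).toLinearMap ∘ₗ l.baseChange L ∘ₗ
      ψ.symm.toLinearMap
  have hgψ : ∀ x : A, g (ψ (1 ⊗ₜ x)) = algebraMap K L (l x) := by
    intro x
    simp [g, Algebra.algebraMap_eq_smul_one]
  have hbc : ∀ x y : L ⊗[K] A, l.baseChange L (x * y) = l.baseChange L (y * x) := by
    intro x y
    induction x using TensorProduct.induction_on with
    | zero => simp
    | add x x' hx hx' => rw [add_mul, mul_add, map_add, map_add, hx, hx']
    | tmul a x =>
      induction y using TensorProduct.induction_on with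
      | zero => simp
      | add y y' hy hy' => rw [add_mul, mul_add, map_add, map_add, hy, hy']
      | tmul b y => simp [hl x y, mul_comm a b]
  have hg : ∀ x y, g (x * y) = g (y * x) := by
    intro x y
    simp only [g, LinearMap.comp_apply, AlgEquiv.toLinearMap_apply, map_mul]
    rw [hbc]
  have htr : ∀ X, g X = g (Matrix.single 0 0 1) * X.trace := by
    intro X
    rw [eq_sum_diag_of_central g hg, Matrix.trace, Finset.mul_sum]
    refine Finset.sum_congr rfl fun i _ => ?_
    have e : Matrix.single (0 : Fin m) (0 : Fin m) (X i i) =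
        X i i • Matrix.single (0 : Fin m) (0 : Fin m) (1 : L) := by simp
    rw [e, map_smul, smul_eq_mul, mul_comm]
    rfl
  set c := g (Matrix.single 0 0 1)
  have key : ∀ x : A, algebraMap K L (l (x ^ p)) * c ^ p = c * algebraMap K L (l x) ^ p := by
    intro x
    have e : (1 : L) ⊗ₜ[K] (x ^ p) = ((1 : L) ⊗ₜ[K] x) ^ p := by simp
    rw [← hgψ, ← hgψ, e, map_pow, htr, Matrix.trace_pow_char, htr (ψ _)]
    ring
  have hc : c ≠ 0 := by
    intro hc
    have := hgψ y
    rw [htr, hc, zero_mul] at this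
    exact hy ((map_eq_zero (algebraMap K L)).1 this.symm)
  have hyp : l (y ^ p) ≠ 0 := by
    intro hyp
    have h1 := key y
    rw [hyp, map_zero, zero_mul, eq_comm, mul_eq_zero, or_iff_right hc, ← map_pow,
      map_eq_zero] at h1
    exact pow_ne_zero p hy h1
  refine ⟨l (y ^ p) / l y ^ p, fun _ => div_ne_zero hyp (pow_ne_zero p hy), fun x => ?_⟩
  rw [div_mul_eq_mul_div, eq_div_iff (pow_ne_zero _ hy)]
  apply (algebraMap K L).injective
  apply mul_right_cancel₀ (pow_ne_zero p hc)
  have h1 := key x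
  have h2 := key y
  simp only [map_mul, map_pow]
  calc _ = (algebraMap K L (l (x ^ p)) * c ^ p) * algebraMap K L (l y) ^ p := by ring
    _ = (algebraMap K L (l (y ^ p)) * c ^ p) * algebraMap K L (l x) ^ p := by
      rw [h1, h2]; ring
    _ = _ := by ring

/-- The commutators do not span: otherwise, after splitting the algebra, every matrix would have
trace 0. -/
lemma exists_central_functional [Nontrivial A] (h : HasCoordinateOperators K A) :
    ∃ l : A →ₗ[K] K, l ≠ 0 ∧ ∀ x y, l (x * y) = l (y * x) := by
  let S := Submodule.span K (Set.range fun z : A × A => z.1 * z.2 - z.2 * z.1)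
  have hS : S < ⊤ := by
    rw [lt_top_iff_ne_top]
    intro hS
    let L := AlgebraicClosure K
    obtain ⟨m, hm, ⟨ψ⟩⟩ := h.exists_algEquiv_matrix L
    let T : A →ₗ[K] L := ((Matrix.traceLinearMap (Fin m) L L).restrictScalars K) ∘ₗ
      (ψ.toLinearMap.restrictScalars K) ∘ₗ (TensorProduct.mk K L A 1)
    have hT : ∀ x, T x = (ψ (1 ⊗ₜ x)).trace := fun x => rfl
    have hT0 : T = 0 := by
      rw [← LinearMap.ker_eq_top, ← top_le_iff, ← hS, Submodule.span_le]
      rintro _ ⟨⟨x, y⟩, rfl⟩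
      change T (x * y - y * x) = 0
      have e : ∀ x y : A, (1 : L) ⊗ₜ[K] (x * y) = ((1 : L) ⊗ₜ[K] x) * ((1 : L) ⊗ₜ[K] y) := by
        intro x y; simp
      rw [map_sub, hT, hT, e, e, map_mul, map_mul, Matrix.trace_mul_comm, sub_self]
    have hall : ∀ z : L ⊗[K] A, (ψ z).trace = 0 := by
      intro z
      induction z using TensorProduct.induction_on with
      | zero => simp
      | add x y hx hy => rw [map_add, Matrix.trace_add, hx, hy, add_zero]
      | tmul a x =>
        have e : a ⊗ₜ[K] x = a • ((1 : L) ⊗ₜ[K] x) := by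
          rw [TensorProduct.smul_tmul', smul_eq_mul, mul_one]
        rw [e, map_smul, Matrix.trace_smul, ← hT, hT0, LinearMap.zero_apply, smul_zero]
    have := hall (ψ.symm (Matrix.single 0 0 1))
    simp at this
  obtain ⟨l, hl0, hl⟩ := Submodule.exists_le_ker_of_lt_top S hS
  refine ⟨l, hl0, fun x y => ?_⟩
  rw [← sub_eq_zero, ← map_sub]
  exact hl (Submodule.subset_span ⟨(x, y), rfl⟩)

/-- A nonzero `x` in the kernel of the form would make `l` vanish on all multiples of `x`, that is
everywhere. -/
lemma gram_det_ne_zero {D : Type*} [DivisionRing D] [Algebra K D] {ι : Type*} [Fintype ι]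
    [DecidableEq ι] (b : Module.Basis ι K D) {l : D →ₗ[K] K} (hl : l ≠ 0) :
    (gram l b).det ≠ 0 := by
  intro h
  obtain ⟨c, hc, hc0⟩ := Matrix.exists_mulVec_eq_zero_iff.2
    (show (gram l b).transpose.det = 0 by rwa [Matrix.det_transpose])
  set x := b.equivFun.symm c with hx
  have hx0 : x ≠ 0 := (LinearEquiv.map_ne_zero_iff _).2 hc
  have hcx : b.equivFun x = c := b.equivFun.apply_symm_apply c
  have h1 : ∀ y, l (x * y) = 0 := by
    intro y
    rw [← b.sum_repr y, Finset.mul_sum, map_sum]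
    refine Finset.sum_eq_zero fun j _ => ?_
    rw [mul_smul_comm, map_smul, ← gram_mulVec, hcx, hc0]
    simp
  refine hl (LinearMap.ext fun y => ?_)
  have := h1 (x⁻¹ * y)
  rwa [mul_inv_cancel_left₀ hx0] at this

variable (L : Type*) [Field L] [Algebra K L]

/-- The extension of a functional to the base change. -/
def extendFunctional (l : A →ₗ[K] K) : L ⊗[K] A →ₗ[L] L :=
  (TensorProduct.AlgebraTensorModule.rid K L L).toLinearMap ∘ₗ l.baseChange L

variable {L}

lemma extendFunctional_tmul (l : A →ₗ[K] K) (a : L) (x : A) :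
    extendFunctional L l (a ⊗ₜ x) = a * algebraMap K L (l x) := by
  simp [extendFunctional, Algebra.smul_def, mul_comm]

lemma extendFunctional_mul_comm {l : A →ₗ[K] K} (hl : ∀ x y, l (x * y) = l (y * x))
    (x y : L ⊗[K] A) : extendFunctional L l (x * y) = extendFunctional L l (y * x) := by
  induction x using TensorProduct.induction_on with
  | zero => simp
  | add x x' hx hx' => rw [add_mul, mul_add, map_add, map_add, hx, hx']
  | tmul a x =>
    induction y using TensorProduct.induction_on with
    | zero => simp
    | add y y' hy hy' => rw [add_mul, mul_add, map_add, map_add, hy, hy']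
    | tmul b y => simp [extendFunctional_tmul, hl x y, mul_comm a b]

lemma gram_extendFunctional {ι : Type*} (l : A →ₗ[K] K) (b : Module.Basis ι K A) :
    gram (extendFunctional L l) (b.baseChange L) = (gram l b).map (algebraMap K L) := by
  ext i j
  simp [gram, extendFunctional_tmul]

end CentralFunctional


/-! ### The dual of the valuation ring under a central functional. -/

section DualOrder

open WithZero
open scoped WithZero Valued

lemma exists_mul_eq_of_mem {R : Type*} [DivisionRing R] {κ : Subring R} [Finite κ] {z y : R}
    (hz : z ∈ κ) (hz0 : z ≠ 0) (hy : y ∈ κ) : ∃ x ∈ κ, z * x = y := by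
  have hinj : Function.Injective (fun x : κ => (⟨z, hz⟩ : κ) * x) := fun a b hab =>
    Subtype.ext (mul_left_cancel₀ hz0 (congrArg Subtype.val hab))
  obtain ⟨x, hx⟩ := Finite.injective_iff_surjective.1 hinj ⟨y, hy⟩
  exact ⟨x, x.2, congrArg Subtype.val hx⟩

variable {K : Type*} [Field K] [Valued K ℤᵐ⁰] [CompactSpace 𝒪[K]] {q : ℕ}
variable {Δ : Type*} [DivisionRing Δ] [Algebra K Δ] [FiniteDimensional K Δ]
variable (hK : IsDiscreteWithCard (Valued.v : Valuation K ℤᵐ⁰) q) {κ : Subring Δ} {π : Δ} {m : ℕ}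
variable (h : IsCyclicData (divValuation K Δ hK.exists_uniformizer) κ π m)
variable {e : ℕ} (he : Module.finrank K Δ = m * e) [Finite κ] [Algebra.IsCentral K Δ]
variable {l : Δ →ₗ[K] K} (hl : ∀ x y, l (x * y) = l (y * x))

include h he hl

/-- Choose `z` in `κ` not commuting with `π ^ i`, and let `z'` be its conjugate. The commutator of
`x * π ^ i` with `z` is `(z' - z) * x * π ^ i`, and `(z' - z) * x` runs through all of the field
`κ`. -/
lemma IsCyclicData.functional_mul_pow {y : Δ} (hy : y ∈ κ) {i : ℕ} (hi : 0 < i) (hie : i < e) :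
    l (y * π ^ i) = 0 := by
  obtain ⟨z, hz, hne⟩ := h.exists_not_comm hK he hi hie
  have hπ := pow_ne_zero i h.ne_zero
  set z' := π ^ i * z * (π ^ i)⁻¹ with hz'
  have hz'κ : z' ∈ κ := h.conj_pow i hz
  have hzz' : z' * π ^ i = π ^ i * z := inv_mul_cancel_right₀ hπ _
  have hd : z' - z ≠ 0 := by
    intro h0
    rw [sub_eq_zero] at h0
    rw [h0] at hzz'
    exact hne hzz'.symm
  obtain ⟨x, hx, hxy⟩ := exists_mul_eq_of_mem (sub_mem hz'κ hz) hd hy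
  have h1 : l (x * π ^ i * z) = l (z * (x * π ^ i)) := hl _ _
  have e1 : x * π ^ i * z = z' * x * π ^ i := by
    rw [mul_assoc, ← hzz', h.mul_comm z' hz'κ x hx]
    exact (mul_assoc x z' _).symm
  rw [e1, ← mul_assoc] at h1
  rw [← hxy, sub_mul, sub_mul, map_sub, h1, sub_self]

/-- Expand `x` in terms `y * π ^ j` with `1 ≤ j ≤ e`. The functional kills those with `j < e`, and
`π ^ e` is a uniformizer of `K`, which lowers the value by one step. -/
lemma IsCyclicData.functional_le_of_lt_one {i : ℤ}
    (hi : ∀ y ∈ κ, Valued.v (l y) ≤ (exp i : ℤᵐ⁰)) {x : Δ}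
    (hx : divValuation K Δ hK.exists_uniformizer x < 1) :
    Valued.v (l x) ≤ (exp (i - 1) : ℤᵐ⁰) := by
  let _ := Fintype.ofFinite κ
  obtain ⟨ϖ, hϖ, hπϖ⟩ := h.exists_pow_eq hK he
  obtain ⟨c, hc, hxc⟩ := h.exists_eq_sum hK he
    (h.val_mul_inv_le 1 (by simpa using h.val_le_of_lt_one hx))
  rw [pow_one, mul_inv_eq_iff_eq_mul₀ h.ne_zero, Finset.sum_mul] at hxc
  rw [hxc, map_sum]
  refine (Valued.v : Valuation K ℤᵐ⁰).map_sum_le fun j _ => ?_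
  rw [smul_mul_assoc, map_smul, smul_eq_mul, map_mul]
  refine (mul_le_of_le_one_left' (hc j)).trans ?_
  rw [mul_assoc, ← pow_succ]
  rcases lt_or_eq_of_le (show (j.2 : ℕ) + 1 ≤ e from j.2.2) with h0 | h0
  · rw [h.functional_mul_pow hK he hl j.1.2 (Nat.succ_pos _) h0, map_zero]
    exact zero_le
  · rw [h0, hπϖ, ← Algebra.commutes, ← Algebra.smul_def, map_smul, smul_eq_mul, map_mul, hϖ,
      sub_eq_add_neg, exp_add, _root_.mul_comm]
    exact mul_le_mul_left (hi _ j.1.2) _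

/-- On basis products with a positive power of `π` the functional vanishes, so it is determined by
its restriction to `κ`, which therefore is nonzero. -/
lemma IsCyclicData.exists_functional_max (h0 : l ≠ 0) :
    ∃ i : ℤ, (∀ y ∈ κ, Valued.v (l y) ≤ (exp i : ℤᵐ⁰)) ∧
      ∃ y ∈ κ, Valued.v (l y) = (exp i : ℤᵐ⁰) := by
  have : Nonempty κ := ⟨0⟩
  obtain ⟨y, hy⟩ := Finite.exists_max fun y : κ => (Valued.v (l y) : ℤᵐ⁰)
  have hy0 : (Valued.v (l y) : ℤᵐ⁰) ≠ 0 := by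
    intro hy0
    have hκ : ∀ z ∈ κ, l z = 0 := fun z hz => by
      have := hy ⟨z, hz⟩
      rw [hy0, le_zero_iff, Valuation.zero_iff] at this
      exact this
    refine h0 (LinearMap.ext fun x => ?_)
    obtain ⟨ϖ, hϖ⟩ := hK.exists_uniformizer
    have hϖ0 := ne_zero_of_valuation_eq_exp hϖ
    obtain ⟨j, hj⟩ := exists_pow_smul_val_le hK h x hϖ
    let _ := Fintype.ofFinite κ
    obtain ⟨c, -, hc⟩ := h.exists_eq_sum hK he hj
    have h1 : l (ϖ ^ j • x) = 0 := by
      rw [hc, map_sum]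
      refine Finset.sum_eq_zero fun a _ => ?_
      rw [map_smul]
      rcases Nat.eq_zero_or_pos (a.2 : ℕ) with h0 | h0
      · rw [h0, pow_zero, mul_one, hκ _ a.1.2, smul_zero]
      · rw [h.functional_mul_pow hK he hl a.1.2 h0 a.2.2, smul_zero]
    rw [map_smul, smul_eq_zero] at h1
    exact h1.resolve_left (pow_ne_zero _ hϖ0)
  obtain ⟨i, hi⟩ := eq_exp_of_ne_zero hy0
  exact ⟨i, fun z hz => (hy ⟨z, hz⟩).trans hi.le, y, y.2, hi⟩

omit [Algebra.IsCentral K Δ] he hl in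
-- The finite field `κ` is perfect, so `p`-th powers attain the maximal value `exp i` too. Hence
-- `exp i` is the value of `γ` times `exp i ^ p`.
lemma IsCyclicData.val_frobenius_factor {i : ℤ} (hi : ∀ y ∈ κ, Valued.v (l y) ≤ (exp i : ℤᵐ⁰))
    (hi' : ∃ y ∈ κ, Valued.v (l y) = (exp i : ℤᵐ⁰)) (p : ℕ) [Fact p.Prime] [CharP Δ p] {γ : K}
    (hγ : ∀ x, l (x ^ p) = γ * l x ^ p) : Valued.v γ = (exp ((1 - p) * i) : ℤᵐ⁰) := by
  have hsurj : ∀ y ∈ κ, ∃ z ∈ κ, z ^ p = y := by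
    have hinj : Function.Injective (fun y : κ => y ^ p) := fun a b hab => by
      have hab : (a : Δ) ^ p = (b : Δ) ^ p := congrArg Subtype.val hab
      have h1 := sub_pow_char_of_commute (p := p) (h.mul_comm _ a.2 _ b.2)
      rw [hab, sub_self] at h1
      exact Subtype.ext (sub_eq_zero.1 (pow_eq_zero_iff (Fact.out : p.Prime).ne_zero |>.1 h1))
    intro y hy
    obtain ⟨z, hz⟩ := Finite.injective_iff_surjective.1 hinj ⟨y, hy⟩
    exact ⟨z, z.2, congrArg Subtype.val hz⟩
  obtain ⟨y, hy, hyi⟩ := hi'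
  obtain ⟨z, hz, rfl⟩ := hsurj y hy
  have h1 := hi _ (pow_mem hy p)
  rw [hγ, map_mul, map_pow, hyi] at h1
  rw [hγ, map_mul, map_pow] at hyi
  have h2 : (exp i : ℤᵐ⁰) ≤ Valued.v γ * exp i ^ p := by
    exact hyi.symm.le.trans (mul_le_mul_right (pow_le_pow_left₀ zero_le (hi z hz) p) _)
  have h3 := le_antisymm h1 h2
  rw [← exp_nsmul] at h3
  have h4 : (Valued.v γ : ℤᵐ⁰) = exp i * (exp (p • i))⁻¹ := by
    rw [← h3, mul_inv_cancel_right₀ exp_ne_zero]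
  rw [h4, ← exp_neg, ← exp_add, exp_inj, nsmul_eq_mul]
  ring

/-- On the radical `l` is smaller by one step than on `κ`, which gives one inclusion. Conversely, if
`c • x` has value at least 1, the integral element `(c • x)⁻¹ * y`, with `y` of maximal `l`-value,
violates duality. Thus the dual is a scalar multiple of the radical, as for a different of exponent
e - 1. -/
lemma IsCyclicData.mem_dualLattice_ball_iff {i : ℤ}
    (hi : ∀ y ∈ κ, Valued.v (l y) ≤ (exp i : ℤᵐ⁰))
    (hi' : ∃ y ∈ κ, Valued.v (l y) = (exp i : ℤᵐ⁰)) {c : K} (hc : Valued.v c = (exp (i - 1) : ℤᵐ⁰))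
    (x : Δ) : x ∈ dualLattice (Valued.v : Valuation K ℤᵐ⁰) l
        (ball (divValuation K Δ hK.exists_uniformizer) 1) ↔
      divValuation K Δ hK.exists_uniformizer (c • x) < 1 := by
  set w := divValuation K Δ hK.exists_uniformizer with hw
  have hc0 : c ≠ 0 := ne_zero_of_valuation_eq_exp hc
  constructor
  · intro hx
    by_contra hcon
    rw [not_lt] at hcon
    obtain ⟨y, hy, hyi⟩ := hi'
    have hx0 : c • x ≠ 0 := by
      intro h0
      rw [h0, map_zero] at hcon
      exact absurd hcon (by simp)
    have h1 := hx ((c • x)⁻¹ * y) (by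
      change w _ ≤ 1
      rw [map_mul, map_inv₀]
      exact mul_le_one' (inv_le_one_of_one_le₀ hcon) (h.le_one_of_mem hy))
    have e1 : x * ((c • x)⁻¹ * y) = c⁻¹ • y := by
      conv_lhs => rw [← inv_smul_smul₀ hc0 x]
      rw [smul_mul_assoc, smul_smul, mul_inv_cancel₀ hc0, one_smul, mul_inv_cancel_left₀ hx0]
    rw [e1, map_smul, smul_eq_mul, map_mul, map_inv₀, hc, hyi, ← exp_neg, ← exp_add, ← exp_zero,
      exp_le_exp] at h1
    linarith
  · intro hx y hy
    have hxy : w (c • (x * y)) < 1 := by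
      rw [← smul_mul_assoc, map_mul]
      exact mul_lt_one_of_nonneg_of_lt_one_left zero_le hx hy
    have h1 := h.functional_le_of_lt_one hK he hl hi hxy
    rw [map_smul, smul_eq_mul, map_mul, hc] at h1
    exact le_of_mul_le_mul_left (by rwa [mul_one]) exp_pos

end DualOrder

/-! ### Matrices with entries in a lattice. -/

section MatrixLattice

open WithZero
open scoped WithZero

lemma relIndex_matrix {G : Type*} [AddCommGroup G] (r : ℕ) {J O : AddSubgroup G} (hJ : J ≤ O) :
    (J.matrix : AddSubgroup (Matrix (Fin r) (Fin r) G)).relIndex O.matrix =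
      J.relIndex O ^ r ^ 2 := by
  let f : (Fin r × Fin r → O) →+ Matrix (Fin r) (Fin r) G :=
    { toFun := fun x => Matrix.of fun i j => (x (i, j) : G)
      map_zero' := rfl
      map_add' := fun _ _ => rfl }
  have hf : Function.Injective f := fun x y hxy => funext fun i =>
    Subtype.ext (congrFun (congrFun hxy i.1) i.2)
  have h1 : (⊤ : AddSubgroup (Fin r × Fin r → O)).map f = O.matrix := by
    ext X
    constructor
    · rintro ⟨x, -, rfl⟩ i j
      exact (x (i, j)).2
    · intro hX
      exact ⟨fun i => ⟨X i.1 i.2, hX _ _⟩, trivial, rfl⟩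
  have h2 : (AddSubgroup.pi Set.univ fun _ : Fin r × Fin r => J.addSubgroupOf O).map f =
      J.matrix := by
    ext X
    constructor
    · rintro ⟨x, hx, rfl⟩ i j
      exact hx (i, j) trivial
    · intro hX
      exact ⟨fun i => ⟨X i.1 i.2, hJ (hX _ _)⟩, fun i _ => hX _ _, rfl⟩
  rw [← h1, ← h2, AddSubgroup.relIndex_map_map_of_injective _ _ hf, AddSubgroup.relIndex_top_right,
    AddSubgroup.index_pi, Finset.prod_const, Finset.card_univ, Fintype.card_prod, Fintype.card_fin,
    sq]
  rfl

variable {K : Type*} [Field K] {v : Valuation K ℤᵐ⁰} {A : Type*} [Ring A] [Algebra K A]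

lemma basisLattice_matrix {ι : Type*} [Fintype ι] (r : ℕ) (b : Module.Basis ι K A) :
    basisLattice v (b.matrix (Fin r) (Fin r)) = (basisLattice v b).matrix := by
  ext X
  constructor
  · intro hX i j k
    exact hX (i, j, k)
  · intro hX i
    exact hX i.1 i.2.1 i.2.2

lemma dualLattice_matrix {r : ℕ} {l : Matrix (Fin r) (Fin r) A →ₗ[K] K} {l' : A →ₗ[K] K}
    (hl : ∀ X, l X = ∑ i, l' (X i i)) (U : AddSubgroup A) :
    dualLattice v l (U.matrix : AddSubgroup (Matrix (Fin r) (Fin r) A)) =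
      (dualLattice v l' U).matrix := by
  classical
  ext X
  constructor
  · intro hX i j y hy
    have h1 := hX (Matrix.single j i y) (fun a b => by
      rw [Matrix.single_apply]
      split_ifs
      · exact hy
      · exact zero_mem _)
    rw [hl, Finset.sum_eq_single i] at h1
    · simpa using h1
    · intro a _ ha
      rw [Matrix.mul_single_apply_of_ne _ _ _ _ _ ha, map_zero]
    · simp
  · intro hX Y hY
    rw [hl]
    refine v.map_sum_le fun i _ => ?_
    rw [Matrix.mul_apply, map_sum]
    exact v.map_sum_le fun j _ => hX i j _ (hY j i)

lemma scaleDown_matrix {r : ℕ} (c : K) (U : AddSubgroup A) :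
    scaleDown c (U.matrix : AddSubgroup (Matrix (Fin r) (Fin r) A)) = (scaleDown c U).matrix := rfl

end MatrixLattice


/-! ### Reduced norms and algebra norms. -/

section NormPower

variable {K : Type*} [Field K]

/-- Left multiplication by `M` on matrices is the Kronecker product of `M` with the identity. -/
lemma norm_matrix {m : ℕ} (M : Matrix (Fin m) (Fin m) K) : Algebra.norm K M = M.det ^ m := by
  have hrepr : ∀ (X : Matrix (Fin m) (Fin m) K) (z : Fin m × Fin m),
      (Matrix.stdBasis K (Fin m) (Fin m)).repr X z = X z.1 z.2 := fun X z => rfl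
  have h1 : Algebra.leftMulMatrix (Matrix.stdBasis K (Fin m) (Fin m)) M =
      Matrix.kroneckerMap (· * ·) M (1 : Matrix (Fin m) (Fin m) K) := by
    ext ⟨a, b⟩ ⟨i, j⟩
    rw [Algebra.leftMulMatrix_eq_repr_mul, hrepr, Matrix.stdBasis_eq_single,
      Matrix.kroneckerMap_apply, Matrix.one_apply]
    split_ifs with hbj
    · subst hbj
      simp
    · simp [Matrix.mul_single_apply_of_ne, hbj]
  rw [Algebra.norm_eq_matrix_det (Matrix.stdBasis K (Fin m) (Fin m)), h1, Matrix.det_kronecker]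
  simp

variable {A : Type*} [Ring A] [Algebra K A] [FiniteDimensional K A]

lemma IsReducedNorm.pow_eq_norm {a : A} {c : K} (h : IsReducedNorm K a c) :
    ∃ m : ℕ, m ^ 2 = Module.finrank K A ∧ c ^ m = Algebra.norm K a := by
  obtain ⟨m, ψ, hψ⟩ := h
  refine ⟨m, ?_, (algebraMap K (AlgebraicClosure K)).injective ?_⟩
  · have := ψ.toLinearEquiv.finrank_eq
    rw [Module.finrank_baseChange, Module.finrank_matrix] at this
    simpa [sq] using this.symm
  · rw [map_pow, hψ, ← norm_matrix]
    let b := Module.finBasis K A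
    have h2 : Algebra.norm (AlgebraicClosure K) ((1 : AlgebraicClosure K) ⊗ₜ[K] a) =
        algebraMap K (AlgebraicClosure K) (Algebra.norm K a) := by
      rw [Algebra.norm_eq_matrix_det b, Algebra.norm_eq_matrix_det (b.baseChange _),
        RingHom.map_det]
      congr 1
      ext i j
      simp [Algebra.leftMulMatrix_eq_repr_mul, Algebra.smul_def]
    rw [← h2, Algebra.norm_eq_of_algEquiv]

omit [FiniteDimensional K A] in
lemma IsReducedNorm.of_algEquiv {B : Type*} [Ring B] [Algebra K B] (e : A ≃ₐ[K] B) {a : A} {c : K}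
    (h : IsReducedNorm K (e a) c) : IsReducedNorm K a c := by
  obtain ⟨m, ψ, hψ⟩ := h
  exact ⟨m, (Algebra.TensorProduct.congr AlgEquiv.refl e).trans ψ, by simpa using hψ⟩

end NormPower

/-! ### Splitting a cyclic algebra. -/

section Splitting

variable {K : Type*} [Field K] {Δ : Type*} [DivisionRing Δ] [Algebra K Δ] [FiniteDimensional K Δ]
  [Algebra.IsCentral K Δ]

/-- `Δ` is a left `L`-space with basis the powers of `π`, and right multiplication by `x` gives a
matrix `M x` over `L`, with `M` multiplicative for row vectors. Extended to an algebraic closure,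
`M` is injective by simplicity and bijective by dimension. Its determinant on `x` commutes with `π`,
hence lies in `K`. -/
lemma exists_isReducedNorm_of_cyclic {L : Type*} [Field L] [Algebra K L] [FiniteDimensional K L]
    (f : L →ₐ[K] Δ) {π : Δ} (hπ : π ≠ 0) {e : ℕ} (hN : Module.finrank K Δ = e * e)
    (hL : Module.finrank K L ≤ e)
    (hspan : ∀ x, ∃ c : Fin e → L, x = ∑ i, f (c i) * π ^ (i : ℕ))
    (hconj : ∀ y, ∃ z, f z = π * f y * π⁻¹)
    (hcent : ∀ y, f y * π = π * f y → ∃ c, algebraMap K Δ c = f y) (x : Δ) :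
    ∃ c, IsReducedNorm K x c := by
  have he : 0 < e := Nat.pos_of_ne_zero fun h0 => by
    have := Module.finrank_pos (R := K) (M := Δ)
    rw [hN, h0] at this
    simp at this
  have : Nonempty (Fin e) := ⟨⟨0, he⟩⟩
  obtain ⟨M, hM, huniq⟩ : ∃ M : Δ → Matrix (Fin e) (Fin e) L,
      (∀ x (i : Fin e), ∑ j, f (M x i j) * π ^ (j : ℕ) = π ^ (i : ℕ) * x) ∧
      ∀ c d : Fin e → L, ∑ j, f (c j) * π ^ (j : ℕ) = ∑ j, f (d j) * π ^ (j : ℕ) → c = d := by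
    let _ : Module L Δ := Module.compHom Δ (f : L →+* Δ)
    have hsmul : ∀ (c : L) (x : Δ), c • x = f c * x := fun _ _ => rfl
    have : IsScalarTower K L Δ := ⟨fun k c x => by
      rw [hsmul, hsmul, map_smul, smul_mul_assoc]⟩
    have : Module.Finite L Δ := Module.Finite.of_restrictScalars_finite K L Δ
    have htop : ⊤ ≤ Submodule.span L (Set.range fun i : Fin e => π ^ (i : ℕ)) := by
      intro x _
      obtain ⟨c, rfl⟩ := hspan x
      exact sum_mem fun i _ => Submodule.smul_mem _ (c i) (Submodule.subset_span ⟨i, rfl⟩)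
    -- Both `[L : K]` and `[Δ : L]` are at most `e` and their product is `e * e`.
    have hcard : Fintype.card (Fin e) = Module.finrank L Δ := by
      have h1 : Module.finrank L Δ ≤ e := by
        have := finrank_range_le_card (R := L) fun i : Fin e => π ^ (i : ℕ)
        rw [Set.finrank, top_le_iff.1 htop, finrank_top, Fintype.card_fin] at this
        exact this
      have h2 := Module.finrank_mul_finrank K L Δ
      rw [hN] at h2
      rw [Fintype.card_fin]
      refine le_antisymm ?_ h1
      by_contra hcon
      have := Nat.mul_le_mul_right (Module.finrank L Δ) hL
      have := Nat.mul_lt_mul_of_pos_left (not_le.1 hcon) he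
      omega
    let β := basisOfTopLeSpanOfCardEqFinrank _ htop hcard
    have hβ : ∀ i, β i = π ^ (i : ℕ) := fun i => by
      rw [coe_basisOfTopLeSpanOfCardEqFinrank]
    have hsum : ∀ c : Fin e → L, ∑ j, f (c j) * π ^ (j : ℕ) = β.equivFun.symm c := by
      intro c
      rw [β.equivFun_symm_apply]
      simp only [hβ, hsmul]
    refine ⟨fun x => Matrix.of fun i => β.equivFun (π ^ (i : ℕ) * x), fun x i => ?_,
      fun c d hcd => ?_⟩
    · exact (hsum _).trans (β.equivFun.symm_apply_apply _)
    · rw [hsum, hsum] at hcd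
      exact β.equivFun.symm.injective hcd
  have hMeq : ∀ (x : Δ) (N : Matrix (Fin e) (Fin e) L),
      (∀ i : Fin e, ∑ j, f (N i j) * π ^ (j : ℕ) = π ^ (i : ℕ) * x) → M x = N := by
    intro x N hNx
    ext i j
    exact congrFun (huniq (M x i) (N i) ((hM x i).trans (hNx i).symm)) j
  have hmul : ∀ (x : Δ) (N : Matrix (Fin e) (Fin e) L) (i : Fin e),
      ∑ k, f ((N * M x) i k) * π ^ (k : ℕ) = (∑ j, f (N i j) * π ^ (j : ℕ)) * x := by
    intro x N i
    simp only [Matrix.mul_apply, map_sum, map_mul, Finset.sum_mul]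
    rw [Finset.sum_comm]
    refine Finset.sum_congr rfl fun j _ => ?_
    rw [mul_assoc, ← hM x j, Finset.mul_sum]
    simp only [mul_assoc]
  let Mh : Δ →ₐ[K] Matrix (Fin e) (Fin e) L :=
    { toFun := M
      map_one' := hMeq _ _ fun i => by
        rw [Finset.sum_eq_single i]
        · simp
        · intro j _ hj
          rw [Matrix.one_apply_ne hj.symm, map_zero, zero_mul]
        · simp
      map_mul' := fun x y => hMeq _ _ fun i => by rw [hmul, hM, mul_assoc]
      map_zero' := hMeq _ _ fun i => by simp
      map_add' := fun x y => hMeq _ _ fun i => by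
        simp [add_mul, Finset.sum_add_distrib, hM, mul_add]
      commutes' := fun c => hMeq _ _ fun i => by
        rw [Finset.sum_eq_single i]
        · rw [Matrix.algebraMap_matrix_apply, if_pos rfl, AlgHom.commutes, Algebra.commutes]
        · intro j _ hj
          rw [Matrix.algebraMap_matrix_apply, if_neg hj.symm, map_zero, zero_mul]
        · simp }
  have hfinj : Function.Injective f := (f : L →+* Δ).injective
  choose t ht using hconj
  let τ : L →+* L :=
    { toFun := t
      map_one' := hfinj (by simp [ht, hπ])
      map_zero' := hfinj (by simp [ht])
      map_add' := fun x y => hfinj (by simp [ht, mul_add, add_mul])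
      map_mul' := fun x y => hfinj (by simp [ht, mul_assoc, hπ]) }
  have hτ : ∀ y, f (τ y) = π * f y * π⁻¹ := ht
  have hdet : ∀ x, ∃ c, algebraMap K L c = (Mh x).det := by
    intro x
    -- Passing `π` across the coefficients applies `τ`, so the determinant of `Mh x` is fixed by
    -- `τ`.
    have h1 : Mh π * Mh x = (Mh x).map τ * Mh π := by
      rw [← map_mul]
      refine hMeq _ _ fun i => ?_
      refine (hmul π _ i).trans ?_
      have h2 : ∀ j : Fin e, f (((Mh x).map τ) i j) * π ^ (j : ℕ) =
          π * (f (M x i j) * π ^ (j : ℕ)) * π⁻¹ := by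
        intro j
        rw [Matrix.map_apply, hτ, mul_assoc, mul_assoc, mul_assoc, mul_assoc]
        congr 2
        rw [inv_mul_eq_iff_eq_mul₀ hπ, ← mul_assoc, ← pow_succ', pow_succ,
          mul_inv_cancel_right₀ hπ]
      simp only [h2]
      rw [← Finset.sum_mul, ← Finset.mul_sum, hM, inv_mul_cancel_right₀ hπ, ← mul_assoc,
        ← mul_assoc, ← pow_succ', ← pow_succ]
    have hu : (Mh π).det ≠ 0 := by
      have h2 : Mh π * Mh π⁻¹ = 1 := by rw [← map_mul, mul_inv_cancel₀ hπ, map_one]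
      have h3 := congrArg Matrix.det h2
      rw [Matrix.det_mul, Matrix.det_one] at h3
      exact left_ne_zero_of_mul_eq_one h3
    have h4 := congrArg Matrix.det h1
    rw [Matrix.det_mul, Matrix.det_mul, mul_comm] at h4
    have h5 := mul_right_cancel₀ hu h4
    have h6 : τ (Mh x).det = (Mh x).det := by
      rw [RingHom.map_det]
      exact h5.symm
    have h7 := hτ (Mh x).det
    rw [h6, eq_mul_inv_iff_mul_eq₀ hπ] at h7
    obtain ⟨c, hc⟩ := hcent _ h7
    exact ⟨c, hfinj (by rw [AlgHom.commutes, hc])⟩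
  let F := AlgebraicClosure K
  let g : L →ₐ[K] F := IsAlgClosed.lift
  let ψ₀ : F ⊗[K] Δ →ₐ[F] Matrix (Fin e) (Fin e) F :=
    Algebra.TensorProduct.lift (Algebra.ofId F _) (g.mapMatrix.comp Mh)
      fun a b => Algebra.commutes a _
  have : IsSimpleRing (F ⊗[K] Δ) :=
    ((hasCoordinateOperators_of_divisionRing K Δ).baseChange F).isSimpleRing
  have hinj : Function.Injective ψ₀ := (ψ₀ : F ⊗[K] Δ →+* Matrix (Fin e) (Fin e) F).injective
  have hbij : Function.Bijective ψ₀ := by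
    refine ⟨hinj, ?_⟩
    refine (LinearMap.injective_iff_surjective_of_finrank_eq_finrank (f := ψ₀.toLinearMap) ?_).1 hinj
    rw [Module.finrank_baseChange, Module.finrank_matrix, hN]
    simp
  obtain ⟨c, hc⟩ := hdet x
  refine ⟨c, e, AlgEquiv.ofBijective ψ₀ hbij, ?_⟩
  have h8 : ψ₀ (1 ⊗ₜ[K] x) = g.mapMatrix (Mh x) := by
    exact (Algebra.TensorProduct.lift_tmul _ _ _ _ _).trans (by rw [map_one, one_mul]; rfl)
  rw [AlgEquiv.coe_ofBijective, h8, ← AlgHom.map_det, ← hc, AlgHom.commutes]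

end Splitting

/-! ### The reduced norm of a local division algebra. -/

section CyclicReducedNorm

open WithZero
open scoped WithZero Valued

variable {K : Type*} [Field K] [Valued K ℤᵐ⁰] [CompactSpace 𝒪[K]] {q : ℕ}
variable {Δ : Type*} [DivisionRing Δ] [Algebra K Δ] [FiniteDimensional K Δ]
variable (hK : IsDiscreteWithCard (Valued.v : Valuation K ℤᵐ⁰) q) {κ : Subring Δ} {π : Δ} {m : ℕ}
variable (h : IsCyclicData (divValuation K Δ hK.exists_uniformizer) κ π m)
variable {e : ℕ} (he : Module.finrank K Δ = m * e) [Finite κ] [Algebra.IsCentral K Δ]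

include h he

/-- The splitting field is the commutative subalgebra generated over `K` by `κ`, which is normalized
by `π` and has dimension at most `e`. -/
lemma IsCyclicData.exists_isReducedNorm (x : Δ) : ∃ c, IsReducedNorm K x c := by
  have hme := h.finrank_eq hK he
  obtain ⟨⟨ζ, hζ, hζs⟩, -⟩ := h.exists_coefficient_basis hK he
  let L := Algebra.adjoin K (κ : Set Δ)
  have hLspan : Subalgebra.toSubmodule L = Submodule.span K (κ : Set Δ) := by
    rw [Algebra.adjoin_eq_span]
    congr 1
    exact congrArg _ (Submonoid.closure_eq κ.toSubmonoid)
  have hLcomm := Algebra.isMulCommutative_adjoin K h.mul_comm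
  let _ : CommRing L := { (inferInstance : Ring L) with
    mul_comm := fun x y => hLcomm.is_comm.comm x y }
  let _ : Field L := fieldOfFiniteDimensional K L
  have hLfin : Module.finrank K L ≤ e := by
    have h1 : Subalgebra.toSubmodule L ≤ Submodule.span K (Set.range ζ) := by
      rw [hLspan, Submodule.span_le]
      intro y hy
      obtain ⟨c, -, rfl⟩ := hζs y hy
      exact sum_mem fun i _ => Submodule.smul_mem _ _ (Submodule.subset_span ⟨i, rfl⟩)
    have h2 := (Submodule.finrank_mono h1).trans (finrank_range_le_card (R := K) ζ)
    rwa [Fintype.card_fin] at h2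
  refine exists_isReducedNorm_of_cyclic (L := L) L.val h.ne_zero (by rw [he, hme]) hLfin ?_ ?_ ?_ x
  · intro x
    obtain ⟨ϖ, hϖ⟩ := hK.exists_uniformizer
    obtain ⟨i, hi⟩ := exists_pow_smul_val_le hK h x hϖ
    let _ := Fintype.ofFinite κ
    obtain ⟨c, -, hc⟩ := h.exists_eq_sum hK he hi
    refine ⟨fun l => ⟨∑ y, ((ϖ ^ i)⁻¹ * c (y, l)) • (y : Δ), sum_mem fun y _ =>
      Subalgebra.smul_mem _ (Algebra.subset_adjoin y.2) _⟩, ?_⟩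
    rw [← inv_smul_smul₀ (pow_ne_zero i (ne_zero_of_valuation_eq_exp hϖ)) x, hc,
      Fintype.sum_prod_type_right, Finset.smul_sum]
    refine Finset.sum_congr rfl fun l _ => ?_
    simp only [Subalgebra.coe_val, Finset.sum_mul, Finset.smul_sum, mul_smul, smul_mul_assoc]
  · rintro ⟨y, hy⟩
    have h1 : π * y * π⁻¹ ∈ L := by
      have hy' : y ∈ Subalgebra.toSubmodule L := hy
      rw [hLspan] at hy'
      clear hy
      induction hy' using Submodule.span_induction with
      | mem y hy => exact Algebra.subset_adjoin (h.conj y hy)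
      | zero => simp
      | add a b _ _ ha hb => simpa [mul_add, add_mul] using add_mem ha hb
      | smul c a _ ha => simpa using L.smul_mem ha c
    exact ⟨⟨_, h1⟩, rfl⟩
  · intro y hy
    refine h.mem_range_algebraMap hK he (fun z hz => ?_) hy
    exact congrArg Subtype.val (_root_.mul_comm y ⟨z, Algebra.subset_adjoin hz⟩)

/-- Existence excludes the default value 0 in `reducedNorm`. Whatever splitting was chosen, a
positive power of the reduced norm is the algebra norm. -/
lemma IsCyclicData.reducedNorm_lt_one_iff (x : Δ) :
    Valued.v (reducedNorm K x) < (1 : ℤᵐ⁰) ↔ divValuation K Δ hK.exists_uniformizer x < 1 := by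
  have hex := h.exists_isReducedNorm hK he x
  have h1 : IsReducedNorm K x (reducedNorm K x) := by
    rw [reducedNorm, dif_pos hex]
    exact hex.choose_spec
  obtain ⟨i, hi, hpow⟩ := h1.pow_eq_norm
  have hi0 : i ≠ 0 := by
    rintro rfl
    exact Module.finrank_pos.ne' (hi.symm.trans (by simp))
  rw [divValuation_apply, ← hpow, map_pow, pow_lt_one_iff hi0]

end CyclicReducedNorm


/-! ### Maximal orders of local central simple algebras. -/

section LocalOrder

open WithZero
open scoped WithZero Valued

/-- `O` is a maximal order of an algebra of degree `n` isomorphic to the `r × r` matrices over a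
division algebra, and `J` is its radical. -/
structure IsLocalOrder {K : Type*} [Field K] (v : Valuation K ℤᵐ⁰) {A : Type*} [Ring A]
    [Algebra K A] (q p n r : ℕ) (O J : AddSubgroup A) : Prop where
  pos : 0 < r
  one_mem : 1 ∈ O
  mul_mem : ∀ x ∈ O, ∀ y ∈ O, x * y ∈ O
  exists_basis : ∃ b : Module.Basis (Fin (Module.finrank K A)) K A, basisLattice v b = O
  le : J ≤ O
  relIndex : J.relIndex O = q ^ (r * n)
  -- The index of the order in its dual depends on the scale of `l`. Raising it to the power `p - 1`
  -- allows that scale to be expressed through `γ`.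
  genIndex_dual : ∀ l : A →ₗ[K] K, l ≠ 0 → (∀ x y, l (x * y) = l (y * x)) → ∀ γ : K,
    (∀ x, l (x ^ p) = γ * l x ^ p) →
    genIndex (dualLattice v l O) O ^ (p - 1) * (q : ℚ) ^ (r * n * (p - 1)) =
      (q : ℚ) ^ (Module.finrank K A * (p - 1)) * absValue q (v γ) ^ Module.finrank K A
  division : r = 1 → ∃ (w : Valuation A ℤᵐ⁰) (π : Aˣ), O = ball w 1 ∧
    (∀ x, x ∈ J ↔ w x < 1) ∧ (∀ x : A, x ≠ 0 → IsUnit x) ∧ (∀ x, w x < 1 ↔ w x ≤ w π) ∧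
    ∀ x, v (reducedNorm K x) < 1 ↔ w x < 1

lemma genIndex_comap {G H : Type*} [AddCommGroup G] [AddCommGroup H] {f : G →+ H}
    (hf : Function.Bijective f) (U V : AddSubgroup H) :
    genIndex (U.comap f) (V.comap f) = genIndex U V := by
  rw [← genIndex_map hf.1, AddSubgroup.map_comap_eq_self_of_surjective hf.2,
    AddSubgroup.map_comap_eq_self_of_surjective hf.2]

lemma basisLattice_reindex {K : Type*} [Field K] {v : Valuation K ℤᵐ⁰} {A : Type*} [Ring A]
    [Algebra K A] {ι ι' : Type*} [Fintype ι] [Fintype ι'] (b : Module.Basis ι K A) (e : ι ≃ ι') :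
    basisLattice v (b.reindex e) = basisLattice v b := by
  ext x
  simp only [mem_basisLattice, Module.Basis.repr_reindex_apply]
  exact ⟨fun h i => by simpa using h (e i), fun h i => h (e.symm i)⟩

lemma reducedNorm_algEquiv {K : Type*} [Field K] {A B : Type*} [Ring A] [Algebra K A] [Ring B]
    [Algebra K B] (e : A ≃ₐ[K] B) (a : A) : reducedNorm K (e a) = reducedNorm K a := by
  have h : IsReducedNorm K (e a) = IsReducedNorm K a := by
    funext c
    refine propext ⟨fun h => h.of_algEquiv e, fun h => IsReducedNorm.of_algEquiv e.symm ?_⟩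
    rwa [e.symm_apply_apply]
  unfold reducedNorm
  rw [h]

variable {K : Type*} [Field K] [Valued K ℤᵐ⁰] [CompactSpace 𝒪[K]] {q : ℕ}
variable (hK : IsDiscreteWithCard (Valued.v : Valuation K ℤᵐ⁰) q)

include hK

/-- Take matrices over the valuation ring of `Δ` and over its maximal ideal. With `n = r * m` and a
residue field of `q ^ m` elements, the index is `(q ^ m) ^ r ^ 2 = q ^ (r * n)`. Duality reduces to
the entries, where the dual is a scalar multiple of the maximal ideal. -/
lemma exists_isLocalOrder_of_algEquiv {A : Type*} [Ring A] [Algebra K A] (p : ℕ) [Fact p.Prime]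
    [CharP K p] {n r : ℕ} (hn : Module.finrank K A = n ^ 2) [NeZero r] {Δ : Type*} [DivisionRing Δ]
    [Algebra K Δ] [FiniteDimensional K Δ] [Algebra.IsCentral K Δ]
    (ψ : A ≃ₐ[K] Matrix (Fin r) (Fin r) Δ) :
    ∃ O J : AddSubgroup A, IsLocalOrder (Valued.v : Valuation K ℤᵐ⁰) q p n r O J := by
  have : CharP Δ p := charP_of_injective_algebraMap (algebraMap K Δ).injective p
  obtain ⟨κ, π, m, hfin, h⟩ := exists_isCyclicData (Δ := Δ) hK p
  obtain ⟨e, -, he⟩ := h.exists_ramification hK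
  obtain rfl := h.finrank_eq hK he
  obtain ⟨β, -, hβ⟩ := h.exists_basis hK he
  have hcard := (h.exists_coefficient_basis hK he).2
  set w := divValuation K Δ hK.exists_uniformizer with hw
  have hq : q ≠ 0 := hK.ne_zero
  have hJ : ∀ x, x ∈ ball w (exp (-1 : ℤ)) ↔ w x < 1 := fun x => lt_one_iff_le_exp.symm
  have hJO : ball w (exp (-1 : ℤ)) ≤ ball w 1 := fun x hx => ((hJ x).1 hx).le
  have hA : Module.finrank K A = r * r * (m * m) := by
    rw [ψ.toLinearEquiv.finrank_eq, Module.finrank_matrix, he]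
    simp
  have hnr : n = r * m := by
    have : n ^ 2 = (r * m) ^ 2 := by rw [← hn, hA]; ring
    exact Nat.pow_left_injective two_ne_zero this
  let f : A →+ Matrix (Fin r) (Fin r) Δ := (ψ : A →+ Matrix (Fin r) (Fin r) Δ)
  have hf : Function.Bijective f := ψ.bijective
  let O' : AddSubgroup (Matrix (Fin r) (Fin r) Δ) := (ball w 1).matrix
  let J' : AddSubgroup (Matrix (Fin r) (Fin r) Δ) := (ball w (exp (-1 : ℤ))).matrix
  have hJO' : J' ≤ O' := fun X hX i j => hJO (hX i j)
  have hrel : J'.relIndex O' = q ^ (r * n) := by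
    rw [relIndex_matrix r hJO, relIndex_eq_card_coefficientField h.eq_one h.approx, hcard,
      ← pow_mul, hnr]
    congr 1
    ring
  have hbasis : basisLattice (Valued.v : Valuation K ℤᵐ⁰) (β.matrix (Fin r) (Fin r)) = O' := by
    rw [basisLattice_matrix, hβ]
  refine ⟨O'.comap f, J'.comap f, Nat.pos_of_ne_zero (NeZero.ne r), ?_, ?_, ?_,
    AddSubgroup.comap_mono hJO', ?_, ?_, ?_⟩
  · intro i j
    change w (ψ 1 i j) ≤ 1
    rw [map_one, Matrix.one_apply]
    split_ifs <;> simp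
  · intro x hx y hy i j
    change w (ψ (x * y) i j) ≤ 1
    rw [map_mul, Matrix.mul_apply]
    refine w.map_sum_le fun k _ => ?_
    rw [map_mul]
    exact mul_le_one' (hx i k) (hy k j)
  · refine ⟨((β.matrix (Fin r) (Fin r)).map ψ.symm.toLinearEquiv).reindex
      (Fintype.equivFinOfCardEq ?_), ?_⟩
    · rw [hA]
      simp
      ring
    · rw [basisLattice_reindex, ← hbasis]
      rfl
  · rw [AddSubgroup.relIndex_comap, AddSubgroup.map_comap_eq_self_of_surjective hf.2, hrel]
  · intro l hl0 hl γ hγ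
    let l' : Matrix (Fin r) (Fin r) Δ →ₗ[K] K := l ∘ₗ ψ.symm.toLinearMap
    have hl' : ∀ X Y, l' (X * Y) = l' (Y * X) := fun X Y => by
      change l (ψ.symm (X * Y)) = l (ψ.symm (Y * X))
      rw [map_mul ψ.symm, map_mul ψ.symm, hl]
    let μ : Δ →ₗ[K] K := l' ∘ₗ Matrix.singleLinearMap K (0 : Fin r) (0 : Fin r)
    have hμ : ∀ x, μ x = l' (Matrix.single 0 0 x) := fun x => rfl
    have hsum : ∀ X, l' X = ∑ i, μ (X i i) := eq_sum_diag_of_central l' hl'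
    have hμc : ∀ x y, μ (x * y) = μ (y * x) := by
      intro x y
      have h1 : ∀ x y : Δ, Matrix.single (0 : Fin r) (0 : Fin r) (x * y) =
          Matrix.single 0 0 x * Matrix.single 0 0 y := fun x y => by simp
      rw [hμ, hμ, h1, h1, hl']
    have hμ0 : μ ≠ 0 := by
      intro h0
      refine hl0 (LinearMap.ext fun x => ?_)
      have h1 := hsum (ψ x)
      rw [h0] at h1
      simpa [l'] using h1
    have hsingle : ∀ (x : Δ) (i : ℕ), Matrix.single (0 : Fin r) (0 : Fin r) x ^ (i + 1) =
        Matrix.single 0 0 (x ^ (i + 1)) := by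
      intro x i
      induction i with
      | zero => simp
      | succ i ih => rw [pow_succ, ih, Matrix.single_mul_single_same, ← pow_succ]
    have hμγ : ∀ x, μ (x ^ p) = γ * μ x ^ p := by
      intro x
      have hp := (Fact.out : p.Prime).pos
      have h1 : Matrix.single (0 : Fin r) (0 : Fin r) (x ^ p) = Matrix.single 0 0 x ^ p := by
        obtain ⟨i, rfl⟩ := Nat.exists_eq_succ_of_ne_zero hp.ne'
        rw [Nat.succ_eq_add_one, hsingle]
      rw [hμ, hμ, h1]
      change l (ψ.symm _) = γ * l (ψ.symm _) ^ p
      rw [map_pow, hγ]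
    obtain ⟨i, hi, hi'⟩ := h.exists_functional_max hK he hμc hμ0
    have hvγ := h.val_frobenius_factor hK hi hi' p hμγ
    obtain ⟨ϖ, hϖ⟩ := hK.exists_uniformizer
    -- The scalar by which the dual differs from the radical.
    have hc : Valued.v (ϖ ^ (1 - i)) = (exp (i - 1) : ℤᵐ⁰) := by
      rw [map_zpow₀, hϖ, ← exp_zsmul, exp_inj, smul_eq_mul]
      ring
    set c := ϖ ^ (1 - i)
    have hc0 : c ≠ 0 := ne_zero_of_valuation_eq_exp hc
    have hdual : dualLattice (Valued.v : Valuation K ℤᵐ⁰) l (O'.comap f) =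
        (scaleDown c J').comap f := by
      have h1 : dualLattice (Valued.v : Valuation K ℤᵐ⁰) l (O'.comap f) =
          (dualLattice (Valued.v : Valuation K ℤᵐ⁰) l' O').comap f := by
        ext x
        constructor
        · intro hx Y hY
          have := hx (ψ.symm Y) (by
            change ψ (ψ.symm Y) ∈ O'
            rwa [ψ.apply_symm_apply])
          change Valued.v (l (ψ.symm (ψ x * Y))) ≤ 1
          rwa [map_mul, ψ.symm_apply_apply]
        · intro hx y hy
          have := hx (ψ y) hy
          change Valued.v (l (ψ.symm (ψ x * ψ y))) ≤ 1 at this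
          rwa [← map_mul, ψ.symm_apply_apply] at this
      rw [h1, dualLattice_matrix hsum, scaleDown_matrix]
      congr 2
      ext x
      rw [h.mem_dualLattice_ball_iff hK he hμc hi hi' hc x]
      exact (hJ _).symm
    have hcomm : O'.Commensurable J' := commensurable_of_le hJO' (by rw [hrel]; positivity)
    have hcomm' : J'.Commensurable
        (basisLattice (Valued.v : Valuation K ℤᵐ⁰) (β.matrix (Fin r) (Fin r))) := by
      rw [hbasis]
      exact hcomm.symm
    obtain ⟨h2, h3⟩ := genIndex_scaleDown_self hK hc0 _ hcomm'
    have h4 : genIndex J' O' * (q : ℚ) ^ (r * n) = 1 := by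
      rw [← genIndex_inv, genIndex_of_le hJO', hrel, Nat.cast_pow, inv_mul_cancel₀]
      positivity
    rw [hdual, genIndex_comap hf, ← genIndex_mul h2 hcomm.symm, hvγ, absValue_exp]
    rw [hc, absValue_exp] at h3
    have h5 : Fintype.card (Fin r × Fin r × Fin m × Fin m) = Module.finrank K A := by
      rw [hA]
      simp
      ring
    rw [h5] at h3
    have hq' : (q : ℚ) ≠ 0 := by exact_mod_cast hq
    set N := Module.finrank K A
    have hp := (Fact.out : p.Prime).one_le
    have h6 : genIndex (scaleDown c J') J' = ((q : ℚ) ^ (1 - i)) ^ N := by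
      rw [eq_comm, ← mul_right_inj' (pow_ne_zero N (zpow_ne_zero (i - 1) hq')), ← mul_pow,
        ← zpow_add₀ hq', _root_.mul_comm (_ ^ N), h3]
      simp
    have h7 : genIndex J' O' = ((q : ℚ) ^ (r * n))⁻¹ := eq_inv_of_mul_eq_one_left h4
    rw [h6, h7, pow_mul (q : ℚ) (r * n), mul_pow, mul_assoc, inv_pow,
      inv_mul_cancel₀ (by positivity), mul_one]
    obtain ⟨p', rfl⟩ := Nat.exists_eq_add_of_le' hp
    simp only [Nat.add_sub_cancel]
    rw [← zpow_natCast, ← zpow_natCast, ← zpow_natCast, ← zpow_natCast, ← zpow_mul, ← zpow_mul,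
      ← zpow_mul, ← zpow_add₀ hq']
    congr 1
    push_cast
    ring
  · rintro rfl
    let E : Matrix (Fin 1) (Fin 1) Δ ≃ₐ[K] Δ :=
      { toFun := fun X => X 0 0
        invFun := fun x => Matrix.of fun _ _ => x
        left_inv := fun X => by
          ext i j
          rw [Subsingleton.elim i 0, Subsingleton.elim j 0]
          rfl
        right_inv := fun _ => rfl
        map_mul' := fun X Y => by simp [Matrix.mul_apply]
        map_add' := fun _ _ => rfl
        commutes' := fun c => by simp [Matrix.algebraMap_matrix_apply] }
    let ψ' : A ≃ₐ[K] Δ := ψ.trans E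
    have hψ' : ∀ x, ψ' x = ψ x 0 0 := fun x => rfl
    let u : Δˣ := Units.mk0 π h.ne_zero
    refine ⟨w.comap (ψ' : A →+* Δ), Units.map (ψ'.symm : Δ →* A) u, ?_, ?_, ?_, ?_, ?_⟩
    · ext x
      refine ⟨fun hx => hx 0 0, fun hx i j => ?_⟩
      rw [Subsingleton.elim i 0, Subsingleton.elim j 0]
      exact hx
    · intro x
      change _ ↔ w (ψ' x) < 1
      rw [← hJ]
      refine ⟨fun hx => hx 0 0, fun hx i j => ?_⟩
      rw [Subsingleton.elim i 0, Subsingleton.elim j 0]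
      exact hx
    · intro x hx
      have h1 : ψ' x ≠ 0 := (map_ne_zero_iff ψ' ψ'.injective).2 hx
      have h2 := (IsUnit.mk0 _ h1).map (ψ'.symm : Δ →* A)
      have h3 : (ψ'.symm : Δ →* A) (ψ' x) = x := ψ'.symm_apply_apply x
      rwa [h3] at h2
    · intro x
      change w (ψ' x) < 1 ↔ w (ψ' x) ≤ w (ψ' (ψ'.symm π))
      rw [ψ'.apply_symm_apply, h.val_uniformizer]
      refine ⟨fun hx => h.val_le_of_lt_one hx, fun hx => hx.trans_lt ?_⟩
      rw [← exp_zero, exp_lt_exp]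
      have := h.pos
      omega
    · intro x
      rw [← reducedNorm_algEquiv ψ']
      exact h.reducedNorm_lt_one_iff hK he (ψ' x)

/-- Artin–Wedderburn presents the algebra as matrices over a division algebra. -/
theorem exists_isLocalOrder {A : Type*} [Ring A] [Nontrivial A] [Algebra K A] (p : ℕ)
    [Fact p.Prime] [CharP K p] {n : ℕ} (hn : Module.finrank K A = n ^ 2)
    (hA : HasCoordinateOperators K A) :
    ∃ (r : ℕ) (O J : AddSubgroup A), IsLocalOrder (Valued.v : Valuation K ℤᵐ⁰) q p n r O J := by
  have := hA.isSimpleRing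
  have := hA.isCentral
  have : FiniteDimensional K A := by
    obtain ⟨m, b, -⟩ := hA
    exact b.finiteDimensional_of_finite
  have := IsArtinianRing.of_finite K A
  obtain ⟨r, hr, Δ, _, _, _, ⟨ψ⟩⟩ := IsSimpleRing.exists_algEquiv_matrix_divisionRing_finite K A
  -- A central element of `Δ` gives a scalar matrix in the centre of the whole algebra, which is
  -- `K`.
  have : Algebra.IsCentral K Δ := ⟨fun z hz => by
    rw [Subalgebra.mem_center_iff] at hz
    have h1 : ψ.symm (Matrix.scalar (Fin r) z) ∈ Subalgebra.center K A := by
      rw [Subalgebra.mem_center_iff]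
      intro x
      apply ψ.injective
      rw [map_mul, map_mul, ψ.apply_symm_apply]
      exact (Matrix.scalar_commute z (fun y => (hz y).symm) (ψ x)).symm
    rw [Algebra.IsCentral.center_eq_bot, Algebra.mem_bot] at h1
    obtain ⟨c, hc⟩ := h1
    have h2 := congrArg (fun x => ψ x 0 0) hc
    simp only [AlgEquiv.commutes, ψ.apply_symm_apply] at h2
    rw [Algebra.mem_bot]
    exact ⟨c, by simpa [Matrix.algebraMap_matrix_apply] using h2⟩⟩
  obtain ⟨O, J, h⟩ := exists_isLocalOrder_of_algEquiv hK p hn ψ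
  exact ⟨r, O, J, h⟩

end LocalOrder


/-! ### Compactness of complete valuation rings with finite residue field. -/

section Compactness

open WithZero
open scoped WithZero Valued

variable {K : Type*} [Field K]

lemma relIndex_ball_ne_zero {v : Valuation K ℤᵐ⁰} {q : ℕ} (hv : IsDiscreteWithCard v q) (i : ℕ) :
    (ball v (exp (-(i : ℤ)))).relIndex (ball v 1) ≠ 0 := by
  obtain ⟨ϖ, hϖ⟩ := hv.exists_uniformizer
  have hϖ0 := ne_zero_of_valuation_eq_exp hϖ
  let b : Module.Basis Unit K K := Module.Basis.singleton Unit K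
  have hb : basisLattice v b = ball v 1 := by
    ext x
    simp [mem_basisLattice, b, mem_ball]
  have h1 := (scalesIndex_scaleDown hv (inv_ne_zero (pow_ne_zero i hϖ0)) b).1.1
  rw [hb] at h1
  have h2 : scaleDown (ϖ ^ i)⁻¹ (ball v 1) = ball v (exp (-(i : ℤ))) := by
    ext x
    change v ((ϖ ^ i)⁻¹ • x) ≤ 1 ↔ v x ≤ _
    rw [smul_eq_mul, map_mul, map_inv₀, map_pow, hϖ, ← exp_nsmul, inv_mul_le_iff₀ exp_pos]
    simp
  rwa [h2] at h1

/-- The ring is complete, and totally bounded because every small ball has finite index in it. -/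
lemma compactSpace_integer [Valued K ℤᵐ⁰] [CompleteSpace K] {q : ℕ}
    (hK : IsDiscreteWithCard (Valued.v : Valuation K ℤᵐ⁰) q) : CompactSpace 𝒪[K] := by
  refine (isCompact_iff_compactSpace (s := ((Valued.v : Valuation K ℤᵐ⁰).integer : Set K))).1 ?_
  rw [isCompact_iff_totallyBounded_isComplete]
  refine ⟨?_, (Valued.isClosed_integer K).isComplete⟩
  rw [(Valued.hasBasis_uniformity K ℤᵐ⁰).totallyBounded_iff]
  intro γ _
  obtain ⟨i, hi⟩ : ∃ i : ℕ, (exp (-(i : ℤ)) : ℤᵐ⁰) <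
      MonoidWithZeroHom.ValueGroup₀.embedding γ.1 := by
    obtain ⟨j, hj⟩ := eq_exp_of_ne_zero
      ((_root_.map_ne_zero MonoidWithZeroHom.ValueGroup₀.embedding).2 γ.ne_zero)
    refine ⟨(-j).toNat + 1, ?_⟩
    rw [hj, exp_lt_exp]
    omega
  have hfin := relIndex_ball_ne_zero hK i
  set H := (ball (Valued.v : Valuation K ℤᵐ⁰) (exp (-(i : ℤ)))).addSubgroupOf
    (ball (Valued.v : Valuation K ℤᵐ⁰) 1)
  have : Finite (ball (Valued.v : Valuation K ℤᵐ⁰) 1 ⧸ H) := Nat.finite_of_card_ne_zero hfin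
  refine ⟨Set.range fun y : ball (Valued.v : Valuation K ℤᵐ⁰) 1 ⧸ H => (y.out : K),
    Set.finite_range _, fun x hx => ?_⟩
  have hx : x ∈ ball (Valued.v : Valuation K ℤᵐ⁰) 1 := hx
  rw [Set.mem_iUnion₂]
  refine ⟨_, ⟨QuotientAddGroup.mk ⟨x, hx⟩, rfl⟩, ?_⟩
  have h1 : (QuotientAddGroup.mk (⟨x, hx⟩ : ball (Valued.v : Valuation K ℤᵐ⁰) 1) : _ ⧸ H) =
      QuotientAddGroup.mk (QuotientAddGroup.mk (⟨x, hx⟩ : ball (Valued.v : Valuation K ℤᵐ⁰) 1) :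
        _ ⧸ H).out := (QuotientAddGroup.out_eq' _).symm
  rw [QuotientAddGroup.eq] at h1
  have h2 : Valued.v (-x + ((QuotientAddGroup.mk
    (⟨x, hx⟩ : ball (Valued.v : Valuation K ℤᵐ⁰) 1) : _ ⧸ H).out : K)) ≤
      (exp (-(i : ℤ)) : ℤᵐ⁰) := h1
  rw [neg_add_eq_sub] at h2
  rw [Set.mem_ofPred_eq, Set.mem_ofPred_eq, Valuation.restrict_lt_iff_lt_embedding]
  exact lt_of_le_of_lt h2 hi

lemma exists_val_sub_lt_of_denseRange [Valued K ℤᵐ⁰] {ϖ : K}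
    (hϖ : Valued.v ϖ = (exp (-1 : ℤ) : ℤᵐ⁰)) {R : Type*} {f : R → K} (hf : DenseRange f)
    (x : K) {γ : ℤᵐ⁰} (hγ : γ ≠ 0) : ∃ r, Valued.v (x - f r) < γ := by
  obtain ⟨i, hi⟩ := eq_exp_of_ne_zero hγ
  have h1 : IsOpen {y : K | Valued.v (x - y) ≤ (exp (i - 1) : ℤᵐ⁰)} :=
    (isClopen_setOf_valuation_le hϖ (i - 1)).isOpen.preimage
      (continuous_const.sub continuous_id : Continuous fun y : K => x - y)
  obtain ⟨r, hr⟩ := hf.exists_mem_open h1 ⟨x, by simp⟩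
  refine ⟨r, lt_of_le_of_lt (show Valued.v _ ≤ _ from hr) ?_⟩
  rw [hi, exp_lt_exp]
  omega

end Compactness

/-! ### Completions of the rational function field and their residue fields. -/

section Places

open WithZero
open scoped WithZero Valued

variable {k : Type*} [Field k]

/-- The valuation of the completion at a finite place. -/
abbrev valAt (v : FinitePlace k) : Valuation (CompletionAt v) ℤᵐ⁰ := Valued.v

variable (k) in
/-- The valuation of the completion at infinity. -/
abbrev valInfty : Valuation (CompletionInfty k) ℤᵐ⁰ := Valued.v

lemma valAt_algebraMap (v : FinitePlace k) (x : RatFunc k) :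
    valAt v (algebraMap (RatFunc k) (CompletionAt v) x) = v.valuation (RatFunc k) x :=
  HeightOneSpectrum.valuedAdicCompletion_eq_valuation' v x

open Classical in
lemma valInfty_algebraMap (x : RatFunc k) :
    valInfty k (algebraMap (RatFunc k) (CompletionInfty k) x) = RatFunc.inftyValuation k x :=
  let _ := RatFunc.inftyValued k
  Valued.valuedCompletion_apply x

open Classical in
lemma denseRange_algebraMap_infty :
    DenseRange (algebraMap (RatFunc k) (CompletionInfty k)) :=
  let _ := RatFunc.inftyValued k
  UniformSpace.Completion.denseRange_coe

open Classical in
instance : CompleteSpace (CompletionInfty k) :=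
  let _ := RatFunc.inftyValued k
  inferInstanceAs (CompleteSpace (UniformSpace.Completion (RatFunc k)))

lemma exists_generator (v : FinitePlace k) : ∃ P : k[X], Irreducible P ∧
    v.asIdeal = Ideal.span {P} ∧ v.intValuation P = exp (-1 : ℤ) := by
  obtain ⟨P, hP⟩ := (IsPrincipalIdealRing.principal v.asIdeal).principal
  have hP : v.asIdeal = Ideal.span {P} := hP
  have hP0 : P ≠ 0 := by
    rintro rfl
    refine v.ne_bot ?_
    rw [hP, Ideal.span_singleton_eq_bot]
  refine ⟨P, ?_, hP, v.intValuation_singleton hP0 hP⟩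
  have := v.isPrime
  rw [hP, Ideal.span_singleton_prime hP0] at this
  exact this.irreducible

lemma valAt_generator {v : FinitePlace k} {P : k[X]} (h : v.intValuation P = exp (-1 : ℤ)) :
    valAt v (algebraMap (RatFunc k) _ (algebraMap k[X] (RatFunc k) P)) = exp (-1 : ℤ) := by
  rw [valAt_algebraMap, HeightOneSpectrum.valuation_of_algebraMap, h]

open Classical in
lemma valInfty_X_inv :
    valInfty k (algebraMap (RatFunc k) _ (1 / RatFunc.X : RatFunc k)) = exp (-1 : ℤ) := by
  rw [valInfty_algebraMap, RatFunc.inftyValuation.X_inv]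

lemma exists_polynomial_sub_lt (v : FinitePlace k) {x : CompletionAt v} (hx : valAt v x ≤ 1)
    {γ : ℤᵐ⁰} (hγ : γ ≠ 0) : ∃ a : k[X],
      valAt v (x - algebraMap (RatFunc k) _ (algebraMap k[X] (RatFunc k) a)) < γ := by
  obtain ⟨P, -, -, hP⟩ := exists_generator v
  obtain ⟨r, hr⟩ := exists_val_sub_lt_of_denseRange (valAt_generator hP)
    (HeightOneSpectrum.denseRange_algebraMap (RatFunc k) v) x
    (γ := min γ 1) (by rcases min_choice γ 1 with h | h <;> rw [h]; exacts [hγ, one_ne_zero])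
  have hr1 : v.valuation (RatFunc k) r ≤ 1 := by
    rw [← valAt_algebraMap, ← sub_sub_cancel x (algebraMap _ _ r)]
    exact ((valAt v).map_sub _ _).trans (max_le hx (hr.le.trans (min_le_right _ _)))
  obtain ⟨a, ha⟩ := v.exists_valuation_sub_lt_of_integer hr1 (Units.mk0 γ hγ)
  refine ⟨a, ?_⟩
  rw [← sub_add_sub_cancel x (algebraMap _ _ r)]
  refine ((valAt v).map_add _ _).trans_lt (max_lt (hr.trans_le (min_le_left _ _)) ?_)
  rw [← map_sub, valAt_algebraMap, Valuation.map_sub_swap]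
  exact ha

/-- The order of the residue field at a finite place. -/
def placeCard (v : FinitePlace k) : ℕ := (ball (valAt v) (exp (-1 : ℤ))).relIndex (ball (valAt v) 1)

/-- Polynomials of degree less than that of `P` represent each residue class once, by division with
remainder. -/
lemma placeCard_eq [Finite k] {v : FinitePlace k} {P : k[X]} (hP : Irreducible P)
    (hv : v.asIdeal = Ideal.span {P}) : placeCard v = Nat.card k ^ P.natDegree := by
  let g : k[X] →+ CompletionAt v :=
    ((algebraMap (RatFunc k) (CompletionAt v)).comp (algebraMap k[X] (RatFunc k)) : k[X] →+* _)
  have hg : ∀ a, valAt v (g a) = v.intValuation a := fun a =>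
    (valAt_algebraMap v _).trans (v.valuation_of_algebraMap a)
  have hginj : Function.Injective g := (algebraMap (RatFunc k) (CompletionAt v)).injective.comp
    (IsFractionRing.injective k[X] (RatFunc k))
  have hlt : ∀ a, valAt v (g a) < 1 ↔ P ∣ a := by
    intro a
    rw [hg, HeightOneSpectrum.intValuation_lt_one_iff_mem, hv, Ideal.mem_span_singleton]
  let T : AddSubgroup (CompletionAt v) := (Polynomial.degreeLT k P.natDegree).toAddSubgroup.map g
  rw [placeCard, relIndex_eq_card_of_complement (T := T)]
  · have h1 : Nat.card T = Nat.card (Polynomial.degreeLT k P.natDegree) :=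
      Nat.card_congr (AddSubgroup.equivMapOfInjective _ g hginj).toEquiv.symm
    rw [h1, Nat.card_congr (Polynomial.degreeLTEquiv k P.natDegree).toEquiv, Nat.card_fun,
      Nat.card_eq_fintype_card (α := Fin _), Fintype.card_fin]
  · refine le_antisymm (sup_le ?_ ?_) fun x hx => ?_
    · rintro _ ⟨a, -, rfl⟩
      change valAt v (g a) ≤ 1
      rw [hg]
      exact v.intValuation_le_one a
    · intro x hx
      exact (lt_one_iff_le_exp.2 hx).le
    · obtain ⟨a, ha⟩ := exists_polynomial_sub_lt v hx one_ne_zero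
      have ha : valAt v (x - g a) < 1 := ha
      refine AddSubgroup.mem_sup.2 ⟨g (a % P), ⟨_, ?_, rfl⟩, x - g (a % P), ?_, by abel⟩
      · change a % P ∈ Polynomial.degreeLT k P.natDegree
        rw [Polynomial.mem_degreeLT, ← Polynomial.degree_eq_natDegree hP.ne_zero]
        exact EuclideanDomain.mod_lt _ hP.ne_zero
      · refine lt_one_iff_le_exp.1 ?_
        rw [← sub_add_sub_cancel x (g a), ← map_sub]
        refine ((valAt v).map_add _ _).trans_lt (max_lt ha ?_)
        rw [hlt]
        exact ⟨a / P, by rw [EuclideanDomain.mod_eq_sub_mul_div]; ring⟩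
  · rw [eq_bot_iff]
    rintro _ ⟨⟨a, ha, rfl⟩, ha2⟩
    have h1 : P ∣ a := (hlt a).1 (lt_one_iff_le_exp.2 ha2)
    have ha : a ∈ Polynomial.degreeLT k P.natDegree := ha
    rw [Polynomial.mem_degreeLT, ← Polynomial.degree_eq_natDegree hP.ne_zero] at ha
    rw [AddSubgroup.mem_bot, Polynomial.eq_zero_of_dvd_of_degree_lt h1 ha, map_zero]

lemma isDiscreteWithCard_at [Finite k] (v : FinitePlace k) :
    IsDiscreteWithCard (valAt v) (placeCard v) := by
  obtain ⟨P, hP, hv, hval⟩ := exists_generator v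
  refine ⟨⟨_, valAt_generator hval⟩, rfl, ?_⟩
  · rw [placeCard_eq hP hv]
    exact pow_ne_zero _ Nat.card_pos.ne'

open Classical in
lemma exists_constant_sub_lt {x : CompletionInfty k} (hx : valInfty k x ≤ 1) :
    ∃ c : k, valInfty k (x - algebraMap (RatFunc k) _ (RatFunc.C c)) < 1 := by
  obtain ⟨r, hr⟩ := exists_val_sub_lt_of_denseRange valInfty_X_inv
    denseRange_algebraMap_infty x
    (γ := 1) one_ne_zero
  have hr1 : RatFunc.inftyValuation k r ≤ 1 := by
    rw [← valInfty_algebraMap, ← sub_sub_cancel x (algebraMap _ _ r)]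
    exact ((valInfty k).map_sub _ _).trans (max_le hx hr.le)
  suffices h : ∃ c : k, RatFunc.inftyValuation k (r - RatFunc.C c) < 1 by
    obtain ⟨c, hc⟩ := h
    refine ⟨c, ?_⟩
    rw [← sub_add_sub_cancel x (algebraMap _ _ r)]
    refine ((valInfty k).map_add _ _).trans_lt (max_lt hr ?_)
    rwa [← map_sub, valInfty_algebraMap]
  rcases hr1.lt_or_eq with h | h
  · exact ⟨0, by simpa using h⟩
  have hr0 : r ≠ 0 := by
    rintro rfl
    simp at h
  have hdeg : r.num.natDegree = r.denom.natDegree := by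
    rw [RatFunc.inftyValuation_apply, RatFunc.inftyValuation_of_nonzero _ hr0, exp_eq_one] at h
    rw [RatFunc.intDegree, sub_eq_zero] at h
    exact_mod_cast h
  -- At value 1 numerator and denominator have equal degrees. The denominator is monic, so
  -- subtracting this constant lowers the degree of the numerator.
  let c := r.num.leadingCoeff
  refine ⟨c, ?_⟩
  have hd : algebraMap k[X] (RatFunc k) r.denom ≠ 0 :=
    (map_ne_zero_iff _ (IsFractionRing.injective k[X] (RatFunc k))).2 r.denom_ne_zero
  have h1 : r - RatFunc.C c = algebraMap k[X] _ (r.num - C c * r.denom) /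
      algebraMap k[X] _ r.denom := by
    rw [eq_div_iff hd, sub_mul, map_sub, map_mul, RatFunc.algebraMap_C]
    congr 1
    exact ((div_eq_iff hd).1 (RatFunc.num_div_denom r)).symm
  rw [h1, map_div₀, div_lt_one₀ (zero_lt_iff.2 ((Valuation.ne_zero_iff _).2 hd)),
    RatFunc.inftyValuation_apply, RatFunc.inftyValuation_apply,
    RatFunc.inftyValuation.polynomial _ r.denom_ne_zero]
  rcases eq_or_ne (r.num - C c * r.denom) 0 with h2 | h2
  · rw [h2, map_zero, ← RatFunc.inftyValuation_apply, map_zero]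
    exact exp_pos
  rw [RatFunc.inftyValuation.polynomial _ h2, exp_lt_exp]
  have hc : c ≠ 0 := leadingCoeff_ne_zero.2 (RatFunc.num_ne_zero hr0)
  have h3 := degree_sub_lt_left (p := r.num) (q := C c * r.denom) (by
    rw [degree_C_mul hc, degree_eq_natDegree (RatFunc.num_ne_zero hr0),
      degree_eq_natDegree r.denom_ne_zero, hdeg]) (RatFunc.num_ne_zero hr0) (by
    rw [leadingCoeff_mul, leadingCoeff_C, (RatFunc.monic_denom r).leadingCoeff, mul_one])
  have h4 := natDegree_lt_natDegree h2 h3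
  omega

open Classical in
-- The constants represent the residue field at infinity.
lemma isDiscreteWithCard_infty [Finite k] : IsDiscreteWithCard (valInfty k) (Nat.card k) := by
  have hC : ∀ c : k, c ≠ 0 → valInfty k (algebraMap (RatFunc k) _ (RatFunc.C c)) = 1 := by
    intro c hc
    rw [valInfty_algebraMap, RatFunc.inftyValuation.C _ hc]
  refine ⟨⟨_, valInfty_X_inv⟩, ?_, Nat.card_pos.ne'⟩
  · let g : k →+* CompletionInfty k := (algebraMap (RatFunc k) (CompletionInfty k)).comp RatFunc.C
    let T : AddSubgroup (CompletionInfty k) := (⊤ : AddSubgroup k).map g.toAddMonoidHom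
    rw [relIndex_eq_card_of_complement (T := T)]
    · have h1 := Nat.card_congr
        (AddSubgroup.equivMapOfInjective (⊤ : AddSubgroup k) g.toAddMonoidHom g.injective).toEquiv
      rw [← h1, AddSubgroup.card_top]
    · refine le_antisymm (sup_le ?_ fun x hx => (lt_one_iff_le_exp.2 hx).le) fun x hx => ?_
      · rintro _ ⟨c, -, rfl⟩
        change valInfty k (g c) ≤ 1
        rcases eq_or_ne c 0 with rfl | hc
        · simp
        · exact (hC c hc).le
      · obtain ⟨c, hc⟩ := exists_constant_sub_lt hx
        exact AddSubgroup.mem_sup.2 ⟨g c, ⟨c, trivial, rfl⟩, x - g c,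
          lt_one_iff_le_exp.1 hc, by abel⟩
    · rw [eq_bot_iff]
      rintro _ ⟨⟨c, -, rfl⟩, hc2⟩
      have h1 : valInfty k (g c) < 1 := lt_one_iff_le_exp.2 hc2
      rw [AddSubgroup.mem_bot]
      change g c = 0
      rcases eq_or_ne c 0 with rfl | hc
      · simp
      · exact absurd (hC c hc) h1.ne

end Places


/-! ### Cohomology of the structure sheaf of the projective line. -/

section StrongApproximation

open WithZero
open scoped WithZero Valued

variable {k : Type*} [Field k]

lemma valuation_generator_of_ne {v w : FinitePlace k} (hvw : v ≠ w) {P : k[X]}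
    (hP : v.asIdeal = Ideal.span {P}) :
    w.valuation (RatFunc k) (algebraMap k[X] (RatFunc k) P) = 1 := by
  rw [HeightOneSpectrum.valuation_of_algebraMap, HeightOneSpectrum.intValuation_eq_one_iff]
  intro h
  refine hvw (HeightOneSpectrum.ext (v.isMaximal.eq_of_le w.isPrime.ne_top ?_))
  rwa [hP, Ideal.span_singleton_le_iff_mem]

/-- Partial fractions: poles are removed one place at a time by `c / ϖ ^ m`, which is integral at
the other finite places since the generator of a prime is a unit there. -/
lemma exists_sub_integral_of_finset (T : Finset (FinitePlace k)) :
    ∀ a : ∀ v : FinitePlace k, CompletionAt v, (∀ v ∉ T, valAt v (a v) ≤ 1) →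
      ∃ f : RatFunc k, ∀ v, valAt v (a v - algebraMap _ _ f) ≤ 1 := by
  classical
  induction T using Finset.induction_on with
  | empty => exact fun a ha => ⟨0, fun v => by simpa using ha v (by simp)⟩
  | insert v T hv ih =>
    intro a ha
    obtain ⟨P, -, hP, hval⟩ := exists_generator v
    set ϖ : RatFunc k := algebraMap k[X] (RatFunc k) P with hϖ
    have hval' : v.valuation (RatFunc k) ϖ = exp (-1 : ℤ) := by
      rw [hϖ, HeightOneSpectrum.valuation_of_algebraMap, hval]
    have hϖ0 : ϖ ≠ 0 := ne_zero_of_valuation_eq_exp hval'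
    have hvϖ : ∀ m : ℕ, valAt v (algebraMap _ _ ϖ ^ m) = exp (-(m : ℤ)) := by
      intro m
      rw [map_pow, valAt_algebraMap, hval', ← exp_nsmul]
      simp
    have hϖ0' : (algebraMap (RatFunc k) (CompletionAt v) ϖ) ≠ 0 := by simpa using hϖ0
    obtain ⟨m, hm⟩ : ∃ m : ℕ, valAt v (algebraMap _ _ ϖ ^ m * a v) ≤ 1 := by
      rcases eq_or_ne (valAt v (a v)) 0 with h0 | h0
      · exact ⟨0, by rw [map_mul, h0, mul_zero]; exact zero_le_one⟩
      · obtain ⟨i, hi⟩ := eq_exp_of_ne_zero h0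
        refine ⟨i.toNat, ?_⟩
        rw [map_mul, hvϖ, hi, ← exp_add, ← exp_zero, exp_le_exp]
        omega
    obtain ⟨c, hc⟩ := exists_polynomial_sub_lt v hm (γ := exp (-(m : ℤ))) exp_ne_zero
    let f₀ : RatFunc k := algebraMap k[X] (RatFunc k) c / ϖ ^ m
    obtain ⟨f, hf⟩ := ih (fun w => a w - algebraMap _ _ f₀) fun w hw => by
      rcases eq_or_ne w v with rfl | hne
      · have h1 : a w - algebraMap _ _ f₀ = (algebraMap _ _ ϖ ^ m)⁻¹ *
            (algebraMap _ _ ϖ ^ m * a w - algebraMap _ _ (algebraMap k[X] (RatFunc k) c)) := by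
          rw [mul_sub, inv_mul_cancel_left₀ (pow_ne_zero m hϖ0'), map_div₀, map_pow,
            div_eq_inv_mul]
        rw [h1, map_mul, map_inv₀, hvϖ, inv_mul_le_iff₀ exp_pos, mul_one]
        exact hc.le
      · refine ((valAt w).map_sub _ _).trans (max_le (ha w (by simp [hne, hw])) ?_)
        rw [valAt_algebraMap, map_div₀, map_pow, valuation_generator_of_ne hne.symm hP, one_pow,
          div_one]
        exact w.valuation_le_one c
    refine ⟨f₀ + f, fun w => ?_⟩
    rw [map_add, ← sub_sub]
    exact hf w

open Classical in
lemma exists_polynomial_sub_le (x : CompletionInfty k) : ∃ p : k[X],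
    valInfty k (x - algebraMap (RatFunc k) _ (algebraMap k[X] (RatFunc k) p)) ≤ 1 := by
  obtain ⟨r, hr⟩ := exists_val_sub_lt_of_denseRange valInfty_X_inv
    denseRange_algebraMap_infty x (γ := 1) one_ne_zero
  refine ⟨r.num / r.denom, ?_⟩
  rw [← sub_add_sub_cancel x (algebraMap _ _ r)]
  refine ((valInfty k).map_add _ _).trans (max_le hr.le ?_)
  have hd : algebraMap k[X] (RatFunc k) r.denom ≠ 0 :=
    (map_ne_zero_iff _ (IsFractionRing.injective k[X] (RatFunc k))).2 r.denom_ne_zero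
  have h1 : r - algebraMap k[X] (RatFunc k) (r.num / r.denom) =
      algebraMap k[X] _ (r.num % r.denom) / algebraMap k[X] _ r.denom := by
    rw [eq_div_iff hd, sub_mul, ← map_mul, ← (div_eq_iff hd).1 (RatFunc.num_div_denom r),
      ← map_sub, EuclideanDomain.mod_eq_sub_mul_div, mul_comm]
  rw [← map_sub, valInfty_algebraMap, h1, map_div₀,
    div_le_one₀ (zero_lt_iff.2 ((Valuation.ne_zero_iff _).2 hd)), RatFunc.inftyValuation_apply,
    RatFunc.inftyValuation_apply, RatFunc.inftyValuation.polynomial _ r.denom_ne_zero]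
  rcases eq_or_ne (r.num % r.denom) 0 with h2 | h2
  · rw [h2, map_zero, ← RatFunc.inftyValuation_apply, map_zero]
    exact exp_pos.le
  rw [RatFunc.inftyValuation.polynomial _ h2, exp_le_exp]
  have h3 := natDegree_lt_natDegree h2 (EuclideanDomain.mod_lt r.num r.denom_ne_zero)
  omega

/-- H¹ of the structure sheaf vanishes: finite poles are removed first, then the pole at infinity by
a polynomial, which is harmless at the finite places. -/
lemma exists_sub_integral (a : Adele k) : ∃ f : RatFunc k,
    valInfty k (adeleToInfty k a - algebraMap _ _ f) ≤ 1 ∧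
      ∀ v, valAt v (adeleToAt v a - algebraMap _ _ f) ≤ 1 := by
  have ha : {v | ¬ valAt v (adeleToAt v a) ≤ 1}.Finite := Filter.eventually_cofinite.1 a.2.2
  obtain ⟨f, hf⟩ := exists_sub_integral_of_finset ha.toFinset (fun v => adeleToAt v a)
    fun v hv => by simpa using hv
  obtain ⟨p, hp⟩ := exists_polynomial_sub_le (adeleToInfty k a - algebraMap _ _ f)
  refine ⟨f + algebraMap k[X] (RatFunc k) p, ?_, fun v => ?_⟩
  · rwa [map_add, ← sub_sub]
  · rw [map_add, ← sub_sub]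
    refine ((valAt v).map_sub _ _).trans (max_le (hf v) ?_)
    rw [valAt_algebraMap]
    exact v.valuation_le_one p

/-- Integrality at the finite places makes `f` a polynomial, and integrality at infinity bounds its
degree by 0. -/
lemma eq_C_of_integral {f : RatFunc k} (hi : valInfty k (algebraMap _ _ f) ≤ 1)
    (hf : ∀ v : FinitePlace k, valAt v (algebraMap _ _ f) ≤ 1) : ∃ c, f = RatFunc.C c := by
  classical
  obtain ⟨p, rfl⟩ := HeightOneSpectrum.mem_integers_of_valuation_le_one (R := k[X]) (RatFunc k) f
    fun v => by rw [← valAt_algebraMap]; exact hf v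
  rcases eq_or_ne p 0 with rfl | hp
  · exact ⟨0, by simp⟩
  rw [valInfty_algebraMap, RatFunc.inftyValuation_apply, RatFunc.inftyValuation.polynomial _ hp,
    ← exp_zero, exp_le_exp] at hi
  obtain ⟨c, rfl⟩ := natDegree_eq_zero.1 (show p.natDegree = 0 by omega)
  exact ⟨c, by simp⟩

lemma val_C_le (c : k) : valInfty k (algebraMap _ _ (RatFunc.C c)) ≤ 1 ∧
    ∀ v : FinitePlace k, valAt v (algebraMap _ _ (RatFunc.C c)) ≤ 1 := by
  classical
  refine ⟨?_, fun v => ?_⟩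
  · rw [valInfty_algebraMap]
    rcases eq_or_ne c 0 with rfl | hc
    · simp
    · rw [RatFunc.inftyValuation.C _ hc]
  · rw [valAt_algebraMap, ← RatFunc.algebraMap_C]
    exact v.valuation_le_one _

end StrongApproximation

/-! ### Adelic lattices in the algebra and the trivial bundle. -/

section Boxes

open WithZero
open scoped WithZero Valued

variable {k : Type*} [Field k] {D : Type*} [DivisionRing D] [Algebra (RatFunc k) D]

/-- The adelic elements with components in the given groups. -/
def box (Ei : AddSubgroup (AlgInfty k D)) (E : ∀ v : FinitePlace k, AddSubgroup (AlgAt D v)) :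
    AddSubgroup (Adele k ⊗[RatFunc k] D) :=
  Ei.comap (compInfty : Adele k ⊗[RatFunc k] D →ₐ[RatFunc k] AlgInfty k D).toAddMonoidHom ⊓
    ⨅ v, (E v).comap (compAt v : Adele k ⊗[RatFunc k] D →ₐ[RatFunc k] AlgAt D v).toAddMonoidHom

lemma mem_box {Ei : AddSubgroup (AlgInfty k D)} {E : ∀ v : FinitePlace k, AddSubgroup (AlgAt D v)}
    {x : Adele k ⊗[RatFunc k] D} : x ∈ box Ei E ↔ compInfty x ∈ Ei ∧ ∀ v, compAt v x ∈ E v := by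
  rw [box, AddSubgroup.mem_inf, AddSubgroup.mem_iInf]
  rfl

variable (k D) in
/-- The diagonal image of `D`. -/
def globalPoints : AddSubgroup (Adele k ⊗[RatFunc k] D) :=
  ((Algebra.TensorProduct.includeRight : D →ₐ[RatFunc k] Adele k ⊗[RatFunc k] D) :
    D →+ Adele k ⊗[RatFunc k] D).range

lemma mem_globalPoints {x : Adele k ⊗[RatFunc k] D} :
    x ∈ globalPoints k D ↔ ∃ d : D, (1 : Adele k) ⊗ₜ d = x := Iff.rfl

lemma compInfty_global (d : D) : compInfty ((1 : Adele k) ⊗ₜ[RatFunc k] d) = 1 ⊗ₜ d := by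
  simp [compInfty]

lemma compAt_global (v : FinitePlace k) (d : D) :
    compAt v ((1 : Adele k) ⊗ₜ[RatFunc k] d) = 1 ⊗ₜ d := by
  simp [compAt]

variable [FiniteDimensional (RatFunc k) D]

variable (k D) in
/-- A basis of `D`. -/
def stdBasis : Module.Basis (Fin (Module.finrank (RatFunc k) D)) (RatFunc k) D :=
  Module.finBasis (RatFunc k) D

variable (k D) in
/-- The lattice of elements with integral coordinates, at infinity. -/
def stdInfty : AddSubgroup (AlgInfty k D) :=
  basisLattice (valInfty k) ((stdBasis k D).baseChange (CompletionInfty k))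

variable (D) in
/-- The lattice of elements with integral coordinates, at a finite place. -/
def stdAt (v : FinitePlace k) : AddSubgroup (AlgAt D v) :=
  basisLattice (valAt v) ((stdBasis k D).baseChange (CompletionAt v))

lemma exists_of_repr (yi : AlgInfty k D) (y : ∀ v : FinitePlace k, AlgAt D v)
    (hy : ∀ᶠ v in Filter.cofinite, y v ∈ stdAt D v) :
    ∃ x : Adele k ⊗[RatFunc k] D, compInfty x = yi ∧ ∀ v, compAt v x = y v := by
  let b := stdBasis k D
  have hint : ∀ l, ∀ᶠ v in Filter.cofinite,
      (b.baseChange (CompletionAt v)).repr (y v) l ∈ IntegersAt v := by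
    intro l
    filter_upwards [hy] with v h using h l
  let a : Fin _ → Adele k := fun l =>
    ((b.baseChange (CompletionInfty k)).repr yi l,
      ⟨fun v => (b.baseChange (CompletionAt v)).repr (y v) l, hint l⟩)
  refine ⟨(b.baseChange (Adele k)).equivFun.symm a, ?_, fun v => ?_⟩
  · refine (b.baseChange (CompletionInfty k)).repr.injective (Finsupp.ext fun l => ?_)
    rw [repr_compInfty, ← Module.Basis.equivFun_apply, LinearEquiv.apply_symm_apply]
    rfl
  · refine (b.baseChange (CompletionAt v)).repr.injective (Finsupp.ext fun l => ?_)
    rw [repr_compAt, ← Module.Basis.equivFun_apply, LinearEquiv.apply_symm_apply]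
    rfl

lemma eventually_compAt_mem (x : Adele k ⊗[RatFunc k] D) :
    ∀ᶠ v in Filter.cofinite, compAt v x ∈ stdAt D v := by
  have h : ∀ l, ∀ᶠ v in Filter.cofinite,
      valAt v (adeleToAt v (((stdBasis k D).baseChange (Adele k)).repr x l)) ≤ 1 :=
    fun l => (((stdBasis k D).baseChange (Adele k)).repr x l).2.2
  filter_upwards [Filter.eventually_all.2 h] with v hv l
  change valAt v (((stdBasis k D).baseChange (CompletionAt v)).repr (compAt v x) l) ≤ 1
  rw [repr_compAt]
  exact hv l

lemma repr_baseChange_global (L : Type*) [Field L] [Algebra (RatFunc k) L] (d : D) (l) :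
    ((stdBasis k D).baseChange L).repr (1 ⊗ₜ d) l = algebraMap _ L ((stdBasis k D).repr d l) := by
  rw [Module.Basis.baseChange_repr_tmul, Algebra.algebraMap_eq_smul_one]

/-- Coordinates reduce the claim to `exists_sub_integral`, that is to the vanishing of H¹. -/
lemma sup_std_eq_top : globalPoints k D ⊔ box (stdInfty k D) (stdAt D) = ⊤ := by
  rw [eq_top_iff]
  intro x _
  choose f hfi hf using fun l => exists_sub_integral
    (((stdBasis k D).baseChange (Adele k)).repr x l)
  let d : D := (stdBasis k D).equivFun.symm f
  have hd : ∀ l, (stdBasis k D).repr d l = f l := fun l => by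
    rw [← Module.Basis.equivFun_apply, LinearEquiv.apply_symm_apply]
  refine AddSubgroup.mem_sup.2 ⟨1 ⊗ₜ d, ⟨d, rfl⟩, x - 1 ⊗ₜ d, mem_box.2 ⟨fun l => ?_,
    fun v l => ?_⟩, by abel⟩
  · change valInfty k (((stdBasis k D).baseChange (CompletionInfty k)).repr _ l) ≤ 1
    rw [map_sub, map_sub, Finsupp.sub_apply, repr_compInfty, compInfty_global,
      repr_baseChange_global, hd]
    exact hfi l
  · change valAt v (((stdBasis k D).baseChange (CompletionAt v)).repr _ l) ≤ 1
    rw [map_sub, map_sub, Finsupp.sub_apply, repr_compAt, compAt_global,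
      repr_baseChange_global, hd]
    exact hf l v

/-- Global sections of the trivial bundle have constant coordinates. -/
lemma card_inf_std : Nat.card ↥(globalPoints k D ⊓ box (stdInfty k D) (stdAt D)) =
    Nat.card k ^ Module.finrank (RatFunc k) D := by
  have hinj : Function.Injective
      (Algebra.TensorProduct.includeRight : D →ₐ[RatFunc k] Adele k ⊗[RatFunc k] D) :=
    (Algebra.TensorProduct.includeRight :
      D →ₐ[RatFunc k] Adele k ⊗[RatFunc k] D).toRingHom.injective
  have hmem : ∀ c : Fin (Module.finrank (RatFunc k) D) → k,
      (1 : Adele k) ⊗ₜ[RatFunc k] (stdBasis k D).equivFun.symm (fun l => RatFunc.C (c l)) ∈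
        globalPoints k D ⊓ box (stdInfty k D) (stdAt D) := by
    intro c
    have hd : ∀ l, (stdBasis k D).repr ((stdBasis k D).equivFun.symm fun l => RatFunc.C (c l)) l =
        RatFunc.C (c l) := fun l => by
      rw [← Module.Basis.equivFun_apply, LinearEquiv.apply_symm_apply]
    refine ⟨⟨_, rfl⟩, mem_box.2 ⟨fun l => ?_, fun v l => ?_⟩⟩
    · change valInfty k (((stdBasis k D).baseChange (CompletionInfty k)).repr _ l) ≤ 1
      rw [compInfty_global, repr_baseChange_global, hd]
      exact (val_C_le _).1
    · change valAt v (((stdBasis k D).baseChange (CompletionAt v)).repr _ l) ≤ 1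
      rw [compAt_global, repr_baseChange_global, hd]
      exact (val_C_le _).2 v
  have hbij : Function.Bijective fun c => (⟨_, hmem c⟩ :
      ↥(globalPoints k D ⊓ box (stdInfty k D) (stdAt D))) := by
    refine ⟨fun c c' h => funext fun l => ?_, ?_⟩
    · have h1 := (stdBasis k D).equivFun.symm.injective (hinj (congrArg Subtype.val h))
      exact RatFunc.C_injective (congrFun h1 l)
    · rintro ⟨_, ⟨d, rfl⟩, hd⟩
      obtain ⟨h1, h2⟩ := mem_box.1 hd
      have h3 : ∀ l, ∃ c, (stdBasis k D).repr d l = RatFunc.C c := by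
        intro l
        refine eq_C_of_integral ?_ fun v => ?_
        · rw [← repr_baseChange_global, ← compInfty_global]
          exact h1 l
        · rw [← repr_baseChange_global, ← compAt_global]
          exact h2 v l
      choose c hc using h3
      refine ⟨c, Subtype.ext ?_⟩
      change (1 : Adele k) ⊗ₜ[RatFunc k] _ = 1 ⊗ₜ d
      congr 1
      rw [LinearEquiv.symm_apply_eq]
      exact funext fun l => (hc l).symm
  rw [← Nat.card_congr (Equiv.ofBijective _ hbij), Nat.card_fun, Nat.card_eq_fintype_card (α := Fin _),
    Fintype.card_fin]

lemma isBounded_std [Finite k] : IsBounded (globalPoints k D) (box (stdInfty k D) (stdAt D)) := by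
  rw [IsBounded, card_inf_std, sup_std_eq_top, AddSubgroup.index_top]
  exact ⟨pow_ne_zero _ Nat.card_pos.ne', one_ne_zero⟩

lemma euler_std : euler (globalPoints k D) (box (stdInfty k D) (stdAt D)) =
    (Nat.card k : ℚ) ^ Module.finrank (RatFunc k) D := by
  rw [euler, card_inf_std, sup_std_eq_top, AddSubgroup.index_top]
  simp

end Boxes


/-! ### Right translates of lattices. -/

section Translate

variable {R : Type*} [Ring R]

/-- The subgroup `U * u`. -/
def translate (u : Rˣ) (U : AddSubgroup R) : AddSubgroup R :=
  U.comap (AddMonoidHom.mulRight ((u⁻¹ : Rˣ) : R))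

lemma mem_translate {u : Rˣ} {U : AddSubgroup R} {x : R} :
    x ∈ translate u U ↔ x * ((u⁻¹ : Rˣ) : R) ∈ U := Iff.rfl

lemma mul_mem_translate {u : Rˣ} {U : AddSubgroup R} {x : R} (hx : x ∈ U) :
    x * (u : R) ∈ translate u U := by
  rwa [mem_translate, Units.mul_inv_cancel_right]

lemma translate_eq_map (u : Rˣ) (U : AddSubgroup R) :
    translate u U = U.map ((AddAut.mulRight u : R ≃+ R) : R →+ R) := by
  ext x
  constructor
  · intro hx
    exact ⟨_, hx, by simp⟩
  · rintro ⟨y, hy, rfl⟩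
    exact mul_mem_translate hy

lemma translate_eq_self {u : Rˣ} {U : AddSubgroup R} (hmul : ∀ x ∈ U, ∀ y ∈ U, x * y ∈ U)
    (h1 : (u : R) ∈ U) (h2 : ((u⁻¹ : Rˣ) : R) ∈ U) : translate u U = U := by
  ext x
  refine ⟨fun hx => ?_, fun hx => hmul _ hx _ h2⟩
  have := hmul _ (mem_translate.1 hx) _ h1
  rwa [Units.inv_mul_cancel_right] at this

lemma genIndex_translate (u : Rˣ) (U V : AddSubgroup R) :
    genIndex (translate u U) (translate u V) = genIndex U V := by
  rw [translate_eq_map, translate_eq_map, genIndex_map (AddEquiv.injective _)]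

lemma euler_translate {Γ : AddSubgroup R} {u : Rˣ} (hu : translate u Γ = Γ) (U : AddSubgroup R) :
    euler Γ (translate u U) = euler Γ U := by
  rw [translate_eq_map] at hu ⊢
  exact euler_map _ hu U

open scoped WithZero in
lemma exists_basis_translate {K : Type*} [Field K] {v : Valuation K ℤᵐ⁰} {ι : Type*} [Fintype ι]
    [Algebra K R] (b : Module.Basis ι K R) (u : Rˣ) :
    ∃ b' : Module.Basis ι K R, basisLattice v b' = translate u (basisLattice v b) :=
  let e : R ≃ₗ[K] R :=
    { LinearMap.mulRight K (u : R) with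
      invFun := fun x => x * ((u⁻¹ : Rˣ) : R)
      left_inv := fun x => Units.mul_inv_cancel_right x u
      right_inv := fun x => Units.inv_mul_cancel_right x u }
  ⟨b.map e, rfl⟩

end Translate

/-! ### Indices and Euler characteristics of lattice families, and the product formula. -/

section BoxIndex

open WithZero
open scoped WithZero Valued

lemma relIndex_eq_of_fiber {G H : Type*} [AddCommGroup G] [AddCommGroup H] {f : G →+ H}
    {U V : AddSubgroup G} {A B : AddSubgroup H} (hU : ∀ x ∈ V, x ∈ U ↔ f x ∈ A)
    (hV : V.map f = B) : U.relIndex V = A.relIndex B := by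
  have h : U ⊓ V = A.comap f ⊓ V := by
    ext x
    simp only [AddSubgroup.mem_inf, AddSubgroup.mem_comap]
    exact and_congr_left fun hx => hU x hx
  rw [← AddSubgroup.inf_relIndex_right, h, AddSubgroup.inf_relIndex_right,
    AddSubgroup.relIndex_comap, hV]

variable {k : Type*} [Field k] {D : Type*} [DivisionRing D] [Algebra (RatFunc k) D]

/-- The component at a finite place of a unit. -/
def unitAt (v : FinitePlace k) : GAdele k D →* GAt D v :=
  Units.map ((compAt v : Adele k ⊗[RatFunc k] D →ₐ[RatFunc k] AlgAt D v) :
    Adele k ⊗[RatFunc k] D →* AlgAt D v)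

/-- The component at infinity of a unit. -/
def unitInfty : GAdele k D →* GInfty k D :=
  Units.map ((compInfty : Adele k ⊗[RatFunc k] D →ₐ[RatFunc k] AlgInfty k D) :
    Adele k ⊗[RatFunc k] D →* AlgInfty k D)

lemma box_translate (u : GAdele k D) (Ei : AddSubgroup (AlgInfty k D))
    (E : ∀ v : FinitePlace k, AddSubgroup (AlgAt D v)) :
    box (translate (unitInfty u) Ei) (fun v => translate (unitAt v u) (E v)) =
      translate u (box Ei E) := by
  ext x
  rw [mem_box, mem_translate (U := box Ei E), mem_box, map_mul]
  refine and_congr Iff.rfl (forall_congr' fun v => ?_)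
  rw [map_mul]
  exact Iff.rfl

lemma translate_diag (d : Dˣ) : translate (diag k D d) (globalPoints k D) = globalPoints k D := by
  ext x
  constructor
  · rintro ⟨y, hy⟩
    refine ⟨y * d, ?_⟩
    change (1 : Adele k) ⊗ₜ[RatFunc k] y = x * ((diag k D d)⁻¹ : GAdele k D) at hy
    change (1 : Adele k) ⊗ₜ[RatFunc k] (y * (d : D)) = x
    rw [← (Units.eq_mul_inv_iff_mul_eq _).1 hy]
    change _ = (1 : Adele k) ⊗ₜ[RatFunc k] y * (1 : Adele k) ⊗ₜ[RatFunc k] (d : D)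
    rw [Algebra.TensorProduct.tmul_mul_tmul, one_mul]
  · rintro ⟨y, rfl⟩
    refine ⟨y * ((d⁻¹ : Dˣ) : D), ?_⟩
    rw [← map_inv]
    change (1 : Adele k) ⊗ₜ[RatFunc k] (y * ((d⁻¹ : Dˣ) : D)) =
      (1 : Adele k) ⊗ₜ[RatFunc k] y * (1 : Adele k) ⊗ₜ[RatFunc k] ((d⁻¹ : Dˣ) : D)
    rw [Algebra.TensorProduct.tmul_mul_tmul, one_mul]

variable [FiniteDimensional (RatFunc k) D]

/-- Only the component at `v` distinguishes the two boxes, and every element of the larger local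
group occurs, extended by 0 at the other places. -/
lemma relIndex_box_of_eq (v : FinitePlace k) {Ei : AddSubgroup (AlgInfty k D)}
    {E E' : ∀ v : FinitePlace k, AddSubgroup (AlgAt D v)} (h : ∀ w ≠ v, E w = E' w) :
    (box Ei E).relIndex (box Ei E') = (E v).relIndex (E' v) := by
  classical
  refine relIndex_eq_of_fiber
    (f := (compAt v : Adele k ⊗[RatFunc k] D →ₐ[RatFunc k] AlgAt D v).toAddMonoidHom) ?_ ?_
  · intro x hx
    rw [mem_box] at hx ⊢
    refine ⟨fun hx' => hx'.2 v, fun hv => ⟨hx.1, fun w => ?_⟩⟩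
    rcases eq_or_ne w v with rfl | hw
    · exact hv
    · rw [h w hw]
      exact hx.2 w
  · refine le_antisymm ?_ fun y hy => ?_
    · rintro _ ⟨x, hx, rfl⟩
      exact (mem_box.1 hx).2 v
    · obtain ⟨x, hxi, hx⟩ := exists_of_repr (k := k) (D := D) 0 (Pi.single v y) (by
        rw [Filter.eventually_cofinite]
        refine (Set.finite_singleton v).subset fun w hw => ?_
        by_contra hne
        refine hw ?_
        rw [Pi.single_eq_of_ne hne]
        exact zero_mem _)
      refine ⟨x, mem_box.2 ⟨by rw [hxi]; exact zero_mem _, fun w => ?_⟩, ?_⟩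
      · rw [hx]
        rcases eq_or_ne w v with rfl | hw
        · rwa [Pi.single_eq_same]
        · rw [Pi.single_eq_of_ne hw]
          exact zero_mem _
      · change compAt v x = y
        rw [hx, Pi.single_eq_same]

lemma relIndex_box_infty (Ei Ei' : AddSubgroup (AlgInfty k D))
    (E : ∀ v : FinitePlace k, AddSubgroup (AlgAt D v)) :
    (box Ei E).relIndex (box Ei' E) = Ei.relIndex Ei' := by
  refine relIndex_eq_of_fiber
    (f := (compInfty : Adele k ⊗[RatFunc k] D →ₐ[RatFunc k] AlgInfty k D).toAddMonoidHom) ?_ ?_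
  · intro x hx
    rw [mem_box] at hx ⊢
    exact ⟨fun hx' => hx'.1, fun hv => ⟨hv, hx.2⟩⟩
  · refine le_antisymm ?_ fun y hy => ?_
    · rintro _ ⟨x, hx, rfl⟩
      exact (mem_box.1 hx).1
    · obtain ⟨x, hxi, hx⟩ := exists_of_repr (k := k) (D := D) y 0
        (Filter.Eventually.of_forall fun v => zero_mem _)
      exact ⟨x, mem_box.2 ⟨by rwa [hxi], fun w => by rw [hx]; exact zero_mem _⟩, hxi⟩

/-- The lattices are changed at one place at a time. -/
lemma box_index_finset {Ei : AddSubgroup (AlgInfty k D)}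
    {E' : ∀ v : FinitePlace k, AddSubgroup (AlgAt D v)} (T : Finset (FinitePlace k)) :
    ∀ E : ∀ v : FinitePlace k, AddSubgroup (AlgAt D v), (∀ v, (E v).Commensurable (E' v)) →
      (∀ v ∉ T, E v = E' v) → (box Ei E).Commensurable (box Ei E') ∧
        genIndex (box Ei E) (box Ei E') = ∏ v ∈ T, genIndex (E v) (E' v) := by
  classical
  induction T using Finset.induction_on with
  | empty =>
    intro E _ h
    obtain rfl : E = E' := funext fun v => h v (by simp)
    exact ⟨AddSubgroup.Commensurable.refl _, by rw [genIndex_self, Finset.prod_empty]⟩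
  | insert v T hv ih =>
    intro E hc h
    have hv1 : Function.update E v (E' v) v = E' v := Function.update_self ..
    have hw1 : ∀ w ≠ v, Function.update E v (E' v) w = E w := fun w hw =>
      Function.update_of_ne hw ..
    obtain ⟨h1, h2⟩ := ih (Function.update E v (E' v)) (fun w => by
        rcases eq_or_ne w v with rfl | hw
        · rw [hv1]
        · rw [hw1 w hw]
          exact hc w) fun w hw => by
        rcases eq_or_ne w v with rfl | hne
        · rw [hv1]
        · rw [hw1 w hne]
          exact h w (by simp [hne, hw])
    have h3 := relIndex_box_of_eq (Ei := Ei) v fun w hw => (hw1 w hw).symm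
    have h4 := relIndex_box_of_eq (Ei := Ei) v fun w hw => hw1 w hw
    rw [hv1] at h3 h4
    have h5 : (box Ei E).Commensurable (box Ei (Function.update E v (E' v))) := by
      rw [AddSubgroup.Commensurable, h3, h4]
      exact hc v
    refine ⟨h5.trans h1, ?_⟩
    rw [← genIndex_mul h5 h1, h2, Finset.prod_insert hv, genIndex, h3, h4, genIndex]
    congr 1
    refine Finset.prod_congr rfl fun w hw => ?_
    rw [hw1 w (by rintro rfl; exact hv hw)]

/-- A family of lattices, one at each place, almost all of them standard. -/
structure IsLatticeFamily (Ei : AddSubgroup (AlgInfty k D))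
    (E : ∀ v : FinitePlace k, AddSubgroup (AlgAt D v)) : Prop where
  exists_basis_infty : ∃ b : Module.Basis (Fin (Module.finrank (RatFunc k) D)) (CompletionInfty k)
    (AlgInfty k D), basisLattice (valInfty k) b = Ei
  exists_basis : ∀ v, ∃ b : Module.Basis (Fin (Module.finrank (RatFunc k) D)) (CompletionAt v)
    (AlgAt D v), basisLattice (valAt v) b = E v
  eventually_eq : ∀ᶠ v in Filter.cofinite, E v = stdAt D v

lemma isLatticeFamily_std : IsLatticeFamily (stdInfty k D) (stdAt D) :=
  ⟨⟨_, rfl⟩, fun _ => ⟨_, rfl⟩, Filter.Eventually.of_forall fun _ => rfl⟩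

section Finite

variable [Finite k] {Ei Ei' : AddSubgroup (AlgInfty k D)}
variable {E E' : ∀ v : FinitePlace k, AddSubgroup (AlgAt D v)}

lemma IsLatticeFamily.commensurable_infty (h : IsLatticeFamily Ei E) (h' : IsLatticeFamily Ei' E') :
    Ei.Commensurable Ei' := by
  obtain ⟨b, rfl⟩ := h.exists_basis_infty
  obtain ⟨b', rfl⟩ := h'.exists_basis_infty
  exact commensurable_basisLattice isDiscreteWithCard_infty b b'

lemma IsLatticeFamily.commensurable (h : IsLatticeFamily Ei E) (h' : IsLatticeFamily Ei' E')
    (v : FinitePlace k) : (E v).Commensurable (E' v) := by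
  obtain ⟨b, hb⟩ := h.exists_basis v
  obtain ⟨b', hb'⟩ := h'.exists_basis v
  rw [← hb, ← hb']
  exact commensurable_basisLattice (isDiscreteWithCard_at v) b b'

omit [Finite k] in
lemma IsLatticeFamily.finite_mulSupport (h : IsLatticeFamily Ei E) (h' : IsLatticeFamily Ei' E') :
    (Function.mulSupport fun v => genIndex (E v) (E' v)).Finite := by
  refine (Filter.eventually_cofinite.1 (h.eventually_eq.and h'.eventually_eq)).subset ?_
  intro v hv hcon
  refine hv ?_
  change genIndex (E v) (E' v) = 1
  rw [hcon.1, hcon.2, genIndex_self]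

lemma IsLatticeFamily.index_box (h : IsLatticeFamily Ei E) (h' : IsLatticeFamily Ei' E') :
    (box Ei E).Commensurable (box Ei' E') ∧ genIndex (box Ei E) (box Ei' E') =
      genIndex Ei Ei' * ∏ᶠ v, genIndex (E v) (E' v) := by
  have hfin : {v | ¬ E v = E' v}.Finite := by
    refine (Filter.eventually_cofinite.1 (h.eventually_eq.and h'.eventually_eq)).subset ?_
    exact fun v hv hcon => hv (hcon.1.trans hcon.2.symm)
  obtain ⟨h1, h2⟩ := box_index_finset (Ei := Ei) hfin.toFinset E (h.commensurable h')
    fun v hv => by simpa using hv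
  have h3 : (box Ei E').Commensurable (box Ei' E') := by
    rw [AddSubgroup.Commensurable, relIndex_box_infty, relIndex_box_infty]
    exact h.commensurable_infty h'
  refine ⟨h1.trans h3, ?_⟩
  rw [← genIndex_mul h1 h3, h2, _root_.mul_comm, genIndex, relIndex_box_infty, relIndex_box_infty, genIndex]
  congr 1
  refine (finprod_eq_prod_of_mulSupport_subset _ fun v hv => ?_).symm
  simp only [Set.Finite.coe_toFinset]
  intro hcon
  refine hv ?_
  change genIndex (E v) (E' v) = 1
  rw [hcon, genIndex_self]

lemma IsLatticeFamily.isBounded (h : IsLatticeFamily Ei E) :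
    IsBounded (globalPoints k D) (box Ei E) :=
  isBounded_std.of_commensurable (h.index_box isLatticeFamily_std).1

lemma IsLatticeFamily.euler_box (h : IsLatticeFamily Ei E) (h' : IsLatticeFamily Ei' E') :
    euler (globalPoints k D) (box Ei E) =
      genIndex Ei Ei' * (∏ᶠ v, genIndex (E v) (E' v)) * euler (globalPoints k D) (box Ei' E') := by
  rw [euler_eq (h.index_box h').1 h'.isBounded, (h.index_box h').2]

omit [Finite k] in
-- At almost all places `u` and `u⁻¹` lie in the local lattice, which is closed under products
-- there; so translation by `u` leaves it unchanged.
lemma IsLatticeFamily.translate (h : IsLatticeFamily Ei E)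
    (hmul : ∀ᶠ v in Filter.cofinite, ∀ x ∈ E v, ∀ y ∈ E v, x * y ∈ E v) (u : GAdele k D) :
    IsLatticeFamily (translate (unitInfty u) Ei) fun v => translate (unitAt v u) (E v) := by
  refine ⟨?_, fun v => ?_, ?_⟩
  · obtain ⟨b, rfl⟩ := h.exists_basis_infty
    exact exists_basis_translate b _
  · obtain ⟨b, hb⟩ := h.exists_basis v
    rw [← hb]
    exact exists_basis_translate b _
  · filter_upwards [h.eventually_eq, hmul, eventually_compAt_mem (u : Adele k ⊗[RatFunc k] D),
      eventually_compAt_mem ((u⁻¹ : GAdele k D) : Adele k ⊗[RatFunc k] D)] with v h1 h2 h3 h4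
    rw [← h1] at h3 h4 ⊢
    refine translate_eq_self h2 h3 ?_
    rw [← map_inv]
    exact h4

omit [FiniteDimensional (RatFunc k) D] [Finite k] in
lemma translate_algebraMap {L : Type*} [Field L] [Algebra (RatFunc k) L] {f : RatFunc k}
    {u : (L ⊗[RatFunc k] D)ˣ} (hu : ((u⁻¹ : (L ⊗[RatFunc k] D)ˣ) : L ⊗[RatFunc k] D) =
      1 ⊗ₜ algebraMap (RatFunc k) D f) (U : AddSubgroup (L ⊗[RatFunc k] D)) :
    translate u U = scaleDown (algebraMap (RatFunc k) L f) U := by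
  ext x
  rw [mem_translate, mem_scaleDown, hu]
  have : (1 : L) ⊗ₜ[RatFunc k] algebraMap (RatFunc k) D f =
      algebraMap L (L ⊗[RatFunc k] D) (algebraMap (RatFunc k) L f) := by
    rw [Algebra.TensorProduct.algebraMap_apply, Algebra.algebraMap_self, RingHom.id_apply,
      Algebra.algebraMap_eq_smul_one f, Algebra.algebraMap_eq_smul_one f, TensorProduct.tmul_smul,
      TensorProduct.smul_tmul']
  rw [this, ← Algebra.commutes, Algebra.smul_def]

omit [Finite k] in
variable (k) in
lemma finite_setOf_val_ne_one {f : RatFunc k} (hf : f ≠ 0) :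
    {v : FinitePlace k | ¬ valAt v (algebraMap _ _ f) = 1}.Finite := by
  have h : ∀ g : RatFunc k, ∀ᶠ v : FinitePlace k in Filter.cofinite,
      valAt v (algebraMap _ _ g) ≤ 1 := fun g => (algebraMap (RatFunc k) (Adele k) g).2.2
  refine Filter.eventually_cofinite.1 ?_
  filter_upwards [h f, h f⁻¹] with v h1 h2
  rw [map_inv₀, map_inv₀, inv_le_one₀ (by
    rw [zero_lt_iff, Valuation.ne_zero_iff]; simpa using hf)] at h2
  exact le_antisymm h1 h2

omit [Finite k] in
lemma finite_mulSupport_absValue {f : RatFunc k} (hf : f ≠ 0) :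
    (Function.mulSupport fun v : FinitePlace k =>
      absValue (placeCard v) (valAt v (algebraMap _ _ f))).Finite := by
  refine (finite_setOf_val_ne_one k hf).subset fun v hv h => hv ?_
  change absValue _ _ = 1
  rw [h, absValue_one]

/-- Translation by the scalar `f⁻¹` preserves the Euler characteristic, while the local indices
multiply to the inverse of the `N`-th power of the product of the absolute values of `f`. The
product is nonnegative, so the `N`-th root is unambiguous. -/
lemma IsLatticeFamily.productFormula (h : IsLatticeFamily Ei E)
    (hmul : ∀ᶠ v in Filter.cofinite, ∀ x ∈ E v, ∀ y ∈ E v, x * y ∈ E v) {f : RatFunc k}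
    (hf : f ≠ 0) : absValue (Nat.card k) (valInfty k (algebraMap _ _ f)) *
      ∏ᶠ v : FinitePlace k, absValue (placeCard v) (valAt v (algebraMap _ _ f)) = 1 := by
  let d : Dˣ := Units.map (algebraMap (RatFunc k) D : RatFunc k →* D) (Units.mk0 f hf)
  -- The inverse is taken so that the translate becomes `scaleDown` by `f` itself.
  let u : GAdele k D := diag k D d⁻¹
  have hu := h.translate hmul u
  have h1 := hu.euler_box h
  rw [box_translate, euler_translate (translate_diag _)] at h1
  have h2 := mul_right_cancel₀ (euler_pos h.isBounded).ne' ((one_mul _).trans h1)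
  have hf' : ∀ (L : Type _) [Field L] [Algebra (RatFunc k) L], algebraMap (RatFunc k) L f ≠ 0 := by
    intro L _ _
    simpa using hf
  set N := Module.finrank (RatFunc k) D with hN
  have hi : genIndex (KappaMap.translate (unitInfty u) Ei) Ei *
      absValue (Nat.card k) (valInfty k (algebraMap _ _ f)) ^ N = 1 := by
    obtain ⟨b, rfl⟩ := h.exists_basis_infty
    have hui : (((unitInfty u)⁻¹ : GInfty k D) : AlgInfty k D) = (1 : CompletionInfty k) ⊗ₜ[RatFunc k]
        algebraMap (RatFunc k) D f := by
      rw [← map_inv, ← map_inv, inv_inv]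
      exact compInfty_global (d : D)
    rw [translate_algebraMap hui]
    have := (genIndex_scaleDown_self isDiscreteWithCard_infty
      (hf' (CompletionInfty k)) b (AddSubgroup.Commensurable.refl _)).2
    rwa [Fintype.card_fin] at this
  have hv : ∀ v, genIndex (KappaMap.translate (unitAt v u) (E v)) (E v) *
      absValue (placeCard v) (valAt v (algebraMap _ _ f)) ^ N = 1 := by
    intro v
    obtain ⟨b, hb⟩ := h.exists_basis v
    have hui : (((unitAt v u)⁻¹ : GAt D v) : AlgAt D v) = (1 : CompletionAt v) ⊗ₜ[RatFunc k]
        algebraMap (RatFunc k) D f := by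
      rw [← map_inv, ← map_inv, inv_inv]
      exact compAt_global v (d : D)
    rw [translate_algebraMap hui, ← hb]
    have := (genIndex_scaleDown_self (isDiscreteWithCard_at v)
      (hf' (CompletionAt v)) b (AddSubgroup.Commensurable.refl _)).2
    rwa [Fintype.card_fin] at this
  have h3 : (absValue (Nat.card k) (valInfty k (algebraMap _ _ f)) *
      ∏ᶠ v : FinitePlace k, absValue (placeCard v) (valAt v (algebraMap _ _ f))) ^ N = 1 := by
    rw [mul_pow, finprod_pow (finite_mulSupport_absValue hf)]
    have h4 : (∏ᶠ v, genIndex (KappaMap.translate (unitAt v u) (E v)) (E v)) *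
        ∏ᶠ v : FinitePlace k, absValue (placeCard v) (valAt v (algebraMap _ _ f)) ^ N = 1 := by
      rw [← finprod_mul_distrib (hu.finite_mulSupport h)
        ((finite_mulSupport_absValue hf).subset fun v hv h => hv (by
          change absValue _ _ ^ N = 1
          rw [show absValue (placeCard v) (valAt v (algebraMap _ _ f)) = 1 from h, one_pow]))]
      simp only [hv, finprod_one]
    calc _ = (genIndex (KappaMap.translate (unitInfty u) Ei) Ei *
          ∏ᶠ v, genIndex (KappaMap.translate (unitAt v u) (E v)) (E v)) *
        (absValue (Nat.card k) (valInfty k (algebraMap _ _ f)) ^ N *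
          ∏ᶠ v : FinitePlace k, absValue (placeCard v) (valAt v (algebraMap _ _ f)) ^ N) := by
            rw [← h2, one_mul]
      _ = (genIndex (KappaMap.translate (unitInfty u) Ei) Ei *
          absValue (Nat.card k) (valInfty k (algebraMap _ _ f)) ^ N) *
        ((∏ᶠ v, genIndex (KappaMap.translate (unitAt v u) (E v)) (E v)) *
          ∏ᶠ v : FinitePlace k, absValue (placeCard v) (valAt v (algebraMap _ _ f)) ^ N) := by ring
      _ = 1 := by rw [hi, h4, one_mul]
  have hN0 : N ≠ 0 := Module.finrank_pos.ne'
  refine (pow_eq_one_iff_of_nonneg (mul_nonneg ?_ (finprod_nonneg fun v => ?_)) hN0).1 h3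
  · exact (absValue_pos Nat.card_pos.ne' ((Valuation.ne_zero_iff _).2 (hf' _))).le
  · exact (absValue_pos (isDiscreteWithCard_at v).ne_zero ((Valuation.ne_zero_iff _).2 (hf' _))).le

end Finite

end BoxIndex


/-! ### Integral matrices at the unramified places. -/

section MatrixOrder

open WithZero
open scoped WithZero

variable {K : Type*} [Field K] (v : Valuation K ℤᵐ⁰) {A : Type*} [Ring A] [Algebra K A] {n : ℕ}

/-- The order of all elements which become integral matrices under a given isomorphism. -/
def matrixOrder (ψ : A ≃ₐ[K] Matrix (Fin n) (Fin n) K) : AddSubgroup A :=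
  ((ball v 1).matrix : AddSubgroup (Matrix (Fin n) (Fin n) K)).comap
    (ψ : A →+ Matrix (Fin n) (Fin n) K)

variable {v} {ψ : A ≃ₐ[K] Matrix (Fin n) (Fin n) K}

lemma mem_matrixOrder {x : A} : x ∈ matrixOrder v ψ ↔ ∀ i j, v (ψ x i j) ≤ 1 := Iff.rfl

lemma one_mem_matrixOrder : 1 ∈ matrixOrder v ψ := by
  intro i j
  change v (ψ 1 i j) ≤ 1
  rw [map_one, Matrix.one_apply]
  split_ifs <;> simp

lemma mul_mem_matrixOrder {x y : A} (hx : x ∈ matrixOrder v ψ) (hy : y ∈ matrixOrder v ψ) :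
    x * y ∈ matrixOrder v ψ := by
  intro i j
  change v (ψ (x * y) i j) ≤ 1
  rw [map_mul, Matrix.mul_apply]
  refine v.map_sum_le fun k _ => ?_
  rw [map_mul]
  exact mul_le_one' (hx i k) (hy k j)

lemma exists_basis_matrixOrder {N : ℕ} (hN : Module.finrank K A = N) :
    ∃ b : Module.Basis (Fin N) K A, basisLattice v b = matrixOrder v ψ := by
  let β : Module.Basis Unit K K := Module.Basis.singleton Unit K
  have hβ : basisLattice v β = ball v 1 := by
    ext x
    simp [mem_basisLattice, β, mem_ball]
  refine ⟨((β.matrix (Fin n) (Fin n)).map ψ.symm.toLinearEquiv).reindex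
    (Fintype.equivFinOfCardEq ?_), ?_⟩
  · rw [← hN, ψ.toLinearEquiv.finrank_eq, Module.finrank_matrix]
    simp
  · rw [basisLattice_reindex, matrixOrder, ← hβ, ← basisLattice_matrix]
    rfl

/-- Here `l` is `c` times the trace, for which integral matrices are self-dual, so the dual is the
order scaled by `c⁻¹`. Evaluating the Frobenius relation at the idempotent matrix unit gives `γ * c
^ (p - 1) = 1`. -/
lemma genIndex_dualLattice_matrixOrder {q : ℕ} (hv : IsDiscreteWithCard v q) [NeZero n] {p : ℕ}
    (hp : p ≠ 0) {l : A →ₗ[K] K} (h0 : l ≠ 0) (hl : ∀ x y, l (x * y) = l (y * x)) {γ : K}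
    (hγ : ∀ x, l (x ^ p) = γ * l x ^ p) :
    genIndex (dualLattice v l (matrixOrder v ψ)) (matrixOrder v ψ) ^ (p - 1) =
      absValue q (v γ) ^ Module.finrank K A := by
  let l' : Matrix (Fin n) (Fin n) K →ₗ[K] K := l ∘ₗ ψ.symm.toLinearMap
  have hl' : ∀ X Y, l' (X * Y) = l' (Y * X) := fun X Y => by
    change l (ψ.symm (X * Y)) = l (ψ.symm (Y * X))
    rw [map_mul ψ.symm, map_mul ψ.symm, hl]
  have hl'ψ : ∀ x, l' (ψ x) = l x := fun x => congrArg l (ψ.symm_apply_apply x)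
  set c := l' (Matrix.single 0 0 1) with hc
  have hμ : ∀ x : K, l' (Matrix.single 0 0 x) = c * x := by
    intro x
    rw [hc, _root_.mul_comm, ← smul_eq_mul, ← map_smul, Matrix.smul_single, smul_eq_mul, mul_one]
  have hsum : ∀ X, l' X = c * ∑ i, X i i := by
    intro X
    rw [eq_sum_diag_of_central l' hl', Finset.mul_sum]
    exact Finset.sum_congr rfl fun i _ => hμ _
  have hc0 : c ≠ 0 := by
    intro hc0
    refine h0 (LinearMap.ext fun x => ?_)
    rw [← hl'ψ, hsum, hc0, zero_mul, LinearMap.zero_apply]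
  have hγc : γ * c ^ (p - 1) = 1 := by
    have h1 : (Matrix.single 0 0 1 : Matrix (Fin n) (Fin n) K) ^ p = Matrix.single 0 0 1 := by
      have : ∀ i : ℕ, (Matrix.single 0 0 1 : Matrix (Fin n) (Fin n) K) ^ (i + 1) =
          Matrix.single 0 0 1 := by
        intro i
        induction i with
        | zero => simp
        | succ i ih => rw [pow_succ, ih, Matrix.single_mul_single_same, mul_one]
      obtain ⟨i, rfl⟩ := Nat.exists_eq_succ_of_ne_zero hp
      exact this i
    have h2 : c = γ * c ^ p := by
      conv_lhs => rw [hc, ← h1]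
      change l (ψ.symm _) = γ * l (ψ.symm _) ^ p
      rw [map_pow, hγ]
    rw [← Nat.sub_add_cancel (Nat.one_le_iff_ne_zero.2 hp), pow_succ, ← mul_assoc] at h2
    exact mul_right_cancel₀ hc0 (h2.symm.trans (one_mul c).symm)
  have hdual : dualLattice v l (matrixOrder v ψ) = scaleDown c (matrixOrder v ψ) := by
    ext x
    rw [mem_scaleDown, mem_matrixOrder]
    constructor
    · intro hx i j
      have h1 := hx (ψ.symm (Matrix.single j i 1)) (by
        intro a b
        change v (ψ (ψ.symm _) a b) ≤ 1
        rw [ψ.apply_symm_apply, Matrix.single_apply]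
        split_ifs <;> simp)
      rw [← hl'ψ, map_mul, ψ.apply_symm_apply, hsum] at h1
      rw [map_smul, Matrix.smul_apply, smul_eq_mul]
      have h2 : ∑ a, (ψ x * Matrix.single j i (1 : K) : Matrix (Fin n) (Fin n) K) a a = ψ x i j := by
        change Matrix.trace _ = _
        rw [Matrix.trace_mul_single, MulOpposite.op_one, one_smul]
      rwa [h2] at h1
    · intro hx y hy
      rw [← hl'ψ, map_mul, hsum, Finset.mul_sum]
      refine v.map_sum_le fun i _ => ?_
      rw [Matrix.mul_apply, Finset.mul_sum]
      refine v.map_sum_le fun j _ => ?_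
      rw [← mul_assoc, map_mul]
      refine mul_le_one' ?_ (hy j i)
      have := hx i j
      rwa [map_smul, Matrix.smul_apply, smul_eq_mul] at this
  obtain ⟨b, hb⟩ := exists_basis_matrixOrder (v := v) (ψ := ψ) rfl
  have h1 := (genIndex_scaleDown_self hv hc0 b
    (AddSubgroup.Commensurable.refl (basisLattice v b))).2
  rw [hdual, ← hb]
  rw [Fintype.card_fin] at h1
  have h2 : absValue q (v γ) * absValue q (v c) ^ (p - 1) = 1 := by
    rw [← absValue_pow hv.ne_zero, ← absValue_mul hv.ne_zero, ← map_pow, ← map_mul, hγc, map_one,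
      absValue_one]
  set N := Module.finrank K A
  have h3 : absValue q (v c) ^ (N * (p - 1)) ≠ 0 :=
    pow_ne_zero _ (absValue_pos hv.ne_zero ((Valuation.ne_zero_iff _).2 hc0)).ne'
  refine mul_right_cancel₀ h3 ?_
  rw [pow_mul, ← mul_pow, h1, one_pow, ← pow_mul, Nat.mul_comm, pow_mul, ← mul_pow, h2, one_pow]

end MatrixOrder


/-! ### The bundle of maximal orders and its Euler characteristic. -/

section GlobalOrder

open WithZero
open scoped WithZero Valued

variable {k : Type*} [Field k] {D : Type*} [DivisionRing D] [Algebra (RatFunc k) D] {n : ℕ}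

open Classical in
/-- The family of orders given by integral matrices at the places other than `0`, and by `O` at
`0`. -/
def orderFamily (φ : Identifications k D n) (O : AddSubgroup (AlgAt D (idealX k))) :
    ∀ v : FinitePlace k, AddSubgroup (AlgAt D v) :=
  -- The value `⊤` is a filler at `0`, overwritten by `O`.
  Function.update (fun v => if hv : v ≠ idealX k then matrixOrder (valAt v) (φ v hv) else ⊤)
    (idealX k) O

variable {φ : Identifications k D n} {O : AddSubgroup (AlgAt D (idealX k))}
variable {Oi : AddSubgroup (AlgInfty k D)}

open Classical in
lemma orderFamily_zero : orderFamily φ O (idealX k) = O := Function.update_self ..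

open Classical in
lemma orderFamily_of_ne {v : FinitePlace k} (hv : v ≠ idealX k) :
    orderFamily φ O v = matrixOrder (valAt v) (φ v hv) := by
  rw [orderFamily, Function.update_of_ne hv, dif_pos hv]

variable {q p r₀ r : ℕ} {J : AddSubgroup (AlgAt D (idealX k))} {Ji : AddSubgroup (AlgInfty k D)}
variable (h₀ : IsLocalOrder (valAt (idealX k)) q p n r₀ O J)
variable (hi : IsLocalOrder (valInfty k) q p n r Oi Ji)

include h₀

lemma mul_mem_orderFamily (v : FinitePlace k) {x y : AlgAt D v} (hx : x ∈ orderFamily φ O v)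
    (hy : y ∈ orderFamily φ O v) : x * y ∈ orderFamily φ O v := by
  by_cases hv : v = idealX k
  · subst hv
    rw [orderFamily_zero] at hx hy ⊢
    exact h₀.mul_mem x hx y hy
  · rw [orderFamily_of_ne hv] at hx hy ⊢
    exact mul_mem_matrixOrder hx hy

lemma one_mem_orderFamily (v : FinitePlace k) : (1 : AlgAt D v) ∈ orderFamily φ O v := by
  by_cases hv : v = idealX k
  · subst hv
    rw [orderFamily_zero]
    exact h₀.one_mem
  · rw [orderFamily_of_ne hv]
    exact one_mem_matrixOrder

include hi

lemma one_mem_orderBox : (1 : Adele k ⊗[RatFunc k] D) ∈ box Oi (orderFamily φ O) := by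
  refine mem_box.2 ⟨?_, fun v => ?_⟩
  · rw [map_one]
    exact hi.one_mem
  · rw [map_one]
    exact one_mem_orderFamily h₀ v

lemma mul_mem_orderBox {x y : Adele k ⊗[RatFunc k] D} (hx : x ∈ box Oi (orderFamily φ O))
    (hy : y ∈ box Oi (orderFamily φ O)) : x * y ∈ box Oi (orderFamily φ O) := by
  rw [mem_box] at *
  refine ⟨?_, fun v => ?_⟩
  · rw [map_mul]
    exact hi.mul_mem _ hx.1 _ hy.1
  · rw [map_mul]
    exact mul_mem_orderFamily h₀ v (hx.2 v) (hy.2 v)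

variable [FiniteDimensional (RatFunc k) D] [Algebra.IsCentral (RatFunc k) D]

/-- By coherence almost all places have the basis of `D` integral as matrices, and
`eventually_repr_mem` conversely makes integral matrices have integral coordinates; there the order
equals the standard lattice. -/
lemma isLatticeFamily_order (hφ : IsCoherent φ) : IsLatticeFamily Oi (orderFamily φ O) := by
  have hcast : ∀ {L : Type _} [Field L] [Algebra (RatFunc k) L] {v : Valuation L ℤᵐ⁰}
      {U : AddSubgroup (L ⊗[RatFunc k] D)}, (∃ b : Module.Basis
        (Fin (Module.finrank L (L ⊗[RatFunc k] D))) L (L ⊗[RatFunc k] D), basisLattice v b = U) →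
      ∃ b : Module.Basis (Fin (Module.finrank (RatFunc k) D)) L (L ⊗[RatFunc k] D),
        basisLattice v b = U := by
    rintro L _ _ v U ⟨b, rfl⟩
    exact ⟨b.reindex (finCongr Module.finrank_baseChange), basisLattice_reindex _ _⟩
  refine ⟨hcast hi.exists_basis, fun v => ?_, ?_⟩
  · by_cases hv : v = idealX k
    · subst hv
      rw [orderFamily_zero]
      exact hcast h₀.exists_basis
    · rw [orderFamily_of_ne hv]
      exact exists_basis_matrixOrder Module.finrank_baseChange
  · have hX : ∀ᶠ v : FinitePlace k in Filter.cofinite, v ≠ idealX k := by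
      simp [Filter.eventually_cofinite]
    filter_upwards [hX, eventually_repr_mem hφ (stdBasis k D),
      Filter.eventually_all.2 fun i => hφ (stdBasis k D i)] with v h1 h2 h3
    rw [orderFamily_of_ne h1]
    refine le_antisymm (fun x hx => h2 h1 x hx) (basisLattice_le ?_ fun i => ?_)
    · intro c hc x hx i j
      change valAt v (φ v h1 (c • x) i j) ≤ 1
      rw [map_smul, Matrix.smul_apply, smul_eq_mul, map_mul]
      exact mul_le_one' hc (hx i j)
    · rw [Module.Basis.baseChange_apply]
      exact fun a b => h3 i h1 a b

omit h₀ hi [FiniteDimensional (RatFunc k) D] [Algebra.IsCentral (RatFunc k) D] in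
lemma finprod_pow_eq {ι : Type*} {a s c g : ι → ℚ} {m N : ℕ}
    (ha : (Function.mulSupport a).Finite) (hs : (Function.mulSupport s).Finite)
    (hc : (Function.mulSupport c).Finite) (hg : (Function.mulSupport g).Finite)
    (h : ∀ v, a v ^ (2 * m) = s v * c v ^ N * g v ^ m) :
    (∏ᶠ v, a v) ^ (2 * m) = (∏ᶠ v, s v) * (∏ᶠ v, c v) ^ N * (∏ᶠ v, g v) ^ m := by
  have hpow : ∀ {f : ι → ℚ} (j : ℕ), (Function.mulSupport f).Finite →
      (Function.mulSupport fun v => f v ^ j).Finite := fun j hf =>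
    hf.subset fun v hv h1 => hv (by simp only [h1, one_pow])
  rw [finprod_pow ha, finprod_pow hc, finprod_pow hg, ← finprod_mul_distrib hs (hpow N hc),
    ← finprod_mul_distrib _ (hpow m hg)]
  · exact finprod_congr h
  · exact (hs.union (hpow N hc)).subset (Function.mulSupport_mul _ _)

omit h₀ hi [FiniteDimensional (RatFunc k) D] in
-- The factor of the extended functional is determined by its value on one global `x` with `l x ≠
-- 0`, so the same `γ` serves at every place.
lemma extendFunctional_frobenius [FiniteDimensional (RatFunc k) D] (p : ℕ) [Fact p.Prime]
    [CharP k p] {l : D →ₗ[RatFunc k] RatFunc k} (hl0 : l ≠ 0) (hl : ∀ x y, l (x * y) = l (y * x))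
    {γ : RatFunc k} (hγ : ∀ x, l (x ^ p) = γ * l x ^ p) (L : Type*) [Field L]
    [Algebra (RatFunc k) L] :
    extendFunctional L l ≠ 0 ∧ ∀ y, extendFunctional L l (y ^ p) =
      algebraMap (RatFunc k) L γ * extendFunctional L l y ^ p := by
  have hF : CharP (RatFunc k) p := charP_of_injective_algebraMap (algebraMap k (RatFunc k)).injective p
  have hL : CharP L p := charP_of_injective_algebraMap (algebraMap (RatFunc k) L).injective p
  obtain ⟨x, hx⟩ : ∃ x, l x ≠ 0 := by
    by_contra! hcon
    exact hl0 (LinearMap.ext hcon)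
  have hx' : ∀ x, extendFunctional L l (1 ⊗ₜ x) = algebraMap _ L (l x) := fun x => by
    rw [extendFunctional_tmul, one_mul]
  have hx0 : algebraMap _ L (l x) ≠ 0 := by simpa using hx
  refine ⟨fun h => hx0 (by rw [← hx', h, LinearMap.zero_apply]), ?_⟩
  obtain ⟨c, -, hc⟩ := exists_frobenius_factor
    ((hasCoordinateOperators_of_divisionRing (K := RatFunc k) D).baseChange L) p
    (extendFunctional L l) (extendFunctional_mul_comm hl)
  have h1 := hc (1 ⊗ₜ x)
  rw [Algebra.TensorProduct.tmul_pow, one_pow, hx', hx', hγ, map_mul, map_pow] at h1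
  rwa [mul_right_cancel₀ (pow_ne_zero p hx0) h1]

/-- The standard family S has Euler characteristic `Q ^ N`, so that of the order family A follows
from the local indices [S : A]. The square of such an index is the index of A in its dual times the
absolute value of the global Gram determinant `g`. Raised to the power `m = p - 1`, the dual index
is an absolute value of the global `γ`, times an explicit power of `Q` at 0 and ∞. The contributions
of `g` and `γ` disappear by the product formula. -/
lemma euler_order_pow [Finite k] (hq : q = Nat.card k) [NeZero n] [Fact p.Prime] [CharP k p]
    (hφ : IsCoherent φ) :
    euler (globalPoints k D) (box Oi (orderFamily φ O)) ^ 2 = (q : ℚ) ^ ((r₀ + r) * n) := by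
  subst hq
  have hA := isLatticeFamily_order h₀ hi hφ
  have hmul : ∀ᶠ v in Filter.cofinite, ∀ x ∈ orderFamily φ O v, ∀ y ∈ orderFamily φ O v,
      x * y ∈ orderFamily φ O v :=
    Filter.Eventually.of_forall fun v x hx y hy => mul_mem_orderFamily h₀ v hx hy
  have hF : CharP (RatFunc k) p := charP_of_injective_algebraMap (algebraMap k (RatFunc k)).injective p
  have hD := hasCoordinateOperators_of_divisionRing (K := RatFunc k) D
  obtain ⟨l, hl0, hl⟩ := exists_central_functional hD
  obtain ⟨γ, hγ0, hγ⟩ := exists_frobenius_factor hD p l hl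
  have hγ0 := hγ0 hl0
  have hG := gram_det_ne_zero (stdBasis k D) hl0
  set g := (gram l (stdBasis k D)).det with hg
  set N := Module.finrank (RatFunc k) D with hN
  set m := p - 1 with hm
  have hp := (Fact.out : p.Prime)
  set Q : ℚ := (Nat.card k : ℚ) with hQ
  have hQ0 : Q ≠ 0 := by
    rw [hQ]
    exact_mod_cast Nat.card_pos.ne'
  have hgram : ∀ (L : Type _) [Field L] [Algebra (RatFunc k) L],
      (gram (extendFunctional L l) ((stdBasis k D).baseChange L)).det = algebraMap _ L g := by
    intro L _ _
    rw [gram_extendFunctional, hg, RingHom.map_det]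
    rfl
  have hgram0 : ∀ (L : Type _) [Field L] [Algebra (RatFunc k) L],
      (gram (extendFunctional L l) ((stdBasis k D).baseChange L)).det ≠ 0 := by
    intro L _ _
    rw [hgram]
    simpa using hG
  -- the place at infinity
  have hi2 : genIndex (stdInfty k D) Oi ^ (2 * m) = Q ^ (N * m) / Q ^ (r * n * m) *
      absValue (Nat.card k) (valInfty k (algebraMap _ _ γ)) ^ N *
      absValue (Nat.card k) (valInfty k (algebraMap _ _ g)) ^ m := by
    obtain ⟨b, hb⟩ := hA.exists_basis_infty
    have h1 := genIndex_dualLattice isDiscreteWithCard_infty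
      (extendFunctional (CompletionInfty k) l) ((stdBasis k D).baseChange _) b (hgram0 _)
    rw [hb, hgram] at h1
    obtain ⟨hne, hfr⟩ := extendFunctional_frobenius p hl0 hl hγ (CompletionInfty k)
    have h2 := hi.genIndex_dual _ hne (extendFunctional_mul_comm hl) _ hfr
    rw [Module.finrank_baseChange] at h2
    rw [pow_mul, stdInfty, ← h1, mul_pow]
    congr 1
    rw [div_mul_eq_mul_div, eq_div_iff (pow_ne_zero _ hQ0)]
    exact h2
  -- the finite places
  let s : FinitePlace k → ℚ := 
    Set.mulIndicator {idealX k} fun _ => Q ^ (N * m) / Q ^ (r₀ * n * m)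
  have hs₀ : s (idealX k) = Q ^ (N * m) / Q ^ (r₀ * n * m) :=
    Set.mulIndicator_of_mem (Set.mem_singleton _) _
  have hs₁ : ∀ v ≠ idealX k, s v = 1 := fun v hv =>
    Set.mulIndicator_of_notMem (by simpa using hv) _
  have hv2 : ∀ v, genIndex (stdAt D v) (orderFamily φ O v) ^ (2 * m) = s v *
      absValue (placeCard v) (valAt v (algebraMap _ _ γ)) ^ N *
      absValue (placeCard v) (valAt v (algebraMap _ _ g)) ^ m := by
    intro v
    obtain ⟨b, hb⟩ := hA.exists_basis v
    have h1 := genIndex_dualLattice (isDiscreteWithCard_at v)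
      (extendFunctional (CompletionAt v) l) ((stdBasis k D).baseChange _) b (hgram0 _)
    rw [hb, hgram] at h1
    obtain ⟨hne, hfr⟩ := extendFunctional_frobenius p hl0 hl hγ (CompletionAt v)
    rw [pow_mul, stdAt, ← h1, mul_pow]
    congr 1
    by_cases hv : v = idealX k
    · subst hv
      have h2 := h₀.genIndex_dual _ hne (extendFunctional_mul_comm hl) _ hfr
      rw [Module.finrank_baseChange] at h2
      rw [hs₀, orderFamily_zero, div_mul_eq_mul_div,
        eq_div_iff (pow_ne_zero _ hQ0)]
      rw [placeCard_eq (P := X) irreducible_X rfl, natDegree_X, pow_one]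
      exact h2
    · rw [hs₁ v hv, one_mul, orderFamily_of_ne hv,
        genIndex_dualLattice_matrixOrder (isDiscreteWithCard_at v) hp.ne_zero hne
          (extendFunctional_mul_comm hl) hfr, Module.finrank_baseChange]
  have hs : (Function.mulSupport s).Finite :=
    (Set.finite_singleton (idealX k)).subset Set.mulSupport_mulIndicator_subset
  have hsprod : ∏ᶠ v, s v = Q ^ (N * m) / Q ^ (r₀ * n * m) := by
    rw [finprod_eq_single s (idealX k) hs₁, hs₀]
  have hfin := finprod_pow_eq (isLatticeFamily_std.finite_mulSupport hA) hs
    (finite_mulSupport_absValue hγ0) (finite_mulSupport_absValue hG) hv2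
  have hE := isLatticeFamily_std.euler_box hA
  rw [euler_std] at hE
  set E := euler (globalPoints k D) (box Oi (orderFamily φ O)) with hEdef
  have hE0 : 0 < E := euler_pos hA.isBounded
  have hpγ := hA.productFormula hmul hγ0
  have hpg := hA.productFormula hmul hG
  -- After the product formula only the correction factors at 0 and ∞ remain.
  have hA2 : (genIndex (stdInfty k D) Oi *
      ∏ᶠ v, genIndex (stdAt D v) (orderFamily φ O v)) ^ (2 * m) =
      Q ^ (N * m) / Q ^ (r * n * m) * (Q ^ (N * m) / Q ^ (r₀ * n * m)) := by
    rw [mul_pow, hi2, hfin, hsprod]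
    calc _ = Q ^ (N * m) / Q ^ (r * n * m) * (Q ^ (N * m) / Q ^ (r₀ * n * m)) *
          (absValue (Nat.card k) (valInfty k (algebraMap _ _ γ)) *
            ∏ᶠ v : FinitePlace k, absValue (placeCard v) (valAt v (algebraMap _ _ γ))) ^ N *
          (absValue (Nat.card k) (valInfty k (algebraMap _ _ g)) *
            ∏ᶠ v : FinitePlace k, absValue (placeCard v) (valAt v (algebraMap _ _ g))) ^ m := by
          ring
      _ = _ := by rw [hpγ, hpg, one_pow, one_pow, mul_one, mul_one]
  have h3 : (E ^ 2) ^ m = (Q ^ ((r₀ + r) * n)) ^ m := by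
    have h4 : Q ^ (2 * (N * m)) = Q ^ (N * m) / Q ^ (r * n * m) *
        (Q ^ (N * m) / Q ^ (r₀ * n * m)) * (E ^ 2) ^ m := by
      rw [← hA2, ← pow_mul, ← mul_pow, ← hE, ← pow_mul]
      congr 1
      ring
    have h5 : Q ^ (N * m) ≠ 0 := pow_ne_zero _ hQ0
    have h6 : Q ^ (r * n * m) ≠ 0 := pow_ne_zero _ hQ0
    have h7 : Q ^ (r₀ * n * m) ≠ 0 := pow_ne_zero _ hQ0
    rw [two_mul, pow_add] at h4
    field_simp at h4
    rw [← h4]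
    ring
  have hm0 : m ≠ 0 := by
    have := hp.two_le
    omega
  exact (pow_left_inj₀ (by positivity) (by positivity) hm0).1 h3

end GlobalOrder


/-! ### Global sections of the order, and total ramification at 0 and ∞. -/

section CardinalityBound

open WithZero
open scoped WithZero Valued

variable (k : Type*) [Field k]

/-- The point `1` of the projective line. -/
def placeOne : FinitePlace k where
  asIdeal := Ideal.span {X - C 1}
  isPrime := by
    rw [Ideal.span_singleton_prime (X_sub_C_ne_zero 1)]
    exact prime_X_sub_C 1
  ne_bot := by
    rw [ne_eq, Ideal.span_singleton_eq_bot]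
    exact X_sub_C_ne_zero 1

lemma placeOne_ne : placeOne k ≠ idealX k := by
  intro h
  have h1 : (X - C 1 : k[X]) ∈ (idealX k).asIdeal := by
    rw [← h]
    exact Ideal.mem_span_singleton_self _
  rw [idealX_span, Ideal.mem_span_singleton, X_dvd_iff] at h1
  simp at h1

lemma placeCard_placeOne [Finite k] : placeCard (placeOne k) = Nat.card k := by
  rw [placeCard_eq (irreducible_X_sub_C (1 : k)) rfl, natDegree_X_sub_C, pow_one]

variable {k}
variable {D : Type*} [DivisionRing D] [Algebra (RatFunc k) D] {n : ℕ}
variable {φ : Identifications k D n} {O : AddSubgroup (AlgAt D (idealX k))}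
variable {Oi : AddSubgroup (AlgInfty k D)}
variable {q p r₀ r : ℕ} {J : AddSubgroup (AlgAt D (idealX k))} {Ji : AddSubgroup (AlgInfty k D)}
variable (h₀ : IsLocalOrder (valAt (idealX k)) q p n r₀ O J)
variable (hi : IsLocalOrder (valInfty k) q p n r Oi Ji)
variable [FiniteDimensional (RatFunc k) D] [Algebra.IsCentral (RatFunc k) D] [Finite k]

include h₀ hi

lemma finite_inf_orderBox (hφ : IsCoherent φ) :
    Finite ↥(globalPoints k D ⊓ box Oi (orderFamily φ O)) :=
  Nat.finite_of_card_ne_zero (isLatticeFamily_order h₀ hi hφ).isBounded.1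

/-- Right multiplication by `d` is injective on the finite ring of global sections, hence
surjective, and so reaches 1. -/
lemma inv_mem_orderBox (hφ : IsCoherent φ) {d : D} (hd0 : d ≠ 0)
    (hd : (1 : Adele k) ⊗ₜ d ∈ box Oi (orderFamily φ O)) :
    (1 : Adele k) ⊗ₜ d⁻¹ ∈ box Oi (orderFamily φ O) := by
  have hfin := finite_inf_orderBox h₀ hi hφ
  let f : ↥(globalPoints k D ⊓ box Oi (orderFamily φ O)) →
      ↥(globalPoints k D ⊓ box Oi (orderFamily φ O)) := fun x => ⟨x.1 * (1 : Adele k) ⊗ₜ d, by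
    obtain ⟨⟨y, hy⟩, hx⟩ := x.2
    refine ⟨⟨y * d, ?_⟩, mul_mem_orderBox h₀ hi hx hd⟩
    rw [← hy]
    change (1 : Adele k) ⊗ₜ[RatFunc k] (y * d) = (1 : Adele k) ⊗ₜ[RatFunc k] y * 1 ⊗ₜ d
    rw [Algebra.TensorProduct.tmul_mul_tmul, one_mul]⟩
  have hu : (1 : Adele k) ⊗ₜ[RatFunc k] d * (1 : Adele k) ⊗ₜ[RatFunc k] d⁻¹ = 1 := by
    rw [Algebra.TensorProduct.tmul_mul_tmul, one_mul, mul_inv_cancel₀ hd0,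
      Algebra.TensorProduct.one_def]
  have hf : Function.Injective f := fun x y hxy => by
    have h1 := congrArg (fun z => z.1 * (1 : Adele k) ⊗ₜ[RatFunc k] d⁻¹) hxy
    simp only [f, mul_assoc, hu, mul_one] at h1
    exact Subtype.ext h1
  obtain ⟨y, hy⟩ := Finite.injective_iff_surjective.1 hf
    ⟨1, ⟨1, rfl⟩, one_mem_orderBox h₀ hi⟩
  have h1 : y.1 * (1 : Adele k) ⊗ₜ[RatFunc k] d = 1 := congrArg Subtype.val hy
  have h2 : y.1 = (1 : Adele k) ⊗ₜ[RatFunc k] d⁻¹ := by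
    rw [← one_mul ((1 : Adele k) ⊗ₜ[RatFunc k] d⁻¹), ← h1, mul_assoc, hu, mul_one]
  rw [← h2]
  exact y.2.2

/-- Map a section to the residues of the first column of its matrix at the rational point 1. A
nonzero `d` in the kernel has an integral inverse, and then the corner entry of `d⁻¹ * d = 1` would
have value less than 1. -/
lemma card_inf_orderBox_le [NeZero n] (hφ : IsCoherent φ) :
    Nat.card ↥(globalPoints k D ⊓ box Oi (orderFamily φ O)) ≤ Nat.card k ^ n := by
  set v := placeOne k
  have hv : v ≠ idealX k := placeOne_ne k
  set B := ball (valAt v) 1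
  set H := (ball (valAt v) (exp (-1 : ℤ))).addSubgroupOf B
  have hcard : Nat.card (B ⧸ H) = Nat.card k := placeCard_placeOne k
  have hentry : ∀ x ∈ box Oi (orderFamily φ O), ∀ i, φ v hv (compAt v x) i 0 ∈ B := by
    intro x hx i
    have := (mem_box.1 hx).2 v
    rw [orderFamily_of_ne hv] at this
    exact this i 0
  let f : ↥(globalPoints k D ⊓ box Oi (orderFamily φ O)) → Fin n → B ⧸ H := fun x i =>
    QuotientAddGroup.mk ⟨_, hentry x.1 x.2.2 i⟩
  have hfin : Finite (B ⧸ H) := Nat.finite_of_card_ne_zero (by rw [hcard]; exact Nat.card_pos.ne')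
  have hf : Function.Injective f := by
    intro x y hxy
    obtain ⟨d, hd⟩ := mem_globalPoints.1 (sub_mem y.2.1 x.2.1)
    have hbox : (1 : Adele k) ⊗ₜ d ∈ box Oi (orderFamily φ O) := by
      rw [hd]
      exact sub_mem y.2.2 x.2.2
    by_cases hd0 : d = 0
    · rw [hd0, TensorProduct.tmul_zero] at hd
      exact Subtype.ext (sub_eq_zero.1 hd.symm).symm
    exfalso
    have hsmall : ∀ i, valAt v (φ v hv (1 ⊗ₜ d) i 0) < 1 := by
      intro i
      have h1 := QuotientAddGroup.eq.1 (congrFun hxy i)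
      have h2 : valAt v (-(φ v hv (compAt v x.1) i 0) + φ v hv (compAt v y.1) i 0) ≤
        exp (-1 : ℤ) := h1
      rw [neg_add_eq_sub, ← Matrix.sub_apply, ← map_sub, ← map_sub, ← hd, compAt_global] at h2
      exact lt_one_iff_le_exp.2 h2
    have hinv := inv_mem_orderBox h₀ hi hφ hd0 hbox
    have h3 : φ v hv (1 ⊗ₜ d⁻¹) * φ v hv (1 ⊗ₜ d) = 1 := by
      rw [← map_mul, Algebra.TensorProduct.tmul_mul_tmul, one_mul, inv_mul_cancel₀ hd0,
        ← Algebra.TensorProduct.one_def, map_one]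
    have h4 := congrArg (fun M => valAt v (M 0 0)) h3
    simp only [Matrix.mul_apply, Matrix.one_apply_eq, map_one] at h4
    refine absurd h4 (ne_of_lt ((valAt v).map_sum_lt one_ne_zero fun j _ => ?_))
    rw [map_mul]
    refine mul_lt_one_of_nonneg_of_lt_one_right ?_ zero_le (hsmall j)
    have h5 := (mem_box.1 hinv).2 v
    rw [orderFamily_of_ne hv, compAt_global] at h5
    exact h5 0 j
  refine (Nat.card_le_card_of_injective f hf).trans ?_
  rw [Nat.card_fun, hcard, Nat.card_eq_fintype_card (α := Fin n), Fintype.card_fin]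

/-- The Euler characteristic is at most |H⁰| and so at most `q ^ n`. With the value of its square
this forces `r₀ + r ≤ 2`, and both are positive. -/
lemma euler_order [NeZero n] [Fact p.Prime] [CharP k p] (hq : q = Nat.card k)
    (hφ : IsCoherent φ) :
    r₀ = 1 ∧ r = 1 ∧ euler (globalPoints k D) (box Oi (orderFamily φ O)) = (q : ℚ) ^ n := by
  have h1 := euler_order_pow h₀ hi hq hφ
  have hb := (isLatticeFamily_order h₀ hi hφ).isBounded
  have h2 : euler (globalPoints k D) (box Oi (orderFamily φ O)) ≤ (q : ℚ) ^ n := by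
    refine (euler_le_card hb).trans ?_
    rw [hq]
    exact_mod_cast card_inf_orderBox_le h₀ hi hφ
  have h3 := euler_pos hb
  have hq1 : 1 < q := by
    rw [hq]
    exact Finite.one_lt_card
  have hr₀ := h₀.pos
  have hr := hi.pos
  have hn := Nat.pos_of_ne_zero (NeZero.ne n)
  have h4 : (q : ℚ) ^ ((r₀ + r) * n) ≤ (q : ℚ) ^ (n * 2) := by
    rw [← h1, pow_mul]
    exact pow_le_pow_left₀ h3.le h2 2
  have h5 : (r₀ + r) * n ≤ n * 2 :=
    (pow_le_pow_iff_right₀ (by exact_mod_cast hq1)).1 h4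
  have h6 : r₀ + r ≤ 2 := by
    rw [Nat.mul_comm n] at h5
    exact Nat.le_of_mul_le_mul_right h5 hn
  obtain rfl : r₀ = 1 := by omega
  obtain rfl : r = 1 := by omega
  refine ⟨rfl, rfl, ?_⟩
  rw [show (1 + 1) * n = n * 2 by ring, pow_mul] at h1
  exact (pow_left_inj₀ h3.le (by positivity) two_ne_zero).1 h1

end CardinalityBound


/-! ### Global elements with prescribed integrality and congruence conditions. -/

section GlobalUnits

open WithZero
open scoped WithZero Valued

variable {k : Type*} [Field k] {D : Type*} [DivisionRing D] [Algebra (RatFunc k) D] {n : ℕ}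
variable {φ : Identifications k D n} {O : AddSubgroup (AlgAt D (idealX k))}
variable {Oi : AddSubgroup (AlgInfty k D)}
variable {q p r₀ r : ℕ} {J : AddSubgroup (AlgAt D (idealX k))} {Ji : AddSubgroup (AlgInfty k D)}
variable {w : Valuation (AlgInfty k D) ℤᵐ⁰}

lemma one_tmul_mul {A : Type*} [CommRing A] [Algebra (RatFunc k) A] (x y : D) :
    (1 : A) ⊗ₜ[RatFunc k] (x * y) = 1 ⊗ₜ x * 1 ⊗ₜ y := by
  rw [Algebra.TensorProduct.tmul_mul_tmul, one_mul]

lemma val_sub_one_lt_of_mul_eq_one {R : Type*} [Ring R] {w : Valuation R ℤᵐ⁰} {x y : R}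
    (hx : w (x - 1) < 1) (hyx : y * x = 1) : w (y - 1) < 1 := by
  have h1 : w x = 1 := by
    have := w.map_add_eq_of_lt_right (x := x - 1) (y := 1) (by rwa [map_one])
    rwa [sub_add_cancel, map_one] at this
  have h2 : w y = 1 := by
    have := congrArg w hyx
    rwa [map_mul, h1, mul_one, map_one] at this
  have h3 : y - 1 = y * (1 - x) := by rw [mul_sub, hyx, mul_one]
  rwa [h3, map_mul, h2, one_mul, Valuation.map_sub_swap]

lemma mem_KAt_iff {v : FinitePlace k} {hv : v ≠ idealX k} {u : GAt D v} :
    u ∈ KAt φ v hv ↔ (u : AlgAt D v) ∈ matrixOrder (valAt v) (φ v hv) ∧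
      ((u⁻¹ : GAt D v) : AlgAt D v) ∈ matrixOrder (valAt v) (φ v hv) := by
  refine ⟨fun h => ⟨integral_of_mem_KAt h, integral_of_mem_KAt (inv_mem h)⟩, fun ⟨h1, h2⟩ => ?_⟩
  let M : Matrix (Fin n) (Fin n) (IntegersAt v) := Matrix.of fun i j => ⟨φ v hv u i j, h1 i j⟩
  let M' : Matrix (Fin n) (Fin n) (IntegersAt v) :=
    Matrix.of fun i j => ⟨φ v hv ((u⁻¹ : GAt D v) : AlgAt D v) i j, h2 i j⟩
  have hinj : Function.Injective fun N : Matrix (Fin n) (Fin n) (IntegersAt v) =>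
      N.map (algebraMap (IntegersAt v) (CompletionAt v)) :=
    Matrix.map_injective Subtype.val_injective
  have hM : M.map (algebraMap (IntegersAt v) (CompletionAt v)) = φ v hv u := rfl
  have hM' : M'.map (algebraMap (IntegersAt v) (CompletionAt v)) =
    φ v hv ((u⁻¹ : GAt D v) : AlgAt D v) := rfl
  have hone : (1 : Matrix (Fin n) (Fin n) (IntegersAt v)).map
      (algebraMap (IntegersAt v) (CompletionAt v)) = 1 :=
    Matrix.map_one _ (map_zero _) (map_one _)
  refine ⟨⟨M, M', hinj ?_, hinj ?_⟩, Units.ext hM⟩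
  · change (M * M').map _ = Matrix.map 1 _
    rw [Matrix.map_mul, hM, hM', hone, ← map_mul, Units.mul_inv, map_one]
  · change (M' * M).map _ = Matrix.map 1 _
    rw [Matrix.map_mul, hM, hM', hone, ← map_mul, Units.inv_mul, map_one]

variable [Finite k] [FiniteDimensional (RatFunc k) D] [Algebra.IsCentral (RatFunc k) D]
variable (h₀ : IsLocalOrder (valAt (idealX k)) q p n r₀ O J)
variable (hi : IsLocalOrder (valInfty k) q p n r Oi Ji) (hφ : IsCoherent φ)
variable (hOi : Oi = ball w 1) (hJi : ∀ x, x ∈ Ji ↔ w x < 1)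

include h₀ hi hφ hOi

/-- If `d - 1` were nonzero, its inverse would be a section too, which is impossible at infinity,
where `d - 1` has value less than 1. -/
lemma eq_one_of_mem_orderBox {d : D} (hd : (1 : Adele k) ⊗ₜ d ∈ box Oi (orderFamily φ O))
    (hw : w (1 ⊗ₜ d - 1) < 1) : d = 1 := by
  by_contra hne
  have hsub : (1 : Adele k) ⊗ₜ (d - 1) ∈ box Oi (orderFamily φ O) := by
    rw [TensorProduct.tmul_sub, ← Algebra.TensorProduct.one_def]
    exact sub_mem hd (one_mem_orderBox h₀ hi)
  have hne' := sub_ne_zero.2 hne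
  have hinv := (mem_box.1 (inv_mem_orderBox h₀ hi hφ hne' hsub)).1
  rw [compInfty_global, hOi, mem_ball] at hinv
  have h1 : (1 : CompletionInfty k) ⊗ₜ[RatFunc k] (d - 1)⁻¹ * 1 ⊗ₜ (d - 1) = 1 := by
    rw [← one_tmul_mul, inv_mul_cancel₀ hne', Algebra.TensorProduct.one_def]
  have h2 := congrArg w h1
  rw [map_mul, map_one, TensorProduct.tmul_sub, ← Algebra.TensorProduct.one_def] at h2
  exact (mul_lt_one_of_nonneg_of_lt_one_right hinv zero_le hw).ne h2

/-- No condition at 0 is needed: since `w₀` is a valuation, `d` or `d⁻¹` is integral there, and both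
satisfy the remaining conditions. -/
lemma eq_one_of_units {w₀ : Valuation (AlgAt D (idealX k)) ℤᵐ⁰} (hO : O = ball w₀ 1) {d : D}
    (hd0 : d ≠ 0) (hd : ∀ v (hv : v ≠ idealX k), (1 : CompletionAt v) ⊗ₜ d ∈
      matrixOrder (valAt v) (φ v hv) ∧ (1 : CompletionAt v) ⊗ₜ d⁻¹ ∈ matrixOrder (valAt v) (φ v hv))
    (hw : w (1 ⊗ₜ d - 1) < 1) : d = 1 := by
  have hmem : ∀ x : D, w₀ (1 ⊗ₜ x) ≤ 1 → w (1 ⊗ₜ x - 1) < 1 → (∀ v (hv : v ≠ idealX k),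
      (1 : CompletionAt v) ⊗ₜ x ∈ matrixOrder (valAt v) (φ v hv)) →
      (1 : Adele k) ⊗ₜ x ∈ box Oi (orderFamily φ O) := by
    intro x h1 h2 h3
    refine mem_box.2 ⟨?_, fun v => ?_⟩
    · rw [compInfty_global, hOi, mem_ball, ← sub_add_cancel ((1 : CompletionInfty k) ⊗ₜ x) 1]
      exact (w.map_add _ _).trans (max_le h2.le w.map_one.le)
    · rw [compAt_global]
      by_cases hv : v = idealX k
      · subst hv
        rw [orderFamily_zero, hO]
        exact h1
      · rw [orderFamily_of_ne hv]
        exact h3 v hv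
  rcases le_total (w₀ (1 ⊗ₜ d)) 1 with h | h
  · exact eq_one_of_mem_orderBox h₀ hi hφ hOi (hmem d h hw fun v hv => (hd v hv).1) hw
  · have h1 : (1 : CompletionAt (idealX k)) ⊗ₜ[RatFunc k] d⁻¹ * 1 ⊗ₜ d = 1 := by
      rw [← one_tmul_mul, inv_mul_cancel₀ hd0, Algebra.TensorProduct.one_def]
    have h2 : w₀ (1 ⊗ₜ d⁻¹) ≤ 1 := by
      have h3 := congrArg w₀ h1
      rw [map_mul, map_one] at h3
      by_contra! hcon
      exact (one_lt_mul_of_lt_of_le' hcon h).ne' h3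
    have hw' : w (1 ⊗ₜ d⁻¹ - 1) < 1 := val_sub_one_lt_of_mul_eq_one hw (by
      rw [← one_tmul_mul, inv_mul_cancel₀ hd0, Algebra.TensorProduct.one_def])
    exact inv_eq_one.1 (eq_one_of_mem_orderBox h₀ hi hφ hOi
      (hmem d⁻¹ h2 hw' fun v hv => (hd v hv).2) hw')

omit hOi in
/-- A translate of the order family which has the same Euler characteristic and contains a nonzero
global point is generated by it. -/
lemma translate_eq_of_mem (hE : euler (globalPoints k D) (box Oi (orderFamily φ O)) = (q : ℚ) ^ n)
    {x : GAdele k D}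
    (hx : euler (globalPoints k D) (translate x (box Oi (orderFamily φ O))) ≤ (q : ℚ) ^ n) {d : Dˣ}
    (hd : (1 : Adele k) ⊗ₜ (d : D) ∈ translate x (box Oi (orderFamily φ O))) :
    translate (diag k D d) (box Oi (orderFamily φ O)) =
      translate x (box Oi (orderFamily φ O)) := by
  have hA := isLatticeFamily_order h₀ hi hφ
  have hmul : ∀ᶠ v in Filter.cofinite, ∀ x ∈ orderFamily φ O v, ∀ y ∈ orderFamily φ O v,
      x * y ∈ orderFamily φ O v :=
    Filter.Eventually.of_forall fun v x hx y hy => mul_mem_orderFamily h₀ v hx hy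
  have hle : translate (diag k D d) (box Oi (orderFamily φ O)) ≤
      translate x (box Oi (orderFamily φ O)) := by
    intro y hy
    have h1 := mul_mem_orderBox h₀ hi (mem_translate.1 hy) (mem_translate.1 hd)
    have h2 : ((diag k D d : GAdele k D) : Adele k ⊗[RatFunc k] D) = 1 ⊗ₜ (d : D) := rfl
    rwa [← h2, ← mul_assoc, Units.inv_mul_cancel_right] at h1
  have hc := ((hA.translate hmul x).index_box (hA.translate hmul (diag k D d))).1
  rw [box_translate, box_translate] at hc
  have hEd := euler_translate (translate_diag d) (box Oi (orderFamily φ O))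
  have hb : IsBounded (globalPoints k D) (translate (diag k D d) (box Oi (orderFamily φ O))) := by
    rw [← box_translate]
    exact (hA.translate hmul (diag k D d)).isBounded
  have h1 := euler_eq hc hb
  rw [h1, hEd] at hx
  have hpos := euler_pos hA.isBounded
  refine eq_of_genIndex_eq_one hle (le_antisymm ?_ (one_le_genIndex hle hc))
  rw [← hE] at hx
  exact (mul_le_iff_le_one_left hpos).1 hx

include hJi

/-- Let `U` be the right translate by `x` of the order box, and `U'` the same with the radical at
infinity. Every nonzero section of `U` generates `U`, so `U'` has no nonzero section. As `[U : U']`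
is `q ^ n` and `U` has at least that many sections, `Γ + U'` contains `x`. -/
lemma exists_approx_global
    (hE : euler (globalPoints k D) (box Oi (orderFamily φ O)) = (q : ℚ) ^ n)
    (hrel : Ji.relIndex Oi = q ^ n) (hq : q ≠ 0) {x : GAdele k D}
    (hx1 : 1 < euler (globalPoints k D) (translate x (box Oi (orderFamily φ O))))
    (hx : euler (globalPoints k D) (translate x (box Oi (orderFamily φ O))) ≤ (q : ℚ) ^ n) :
    ∃ d : Dˣ, (1 : Adele k) ⊗ₜ (d : D) ∈ translate x (box Oi (orderFamily φ O)) ∧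
      translate (diag k D d) (box Oi (orderFamily φ O)) =
        translate x (box Oi (orderFamily φ O)) ∧
      w (1 ⊗ₜ (d : D) * (((unitInfty x)⁻¹ : GInfty k D) : AlgInfty k D) - 1) < 1 := by
  have hA := isLatticeFamily_order h₀ hi hφ
  have hmul : ∀ᶠ v in Filter.cofinite, ∀ x ∈ orderFamily φ O v, ∀ y ∈ orderFamily φ O v,
      x * y ∈ orderFamily φ O v :=
    Filter.Eventually.of_forall fun v x hx y hy => mul_mem_orderFamily h₀ v hx hy
  set U := translate x (box Oi (orderFamily φ O)) with hU
  set U' := translate x (box Ji (orderFamily φ O)) with hU'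
  have hb : IsBounded (globalPoints k D) U := by
    rw [hU, ← box_translate]
    exact (hA.translate hmul x).isBounded
  have hJO : Ji ≤ Oi := hi.le
  have hbox : box Ji (orderFamily φ O) ≤ box Oi (orderFamily φ O) := fun y hy =>
    mem_box.2 ⟨hJO (mem_box.1 hy).1, (mem_box.1 hy).2⟩
  have hUU' : U' ≤ U := fun y hy => hbox hy
  have hxU : (x : Adele k ⊗[RatFunc k] D) ∈ U := by
    rw [hU, mem_translate, Units.mul_inv]
    exact one_mem_orderBox h₀ hi
  have hxU' : (x : Adele k ⊗[RatFunc k] D) ∉ U' := by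
    rw [hU', mem_translate, Units.mul_inv, mem_box, map_one, hJi, map_one]
    exact fun h => lt_irrefl _ h.1
  have hgen : ∀ d : Dˣ, (1 : Adele k) ⊗ₜ (d : D) ∈ U →
      translate (diag k D d) (box Oi (orderFamily φ O)) = U := fun d hd =>
    translate_eq_of_mem h₀ hi hφ hE hx hd
  -- A nonzero section `d` of `U'` generates `U`, so x x⁻¹ = (x d⁻¹)(d x⁻¹) with the first factor
  -- integral and the second in the radical at infinity; but it equals 1.
  have hbot : globalPoints k D ⊓ U' = ⊥ := by
    rw [eq_bot_iff]
    rintro _ ⟨⟨d, rfl⟩, hd⟩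
    have hd : (1 : Adele k) ⊗ₜ[RatFunc k] d ∈ U' := hd
    by_cases hd0 : d = 0
    · rw [hd0]
      exact AddSubgroup.mem_bot.2 (TensorProduct.tmul_zero _ _)
    exfalso
    refine hxU' ?_
    have h1 : (x : Adele k ⊗[RatFunc k] D) ∈
        translate (diag k D (Units.mk0 d hd0)) (box Oi (orderFamily φ O)) := by
      rw [hgen (Units.mk0 d hd0) (hUU' hd)]
      exact hxU
    rw [mem_translate, mem_box] at h1
    rw [hU', mem_translate, mem_box] at hd ⊢
    have h2 : ((diag k D (Units.mk0 d hd0) : GAdele k D) : Adele k ⊗[RatFunc k] D) = 1 ⊗ₜ d := rfl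
    have h3 : (x : Adele k ⊗[RatFunc k] D) * ((x⁻¹ : GAdele k D) : Adele k ⊗[RatFunc k] D) =
        (x : Adele k ⊗[RatFunc k] D) *
          (((diag k D (Units.mk0 d hd0))⁻¹ : GAdele k D) : Adele k ⊗[RatFunc k] D) *
          (1 ⊗ₜ d * ((x⁻¹ : GAdele k D) : Adele k ⊗[RatFunc k] D)) := by
      rw [← h2, ← mul_assoc, Units.inv_mul_cancel_right]
    rw [h3]
    refine ⟨?_, fun v => ?_⟩
    · have h4 := h1.1
      have h5 := hd.1
      rw [hOi, mem_ball] at h4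
      rw [hJi] at h5 ⊢
      rw [map_mul, map_mul]
      exact mul_lt_one_of_nonneg_of_lt_one_right h4 zero_le h5
    · rw [map_mul]
      exact mul_mem_orderFamily h₀ v (h1.2 v) (hd.2 v)
  have hindex : U'.relIndex U = q ^ n := by
    rw [hU, hU', translate_eq_map, translate_eq_map,
      AddSubgroup.relIndex_map_map_of_injective _ _ (AddEquiv.injective _), relIndex_box_infty, hrel]
  have hcard := euler_le_card hb
  have hnt : Nontrivial ↥(globalPoints k D ⊓ U) := by
    have := Nat.finite_of_card_ne_zero hb.1
    refine Finite.one_lt_card_iff_nontrivial.1 ?_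
    exact_mod_cast hx1.trans_le hcard
  -- The strict bound `1 < euler` provides a nonzero section, whose existence makes the Euler
  -- characteristic exactly `q ^ n`.
  obtain ⟨⟨y, ⟨d₁, rfl⟩, hd₁⟩, hne⟩ := exists_ne (0 : ↥(globalPoints k D ⊓ U))
  have hd₁0 : d₁ ≠ 0 := by
    rintro rfl
    exact hne (Subtype.ext (TensorProduct.tmul_zero _ _))
  have hEU : euler (globalPoints k D) U = (q : ℚ) ^ n := by
    rw [← hgen (Units.mk0 d₁ hd₁0) hd₁, euler_translate (translate_diag _), hE]
  rw [hEU] at hcard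
  have hcard : q ^ n ≤ Nat.card ↥(globalPoints k D ⊓ U) := by exact_mod_cast hcard
  have hsplit := relIndex_eq_mul_relIndex (Γ := globalPoints k D) hUU'
  rw [hindex, hbot, AddSubgroup.relIndex_bot_left] at hsplit
  have hqn : 0 < q ^ n := pow_pos (Nat.pos_of_ne_zero hq) n
  -- The index `q ^ n` is the number of sections, at least `q ^ n`, times this factor.
  have hone : (globalPoints k D ⊔ U').relIndex (globalPoints k D ⊔ U) = 1 := by
    set s := (globalPoints k D ⊔ U').relIndex (globalPoints k D ⊔ U)
    rcases Nat.lt_trichotomy s 1 with h | h | h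
    · rw [Nat.lt_one_iff.1 h, mul_zero] at hsplit
      omega
    · exact h
    · nlinarith
  have hxs : (x : Adele k ⊗[RatFunc k] D) ∈ globalPoints k D ⊔ U' :=
    AddSubgroup.relIndex_eq_one.1 hone (AddSubgroup.mem_sup_right hxU)
  obtain ⟨_, ⟨d, rfl⟩, u, hu, hxu⟩ := AddSubgroup.mem_sup.1 hxs
  have hxu : (1 : Adele k) ⊗ₜ[RatFunc k] d + u = x := hxu
  have hd0 : d ≠ 0 := by
    rintro rfl
    rw [TensorProduct.tmul_zero, zero_add] at hxu
    exact hxU' (hxu ▸ hu)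
  have hdU : (1 : Adele k) ⊗ₜ[RatFunc k] d ∈ U := by
    rw [eq_sub_of_add_eq hxu]
    exact sub_mem hxU (hUU' hu)
  refine ⟨Units.mk0 d hd0, hdU, hgen _ hdU, ?_⟩
  have h1 := (mem_box.1 (mem_translate.1 hu)).1
  rw [hJi] at h1
  have h2 : (1 : CompletionInfty k) ⊗ₜ[RatFunc k] d *
      (((unitInfty x)⁻¹ : GInfty k D) : AlgInfty k D) - 1 =
      - compInfty (u * ((x⁻¹ : GAdele k D) : Adele k ⊗[RatFunc k] D)) := by
    rw [eq_sub_of_add_eq' hxu, sub_mul, Units.mul_inv, map_sub, map_one, map_mul, compInfty_global,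
      ← map_inv]
    change _ = -(1 - (1 : CompletionInfty k) ⊗ₜ[RatFunc k] d *
      compInfty ((x⁻¹ : GAdele k D) : Adele k ⊗[RatFunc k] D))
    rw [neg_sub]
    rfl
  change w ((1 : CompletionInfty k) ⊗ₜ[RatFunc k] d * _ - 1) < 1
  rw [h2, Valuation.map_neg]
  exact h1

end GlobalUnits


/-! ### Components of the multiplication map, injectivity and surjectivity. -/

section Kappa

open WithZero
open scoped WithZero Valued

variable {k : Type*} [Field k] {D : Type*} [DivisionRing D] [Algebra (RatFunc k) D]
variable [FiniteDimensional (RatFunc k) D] [Algebra.IsCentral (RatFunc k) D] {n : ℕ}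
variable {φ : Identifications k D n} (hφ : IsCoherent φ)

omit [FiniteDimensional (RatFunc k) D] [Algebra.IsCentral (RatFunc k) D] in
lemma unitAt_diag (v : FinitePlace k) (d : Dˣ) :
    (unitAt v (diag k D d) : AlgAt D v) = 1 ⊗ₜ (d : D) := compAt_global v (d : D)

omit [FiniteDimensional (RatFunc k) D] [Algebra.IsCentral (RatFunc k) D] in
lemma unitInfty_diag (d : Dˣ) :
    (unitInfty (diag k D d) : AlgInfty k D) = 1 ⊗ₜ (d : D) := compInfty_global (d : D)

omit [FiniteDimensional (RatFunc k) D] [Algebra.IsCentral (RatFunc k) D] in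
lemma eq_of_units {x y : GAdele k D} (hi : unitInfty x = unitInfty y)
    (h : ∀ v, unitAt v x = unitAt v y) : x = y :=
  Units.ext (eq_of_components (congrArg Units.val hi) fun v => congrArg Units.val (h v))

lemma unitInfty_inclG0 (g : GAt D (idealX k)) : unitInfty (inclG0 hφ g) = 1 :=
  Units.ext (adelicPoint_spec hφ _ _ _).1

open Classical in
lemma unitAt_inclG0 (g : GAt D (idealX k)) : unitAt (idealX k) (inclG0 hφ g) = g :=
  Units.ext (((adelicPoint_spec hφ _ _ _).2 (idealX k)).trans (by rw [Function.update_self]))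

open Classical in
lemma unitAt_inclG0_of_ne (g : GAt D (idealX k)) {v : FinitePlace k} (hv : v ≠ idealX k) :
    unitAt v (inclG0 hφ g) = 1 :=
  Units.ext (((adelicPoint_spec hφ _ _ _).2 v).trans (by rw [Function.update_of_ne hv]; rfl))

lemma unitInfty_kappa (g : GAt D (idealX k)) (c : K1 φ) (d : Dˣ) :
    unitInfty (kappa hφ (g, c, d)) = c.2 * unitInfty (diag k D d) := by
  have h : unitInfty (inclK1 hφ c) = c.2 := Units.ext (adelicPoint_spec hφ _ _ _).1
  rw [kappa, map_mul, map_mul, h, unitInfty_inclG0, one_mul]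

lemma unitAt_kappa (g : GAt D (idealX k)) (c : K1 φ) (d : Dˣ) :
    unitAt (idealX k) (kappa hφ (g, c, d)) = g * unitAt (idealX k) (diag k D d) := by
  have h : unitAt (idealX k) (inclK1 hφ c) = 1 :=
    Units.ext (((adelicPoint_spec hφ _ _ _).2 (idealX k)).trans (by rw [dif_neg (by simp)]))
  rw [kappa, map_mul, map_mul, h, unitAt_inclG0, mul_one]

lemma unitAt_kappa_of_ne (g : GAt D (idealX k)) (c : K1 φ) (d : Dˣ) {v : FinitePlace k}
    (hv : v ≠ idealX k) :
    unitAt v (kappa hφ (g, c, d)) = (c.1 ⟨v, hv⟩ : GAt D v) * unitAt v (diag k D d) := by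
  have h : unitAt v (inclK1 hφ c) = (c.1 ⟨v, hv⟩ : GAt D v) :=
    Units.ext (((adelicPoint_spec hφ _ _ _).2 v).trans (by rw [dif_pos hv]))
  rw [kappa, map_mul, map_mul, h, unitAt_inclG0_of_ne hφ g hv, one_mul]

lemma kappa_mul (g g' : GAt D (idealX k)) (c : K1 φ) (d : Dˣ) :
    inclG0 hφ g' * kappa hφ (g, c, d) = kappa hφ (g' * g, c, d) := by
  refine eq_of_units ?_ fun v => ?_
  · rw [map_mul, unitInfty_inclG0, one_mul, unitInfty_kappa, unitInfty_kappa]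
  · by_cases hv : v = idealX k
    · subst hv
      rw [map_mul, unitAt_inclG0, unitAt_kappa, unitAt_kappa, mul_assoc]
    · rw [map_mul, unitAt_inclG0_of_ne hφ _ hv, one_mul, unitAt_kappa_of_ne hφ _ _ _ hv,
        unitAt_kappa_of_ne hφ _ _ _ hv]

variable {O : AddSubgroup (AlgAt D (idealX k))} {Oi : AddSubgroup (AlgInfty k D)}
variable {q p r₀ r : ℕ} {J : AddSubgroup (AlgAt D (idealX k))} {Ji : AddSubgroup (AlgInfty k D)}
variable {w : Valuation (AlgInfty k D) ℤᵐ⁰} {w₀ : Valuation (AlgAt D (idealX k)) ℤᵐ⁰}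

variable [Finite k]
variable (h₀ : IsLocalOrder (valAt (idealX k)) q p n r₀ O J)
variable (hi : IsLocalOrder (valInfty k) q p n r Oi Ji)
variable (hOi : Oi = ball w 1) (hJi : ∀ x, x ∈ Ji ↔ w x < 1)
variable (hN : ∀ x, valInfty k (reducedNorm (CompletionInfty k) x) < 1 ↔ w x < 1)

include h₀ hi hOi hN

/-- Comparing components shows that `d' * d⁻¹` lies in `K_v` for every finite `v ≠ 0` and is
congruent to 1 at infinity, so it is 1 by `eq_one_of_units`; the other components then cancel. -/
lemma kappa_injective (hO : O = ball w₀ 1) : Function.Injective (kappa hφ) := by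
  rintro ⟨g, c, d⟩ ⟨g', c', d'⟩ h
  have hc : ∀ {e : GInfty k D}, e ∈ K1Infty k D → w ((e : AlgInfty k D) - 1) < 1 :=
    fun {e} he => (hN _).1 he
  have hδ : d' * d⁻¹ = 1 := by
    refine Units.ext (eq_one_of_units h₀ hi hφ hOi hO (d' * d⁻¹).ne_zero (fun v hv => ?_) ?_)
    · have h1 := congrArg (unitAt v) h
      rw [unitAt_kappa_of_ne hφ _ _ _ hv, unitAt_kappa_of_ne hφ _ _ _ hv] at h1
      have h2 : unitAt v (diag k D (d' * d⁻¹)) ∈ KAt φ v hv := by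
        rw [map_mul, map_mul, map_inv, map_inv, ← inv_mul_eq_iff_eq_mul.2 h1, mul_assoc,
          mul_inv_cancel_right]
        exact mul_mem (inv_mem (c'.1 ⟨v, hv⟩).2) (c.1 ⟨v, hv⟩).2
      obtain ⟨h3, h4⟩ := mem_KAt_iff.1 h2
      rw [← map_inv, ← map_inv, unitAt_diag, Units.val_inv_eq_inv_val] at h4
      rw [unitAt_diag] at h3
      exact ⟨h3, h4⟩
    · have h1 := congrArg unitInfty h
      rw [unitInfty_kappa, unitInfty_kappa] at h1
      have h2 : unitInfty (diag k D (d' * d⁻¹)) =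
          (c'.2 : GInfty k D)⁻¹ * (c.2 : GInfty k D) := by
        rw [map_mul, map_mul, map_inv, map_inv, ← inv_mul_eq_iff_eq_mul.2 h1, mul_assoc,
          mul_inv_cancel_right]
      rw [← unitInfty_diag, h2]
      have h3 := hc c.2.2
      have h4 := hc c'.2.2
      have h5 := val_sub_one_lt_of_mul_eq_one h4 (Units.inv_mul _)
      have h6 : w (((c'.2 : GInfty k D)⁻¹ : GInfty k D) : AlgInfty k D) ≤ 1 := by
        rw [← sub_add_cancel ((((c'.2 : GInfty k D)⁻¹ : GInfty k D) : AlgInfty k D)) 1]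
        exact (w.map_add _ _).trans (max_le h5.le w.map_one.le)
      have h7 : (((c'.2 : GInfty k D)⁻¹ * (c.2 : GInfty k D) : GInfty k D) : AlgInfty k D) - 1 =
          (((c'.2 : GInfty k D)⁻¹ : GInfty k D) : AlgInfty k D) *
            (((c.2 : GInfty k D) : AlgInfty k D) - 1) +
          ((((c'.2 : GInfty k D)⁻¹ : GInfty k D) : AlgInfty k D) - 1) := by
        rw [Units.val_mul, mul_sub, mul_one]
        abel
      rw [h7]
      refine (w.map_add _ _).trans_lt (max_lt ?_ h5)
      rw [map_mul]
      exact mul_lt_one_of_nonneg_of_lt_one_right h6 zero_le h3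
  obtain rfl : d' = d := mul_inv_eq_one.1 hδ
  refine Prod.ext ?_ (Prod.ext (Prod.ext (funext fun v => Subtype.ext ?_) (Subtype.ext ?_)) rfl)
  · have h1 := congrArg (unitAt (idealX k)) h
    rw [unitAt_kappa, unitAt_kappa] at h1
    exact mul_right_cancel h1
  · have h1 := congrArg (unitAt v.1) h
    rw [unitAt_kappa_of_ne hφ _ _ _ v.2, unitAt_kappa_of_ne hφ _ _ _ v.2] at h1
    exact mul_right_cancel h1
  · have h1 := congrArg unitInfty h
    rw [unitInfty_kappa, unitInfty_kappa] at h1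
    exact mul_right_cancel h1

include hJi

/-- For the `d` of `exists_approx_global`, `x` and `d` generate the same left module over the
orders, so x d⁻¹ and its inverse are integral at every place other than 0 and ∞. The congruence
places its component at infinity in K¹_∞, and the component at 0 is unrestricted. -/
lemma mem_range_kappa_of_euler
    (hE : euler (globalPoints k D) (box Oi (orderFamily φ O)) = (q : ℚ) ^ n)
    (hrel : Ji.relIndex Oi = q ^ n) (hq : q ≠ 0) {x : GAdele k D}
    (hx1 : 1 < euler (globalPoints k D) (translate x (box Oi (orderFamily φ O))))
    (hx : euler (globalPoints k D) (translate x (box Oi (orderFamily φ O))) ≤ (q : ℚ) ^ n) :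
    x ∈ Set.range (kappa hφ) := by
  obtain ⟨d, hd, hU, hw⟩ := exists_approx_global h₀ hi hφ hOi hJi hE hrel hq hx1 hx
  have hx' : (x : Adele k ⊗[RatFunc k] D) ∈ translate (diag k D d) (box Oi (orderFamily φ O)) := by
    rw [hU, mem_translate, Units.mul_inv]
    exact one_mem_orderBox h₀ hi
  have hK : ∀ v (hv : v ≠ idealX k), unitAt v (x * (diag k D d)⁻¹) ∈ KAt φ v hv := by
    intro v hv
    rw [mem_KAt_iff, ← orderFamily_of_ne (O := O) hv]
    refine ⟨(mem_box.1 (mem_translate.1 hx')).2 v, ?_⟩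
    have := (mem_box.1 (mem_translate.1 hd)).2 v
    rw [← map_inv, mul_inv_rev, inv_inv]
    exact this
  have hKi : unitInfty (x * (diag k D d)⁻¹) ∈ K1Infty k D := by
    refine (hN _).2 (val_sub_one_lt_of_mul_eq_one hw ?_)
    rw [← unitInfty_diag, ← Units.val_mul, ← Units.val_mul, map_mul, map_inv]
    simp
  refine ⟨(unitAt (idealX k) (x * (diag k D d)⁻¹), (fun v => ⟨_, hK v.1 v.2⟩, ⟨_, hKi⟩), d),
    eq_of_units ?_ fun v => ?_⟩
  · rw [unitInfty_kappa, ← map_mul, inv_mul_cancel_right]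
  · by_cases hv : v = idealX k
    · subst hv
      rw [unitAt_kappa, ← map_mul, inv_mul_cancel_right]
    · rw [unitAt_kappa_of_ne hφ _ _ _ hv, ← map_mul, inv_mul_cancel_right]

omit hi hOi hN hJi in
-- Only the lattice at 0 changes, from a translate of `O` to the same translate of `J`, which has
-- index `q ^ n` in it.
lemma euler_translate_inclG0 (hi : IsLocalOrder (valInfty k) q p n r Oi Ji) {π : GAt D (idealX k)}
    (hπ : translate π O = J) (hrel : J.relIndex O = q ^ n) (hq : q ≠ 0) (x : GAdele k D) :
    euler (globalPoints k D) (translate (inclG0 hφ π * x) (box Oi (orderFamily φ O))) * (q : ℚ) ^ n =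
      euler (globalPoints k D) (translate x (box Oi (orderFamily φ O))) := by
  have hA := isLatticeFamily_order h₀ hi hφ
  have hmul : ∀ᶠ v in Filter.cofinite, ∀ x ∈ orderFamily φ O v, ∀ y ∈ orderFamily φ O v,
      x * y ∈ orderFamily φ O v :=
    Filter.Eventually.of_forall fun v x hx y hy => mul_mem_orderFamily h₀ v hx hy
  have h1 := (hA.translate hmul (inclG0 hφ π * x)).euler_box (hA.translate hmul x)
  rw [box_translate, box_translate, map_mul, unitInfty_inclG0, one_mul, genIndex_self, one_mul,
    finprod_eq_single _ (idealX k), orderFamily_zero, map_mul, unitAt_inclG0] at h1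
  · have h2 : translate (π * unitAt (idealX k) x) O = translate (unitAt (idealX k) x) J := by
      rw [← hπ]
      ext y
      rw [mem_translate, mem_translate, mem_translate, mul_inv_rev, Units.val_mul, mul_assoc]
    rw [h1, h2, genIndex_translate, ← genIndex_inv, genIndex_of_le h₀.le, hrel]
    have : (q : ℚ) ^ n ≠ 0 := pow_ne_zero _ (by exact_mod_cast hq)
    push_cast
    field_simp
  · intro v hv
    rw [map_mul, unitAt_inclG0_of_ne hφ _ hv, one_mul, genIndex_self]

/-- Powers of `π` in the leftmost factor G_0 shift the Euler characteristic by powers of `q ^ n`,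
and can be absorbed afterwards by `kappa_mul`. -/
lemma kappa_surjective
    (hE : euler (globalPoints k D) (box Oi (orderFamily φ O)) = (q : ℚ) ^ n)
    (hrel : Ji.relIndex Oi = q ^ n) (hrel₀ : J.relIndex O = q ^ n) (hq : 1 < q) (hn : n ≠ 0)
    {π : GAt D (idealX k)} (hπ : translate π O = J) : Function.Surjective (kappa hφ) := by
  intro x
  have hA := isLatticeFamily_order h₀ hi hφ
  have hmul : ∀ᶠ v in Filter.cofinite, ∀ x ∈ orderFamily φ O v, ∀ y ∈ orderFamily φ O v,
      x * y ∈ orderFamily φ O v :=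
    Filter.Eventually.of_forall fun v x hx y hy => mul_mem_orderFamily h₀ v hx hy
  have hq0 : q ≠ 0 := by omega
  have hG : ∀ a b, inclG0 hφ (a * b) = inclG0 hφ a * inclG0 hφ b := by
    intro a b
    refine eq_of_units ?_ fun v => ?_
    · rw [map_mul, unitInfty_inclG0, unitInfty_inclG0, unitInfty_inclG0, one_mul]
    · by_cases hv : v = idealX k
      · subst hv
        rw [map_mul, unitAt_inclG0, unitAt_inclG0, unitAt_inclG0]
      · rw [map_mul, unitAt_inclG0_of_ne hφ _ hv, unitAt_inclG0_of_ne hφ _ hv,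
          unitAt_inclG0_of_ne hφ _ hv, one_mul]
  have hG1 : inclG0 hφ 1 = 1 := mul_left_cancel ((hG 1 1).symm.trans (by rw [mul_one, mul_one]))
  set e : GAdele k D → ℚ := fun y =>
    euler (globalPoints k D) (translate y (box Oi (orderFamily φ O))) with he
  have hy : (1 : ℚ) < (q : ℚ) ^ n := one_lt_pow₀ (by exact_mod_cast hq) hn
  have hy0 : (q : ℚ) ^ n ≠ 0 := by positivity
  have hstep : ∀ j : ℤ, e (inclG0 hφ (π ^ j) * x) * ((q : ℚ) ^ n) ^ j = e x := by
    have hs : ∀ j : ℤ, e (inclG0 hφ (π ^ (j + 1)) * x) * (q : ℚ) ^ n =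
        e (inclG0 hφ (π ^ j) * x) := by
      intro j
      rw [_root_.add_comm, zpow_one_add, hG, mul_assoc]
      exact euler_translate_inclG0 hφ h₀ hi hπ hrel₀ hq0 _
    intro j
    induction j using Int.induction_on with
    | zero => rw [zpow_zero, zpow_zero, hG1, one_mul, mul_one]
    | succ i ih => rw [← ih, ← hs (i : ℤ), zpow_add_one₀ hy0]; ring
    | pred i ih =>
      rw [← ih, ← hs (-(i : ℤ) - 1), sub_add_cancel, mul_assoc, ← zpow_one_add₀ hy0]
      congr 2
      ring
  have hpos : 0 < e x := by
    have := euler_pos (hA.translate hmul x).isBounded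
    rwa [box_translate] at this
  -- The half-open interval matters: strictness below yields a nonzero section, and equality must be
  -- allowed above because the order itself has value `q ^ n`.
  obtain ⟨j, hj1, hj2⟩ := exists_mem_Ioc_zpow hpos hy
  have hzpos : 0 < ((q : ℚ) ^ n) ^ j := by positivity
  rw [← hstep j] at hj1 hj2
  rw [zpow_add_one₀ hy0, mul_comm (_ ^ j)] at hj2
  obtain ⟨⟨g, c, d⟩, hgcd⟩ := mem_range_kappa_of_euler hφ h₀ hi hOi hJi hN hE hrel hq0
    ((lt_mul_iff_one_lt_left hzpos).1 hj1) (le_of_mul_le_mul_right hj2 hzpos)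
  refine ⟨(π ^ (-j) * g, c, d), ?_⟩
  rw [← kappa_mul, hgcd, ← mul_assoc, ← hG, ← zpow_add, neg_add_cancel, zpow_zero, hG1, one_mul]

end Kappa

/-! ### Assembly of the local and global results. -/

section Main

variable {k : Type*} [Field k] [Finite k] {D : Type*} [DivisionRing D] [Algebra (RatFunc k) D]
variable [Algebra.IsCentral (RatFunc k) D] [FiniteDimensional (RatFunc k) D]

open scoped Valued

theorem kappa_bijective {n : ℕ} (hn : Module.finrank (RatFunc k) D = n ^ 2)
    {φ : Identifications k D n} (hφ : IsCoherent φ) : Function.Bijective (kappa hφ) := by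
  obtain ⟨p, hp⟩ := CharP.exists k
  have hfact : Fact p.Prime := ⟨CharP.char_is_prime k p⟩
  have hn0 : n ≠ 0 := by
    rintro rfl
    exact Module.finrank_pos.ne' (hn.trans (zero_pow two_ne_zero))
  have hnz : NeZero n := ⟨hn0⟩
  have hF : CharP (RatFunc k) p :=
    charP_of_injective_algebraMap (algebraMap k (RatFunc k)).injective p
  have hFi : CharP (CompletionInfty k) p :=
    charP_of_injective_algebraMap (algebraMap (RatFunc k) (CompletionInfty k)).injective p
  have hF₀ : CharP (CompletionAt (idealX k)) p :=
    charP_of_injective_algebraMap (algebraMap (RatFunc k) (CompletionAt (idealX k))).injective p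
  have hD := hasCoordinateOperators_of_divisionRing (K := RatFunc k) D
  have hX : placeCard (idealX k) = Nat.card k := by
    rw [placeCard_eq (P := X) irreducible_X rfl, natDegree_X, pow_one]
  have hv₀ : IsDiscreteWithCard (valAt (idealX k)) (Nat.card k) := by
    rw [← hX]
    exact isDiscreteWithCard_at _
  have hvi := isDiscreteWithCard_infty (k := k)
  have hc₀ : CompactSpace 𝒪[CompletionAt (idealX k)] := compactSpace_integer hv₀
  have hci : CompactSpace 𝒪[CompletionInfty k] := compactSpace_integer hvi
  obtain ⟨r₀, O, J, h₀⟩ := exists_isLocalOrder hv₀ p (Module.finrank_baseChange.trans hn)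
    (hD.baseChange (CompletionAt (idealX k)))
  obtain ⟨r, Oi, Ji, hi⟩ := exists_isLocalOrder hvi p (Module.finrank_baseChange.trans hn)
    (hD.baseChange (CompletionInfty k))
  -- From here on the algebras at 0 and ∞ are known to be division algebras, so the `division`
  -- clauses of the local orders apply.
  obtain ⟨rfl, rfl, hE⟩ := euler_order h₀ hi rfl hφ
  obtain ⟨w₀, π, hO, hJ, -, hπ, -⟩ := h₀.division rfl
  obtain ⟨w, -, hOi, hJi, -, -, hN⟩ := hi.division rfl
  have hrel₀ := h₀.relIndex
  have hrel := hi.relIndex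
  rw [one_mul] at hrel₀ hrel
  refine ⟨kappa_injective hφ h₀ hi hOi hN hO,
    kappa_surjective hφ h₀ hi hOi hJi hN hE hrel hrel₀ Finite.one_lt_card hn0 (π := π) ?_⟩
  -- The radical at 0 consists of the elements of value at most that of `π`, that is of the left
  -- multiples of `π` by elements of `O`.
  ext x
  rw [mem_translate, hO, mem_ball, hJ, hπ, map_mul]
  have h1 : w₀ π * w₀ ((π⁻¹ : GAt D (idealX k)) : AlgAt D (idealX k)) = 1 := by
    rw [← map_mul, Units.mul_inv, map_one]
  rw [eq_inv_of_mul_eq_one_right h1,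
    mul_inv_le_iff₀ (zero_lt_iff.2 (left_ne_zero_of_mul_eq_one h1)), one_mul]

end Main

end KappaMap

end

theorem mainTheorem2 {k : Type*} [Field k] [Finite k]
    {D : Type*} [DivisionRing D] [Algebra (RatFunc k) D] [Algebra.IsCentral (RatFunc k) D]
    [FiniteDimensional (RatFunc k) D] (n : ℕ) (hn : Module.finrank (RatFunc k) D = n ^ 2)
    (φ : KappaMap.Identifications k D n) (hφ : KappaMap.IsCoherent φ) :
    Function.Bijective (KappaMap.kappa hφ) := by
  exact KappaMap.kappa_bijective hn hφ
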